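/- Setting. Let $\Sigma$ be the square lattice with vertex set $\mathbb Z^2$, whose edges carry independent coupling constants $J_e$ with a centred Gaussian distribution of variance $v>0$. A state is a map $\sigma$ from the vertices to $\{\pm1\}$; its energy is $-\sum_{xy}J_{xy}\sigma_x\sigma_y$, and an edge $xy$ is satisfied by $\sigma$ if $J_{xy}\sigma_x\sigma_y>0$ and dissatisfied otherwise. A state of $\Sigma$ is a ground state if its energy cannot be lowered by changing finitely many spins. For $n,k\ge 1$ let $C(n,k)$ be the subgraph of $\Sigma$ induced by the vertices $(i,j)$ with $|i|\le k$, $|j|\le n$. A c-groundstate of $C(n,k)$ is a state of $C(n,k)$ whose boundary spins satisfy the maximum possible number of boundary edges and which has minimum energy among the states with the same boundary spins. A plaquette (unit square) is frustrated if an odd number of its four edges have negative coupling constants. The graph $C(n,k)^*$ has the plaquettes of $C(n,k)$ as vertices and, for each non-boundary edge $e$ of $C(n,k)$, an edge $e^*$ joining the two plaquettes that contain $e$. For a state $r$, $DIS(r)^*$ denotes the set of the $e^*$ for the dissatisfied non-boundary edges $e$. The middle plaquette of a horizontal row is the one with lower left corner on the axis $x=0$. For $m<n$, let $DU(n,m,k)$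 and $DL(n,m,k)$ be the sets of the plaquettes of $C(n,k)$ between the heights $m$ and $n$, respectively $-n$ and $-m$. The pair $C(n,k),C(m,k)$ is regular if for all $1\le k'\le k$ both $C(n,k')$ and $C(m,k')$ have an even number of boundary edges with negative coupling constants, and each of $DU(n,m,k)$, $DL(n,m,k)$ has exactly one frustrated plaquette, namely the middle one of its lowest, respectively highest, row. A row $R$ of plaquettes of $C(n,k)$ is an isolation if its middle plaquette $M$ is its only frustrated plaquette and for each horizontal edge $e$ of $R$ not in $M$ we have $|J_e|>\sum_{e'}|J_{e'}|$, the sum being over all edges $e'$ of $\Sigma$ that belong to $M$ or are vertical and incident to a vertex of a plaquette of $R$. $C(n,k)$ is isolated if its top and bottom rows of plaquettes are isolations. Let $A(n,k)$ be the event that there are a c-groundstate $r$ of $C(n-1,k)$, a c-groundstate $s$ of $C(n,k)$ and a path in $DIS(r)^*\,\Delta\,DIS(s)^*$ from a frustrated plaquette of $DU(n,n-1,k)$ to a frustrated plaquette of $DL(n,n-1,k)$ that contains some $e^*$ with $e$ at distance at most $100$ from the origin. Let $R(n,k)$ be the event that $C(n,k),C(n-1,k)$ is a regular pair and $C(n,k)$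 is isolated, and let $R'(n,k)$ be the event that $R(n,k)$ holds and $R(n',k)$ fails for all $k\le n'<n$. **Conjecture 2.** There are a positive integer $c$ and an $\epsilon>0$ such that for all $n,k>c+1$ the conditional probability of $A(n,k)$, given that $R'(n,k)$ holds and that $A(n,k')$ holds for each $c+1<k'<k$ (whenever this condition has positive probability), is at least $$1-(k-c)^{-1}\bigl(\log(k-c)\bigr)^{-1-\epsilon}.$$ **Conjecture 1.** With probability strictly greater than zero there is a nested sequence $S_1\subseteq S_2\subseteq\dots$ of finite sublattices $S_i=C(n_i,k_i)$ whose union is $\Sigma$ such that, whenever $o_j$ is a c-groundstate of $S_{2j-1}$ and $e_j$ is a c-groundstate of $S_{2j}$ for each $j\ge1$, the sequences $(o_j)$ and $(e_j)$ converge (pointwise, up to reversing all spins), and their limits $o,e$ are ground states of $\Sigma$ that are finitely incongruent: the dual edges of the edges satisfied by exactly one of $o,e$ contain a path that is infinite (unbounded) both ways. **Theorem.** For every $v>0$, Conjecture 2 implies Conjecture 1. -/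

import Mathlib

open scoped NNReal

noncomputable section

namespace EASpinGlass

/-! ### The square lattice -/

/-- Vertices of the square lattice. -/
abbrev Site : Type := ℤ × ℤ

/-- Edges of the square lattice: `hor x y` joins `(x, y)` and `(x + 1, y)`,
`ver x y` joins `(x, y)` and `(x, y + 1)`. -/
inductive Edge : Type
  | hor (x y : ℤ) : Edge
  | ver (x y : ℤ) : Edge
  deriving DecidableEq

/-- The left (lower) endpoint of an edge. -/
def Edge.src : Edge → Site
  | .hor x y => (x, y)
  | .ver x y => (x, y)

/-- The right (upper) endpoint of an edge. -/
def Edge.tgt : Edge → Site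
  | .hor x y => (x + 1, y)
  | .ver x y => (x, y + 1)

/-- An assignment of coupling constants to the edges of the square lattice. -/
abbrev Couplings : Type := Edge → ℝ

/-- The law of the coupling constants: independent centred Gaussians of variance `v`. -/
def couplingLaw (v : ℝ≥0) : MeasureTheory.Measure Couplings :=
  MeasureTheory.Measure.infinitePi fun _ : Edge => ProbabilityTheory.gaussianReal 0 v

/-- Spin assignments. A state of a finite sublattice is represented by any extension of it to the
whole lattice; the notions below for `C(n,k)` only read the spins at the vertices of `C(n,k)`. -/
abbrev State : Type := Site → ℤˣ

/-- The product of the two spins at the ends of an edge. -/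
def bond (σ : State) (e : Edge) : ℝ := ((σ e.src * σ e.tgt : ℤˣ) : ℤ)

/-- The edge `e` is satisfied by `σ`. -/
def Satisfied (J : Couplings) (σ : State) (e : Edge) : Prop := 0 < J e * bond σ e

/-- The energy of `σ` carried by a finite set of edges. -/
def energyOn (F : Finset Edge) (J : Couplings) (σ : State) : ℝ := -∑ e ∈ F, J e * bond σ e

/-- The four edges incident to a vertex. -/
def incidentEdges (p : Site) : Finset Edge :=
  {.hor p.1 p.2, .hor (p.1 - 1) p.2, .ver p.1 p.2, .ver p.1 (p.2 - 1)}

/-- A ground state of the square lattice: the energy cannot be lowered by changing finitely many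
spins (only the edges touching the changed spins matter). -/
def IsGroundState (J : Couplings) (σ : State) : Prop :=
  ∀ W : Finset Site, ∀ τ : State, (∀ x, x ∉ W → τ x = σ x) →
    energyOn (W.biUnion incidentEdges) J σ ≤ energyOn (W.biUnion incidentEdges) J τ

/-! ### The finite sublattices `C(n,k)` -/

/-- The vertices of `C(n,k)`. -/
def sites (n k : ℕ) : Finset Site :=
  Finset.Icc (-(k : ℤ)) k ×ˢ Finset.Icc (-(n : ℤ)) n

/-- The edges of `C(n,k)`. -/
def edges (n k : ℕ) : Finset Edge :=
  (Finset.Ico (-(k : ℤ)) k ×ˢ Finset.Icc (-(n : ℤ)) n).image (fun p => Edge.hor p.1 p.2) ∪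
  (Finset.Icc (-(k : ℤ)) k ×ˢ Finset.Ico (-(n : ℤ)) n).image (fun p => Edge.ver p.1 p.2)

/-- The vertices on the boundary of `C(n,k)`. -/
def boundarySites (n k : ℕ) : Finset Site :=
  (sites n k).filter fun p => p.1 = k ∨ p.1 = -k ∨ p.2 = n ∨ p.2 = -n

/-- The edges on the boundary of `C(n,k)`. -/
def boundaryEdges (n k : ℕ) : Finset Edge :=
  (Finset.Ico (-(k : ℤ)) k).image (fun x => Edge.hor x n) ∪
  (Finset.Ico (-(k : ℤ)) k).image (fun x => Edge.hor x (-n)) ∪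
  (Finset.Ico (-(n : ℤ)) n).image (fun y => Edge.ver k y) ∪
  (Finset.Ico (-(n : ℤ)) n).image (fun y => Edge.ver (-k) y)

open Classical in
/-- The number of boundary edges of `C(n,k)` satisfied by `σ`. -/
def boundarySatisfied (J : Couplings) (n k : ℕ) (σ : State) : ℕ :=
  ((boundaryEdges n k).filter fun e => Satisfied J σ e).card

/-- `σ` is a c-groundstate of `C(n,k)`: its boundary spins satisfy the largest possible number of
boundary edges, and its energy in `C(n,k)` is minimal for these boundary spins. -/
def IsCGroundState (J : Couplings) (n k : ℕ) (σ : State) : Prop :=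
  (∀ τ : State, boundarySatisfied J n k τ ≤ boundarySatisfied J n k σ) ∧
  ∀ τ : State, (∀ x ∈ boundarySites n k, τ x = σ x) →
    energyOn (edges n k) J σ ≤ energyOn (edges n k) J τ

/-! ### Plaquettes and the dual graph -/

/-- Plaquettes (unit squares), labelled by their lower left corner. -/
abbrev Plaquette : Type := ℤ × ℤ

/-- The four edges of a plaquette. -/
def plaquetteEdges (p : Plaquette) : Finset Edge :=
  {.hor p.1 p.2, .hor p.1 (p.2 + 1), .ver p.1 p.2, .ver (p.1 + 1) p.2}

/-- A plaquette is frustrated if an odd number of its edges carry a negative coupling constant. -/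
def Frustrated (J : Couplings) (p : Plaquette) : Prop :=
  Odd ((plaquetteEdges p).filter fun e => J e < 0).card

/-- The dual edge `e*`: the pair of plaquettes on the two sides of `e`. -/
def dualEdge : Edge → Sym2 Plaquette
  | .hor x y => s((x, y - 1), (x, y))
  | .ver x y => s((x - 1, y), (x, y))

/-- `DIS(σ)*` in `C(n,k)*`: the duals of the edges of `C(n,k)` dissatisfied by `σ`
(boundary edges have no dual in `C(n,k)*`). -/
def disDual (J : Couplings) (n k : ℕ) (σ : State) : Set (Sym2 Plaquette) :=
  dualEdge '' {e | e ∈ edges n k ∧ e ∉ boundaryEdges n k ∧ ¬ Satisfied J σ e}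

/-- The plaquettes of `DU(n,m,k)`, the upper component of `C(n,k) - C(m-1,k)`. -/
def upperPart (n m k : ℕ) : Finset Plaquette :=
  Finset.Ico (-(k : ℤ)) k ×ˢ Finset.Ico (m : ℤ) n

/-- The plaquettes of `DL(n,m,k)`, the lower component of `C(n,k) - C(m-1,k)`. -/
def lowerPart (n m k : ℕ) : Finset Plaquette :=
  Finset.Ico (-(k : ℤ)) k ×ˢ Finset.Ico (-(n : ℤ)) (-m)

/-- `C(n,k)` has an even number of boundary edges with negative coupling constants. -/
def EvenBoundary (J : Couplings) (n k : ℕ) : Prop :=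
  Even ((boundaryEdges n k).filter fun e => J e < 0).card

/-- `C(n,k), C(m,k)` is a regular pair. A row of `C(n,k)` has `2k` plaquettes; as its middle one
we take the one with lower left corner on the axis `x = 0`. -/
def IsRegularPair (J : Couplings) (n m k : ℕ) : Prop :=
  m < n ∧
  (∀ k' : ℕ, 1 ≤ k' → k' ≤ k → EvenBoundary J n k' ∧ EvenBoundary J m k') ∧
  (∀ p ∈ upperPart n m k, Frustrated J p ↔ p = (0, (m : ℤ))) ∧
  (∀ p ∈ lowerPart n m k, Frustrated J p ↔ p = (0, -(m : ℤ) - 1))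

/-- The edge `e` is at distance at most `100` from the origin (the point of a lattice edge nearest
to the origin is one of its endpoints). -/
def NearOrigin (e : Edge) : Prop :=
  e.src.1 ^ 2 + e.src.2 ^ 2 ≤ 100 ^ 2 ∨ e.tgt.1 ^ 2 + e.tgt.2 ^ 2 ≤ 100 ^ 2

/-- The event `A(n,k)`. -/
def eventA (n k : ℕ) : Set Couplings :=
  {J | ∃ r s : State, IsCGroundState J (n - 1) k r ∧ IsCGroundState J n k s ∧
    ∃ p ∈ upperPart n (n - 1) k, ∃ q ∈ lowerPart n (n - 1) k,
      Frustrated J p ∧ Frustrated J q ∧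
      ∃ P : (SimpleGraph.fromEdgeSet
          (symmDiff (disDual J (n - 1) k r) (disDual J n k s))).Walk p q,
        P.IsPath ∧ ∃ e : Edge, dualEdge e ∈ P.edges ∧ NearOrigin e}

/-- The row of plaquettes between the heights `y` and `y + 1` of the strip of half-width `k` is an
isolation: its middle plaquette is its only frustrated one, and each of its horizontal edges
outside of the middle plaquette is heavier than all edges of the middle plaquette and all vertical
edges incident to a vertex of the row together. -/
def IsIsolation (J : Couplings) (k : ℕ) (y : ℤ) : Prop :=
  (∀ x ∈ Finset.Ico (-(k : ℤ)) k, Frustrated J (x, y) ↔ x = 0) ∧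
  ∀ x ∈ Finset.Ico (-(k : ℤ)) k, ∀ e ∈ ({Edge.hor x y, Edge.hor x (y + 1)} : Finset Edge),
    e ∉ plaquetteEdges (0, y) →
      ∑ e' ∈ plaquetteEdges (0, y) ∪
          (Finset.Icc (-(k : ℤ)) k ×ˢ Finset.Icc (y - 1) (y + 1)).image
            (fun p => Edge.ver p.1 p.2), |J e'| < |J e|

/-- `C(n,k)` is isolated: its top and bottom rows of plaquettes are isolations. -/
def IsIsolated (J : Couplings) (n k : ℕ) : Prop :=
  IsIsolation J k ((n : ℤ) - 1) ∧ IsIsolation J k (-(n : ℤ))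

/-- The event `R(n,k)`. -/
def eventR (n k : ℕ) : Set Couplings :=
  {J | IsRegularPair J n (n - 1) k ∧ IsIsolated J n k}

/-- The event `R'(n,k)`. -/
def eventR' (n k : ℕ) : Set Couplings :=
  {J | J ∈ eventR n k ∧ ∀ n' : ℕ, k ≤ n' → n' < n → J ∉ eventR n' k}

/-- The conditioning event: `R'(n,k)` holds and `A(n,k')` holds for all `c + 1 < k' < k`. -/
def conditioning (c n k : ℕ) : Set Couplings :=
  {J | J ∈ eventR' n k ∧ ∀ k' : ℕ, c + 1 < k' → k' < k → J ∈ eventA n k'}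

/-- Conjecture 2, about finite sublattices: a lower bound for the conditional probability of
`A(n,k)`. -/
def FiniteConjecture (v : ℝ≥0) : Prop :=
  ∃ c : ℕ, 0 < c ∧ ∃ ε : ℝ, 0 < ε ∧ ∀ n k : ℕ, c + 1 < n → c + 1 < k →
    couplingLaw v (conditioning c n k) ≠ 0 →
      1 - ((k : ℝ) - c)⁻¹ * (Real.log ((k : ℝ) - c)) ^ (-1 - ε) ≤
        (ProbabilityTheory.cond (couplingLaw v) (conditioning c n k)).real (eventA n k)

/-! ### Finitely incongruent limits -/

/-- Convergence of spin assignments, up to reversing all spins: on every finite set of vertices the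
sequence eventually agrees with the limit or with its reversal. -/
def ConvergesTo (s : ℕ → State) (σ : State) : Prop :=
  ∀ W : Finset Site, ∀ᶠ j in Filter.atTop,
    (∀ x ∈ W, s j x = σ x) ∨ (∀ x ∈ W, s j x = -σ x)

/-- `σ` and `τ` are finitely incongruent: the duals of the edges satisfied by exactly one of them
contain a path that is infinite both ways (it lies in a single domain wall, being connected, and
is unbounded both ways, its plaquettes being distinct). -/
def FinitelyIncongruent (J : Couplings) (σ τ : State) : Prop :=
  ∃ p : ℤ → Plaquette, Function.Injective p ∧
    ∀ i : ℤ, s(p i, p (i + 1)) ∈ dualEdge '' {e | Xor (Satisfied J σ e) (Satisfied J τ e)}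

/-- Conjecture 1: with positive probability there is a nested sequence of finite sublattices
exhausting the square lattice, `S 0, S 1, …` with `S i = C(n i, k i)`, such that, for any choice of
c-groundstates `o j` of `S (2 j)` and `e j` of `S (2 j + 1)`, both sequences converge, and their
limits are finitely incongruent ground states. -/
def IncongruenceConjecture (v : ℝ≥0) : Prop :=
  ∃ B : Set Couplings, MeasurableSet B ∧ 0 < couplingLaw v B ∧ ∀ J ∈ B,
    ∃ n k : ℕ → ℕ, (∀ i, 0 < n i ∧ 0 < k i) ∧
      (∀ i, sites (n i) (k i) ⊆ sites (n (i + 1)) (k (i + 1))) ∧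
      (∀ x : Site, ∃ i, x ∈ sites (n i) (k i)) ∧
      ∀ o e : ℕ → State,
        (∀ j, IsCGroundState J (n (2 * j)) (k (2 * j)) (o j)) →
        (∀ j, IsCGroundState J (n (2 * j + 1)) (k (2 * j + 1)) (e j)) →
        ∃ oLim eLim : State, ConvergesTo o oLim ∧ ConvergesTo e eLim ∧
          FinitelyIncongruent J oLim eLim ∧ IsGroundState J oLim ∧ IsGroundState J eLim

end EASpinGlass

end

/-! Call the set of edges dissatisfied by exactly one of the c-groundstates r of C(n-1,k) and s of
C(n,k) their wall. If the pair is regular, both boundaries can be satisfied completely, so the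
number of dissatisfied inner edges of a plaquette is odd exactly if the plaquette is frustrated
(`odd_disEdges_iff`). In the wall these parities cancel except at the middle plaquettes of the two
outermost rows, and the handshake lemma joins these two (`IsRegularAt.reachable`). The event A says
that such a connection passes near the origin. If R(n,k) and A(n,k) hold together for arbitrarily
large k, compactness, applied to the states and to the paths parametrized from their edge near the
origin, yields two limit states and a two-sided infinite path between them
(`exists_incongruent_limits`). For almost all couplings no signed finite sum vanishes; then
c-groundstates with even boundary are unique up to reversal, so their choice is immaterial.

It remains to bound the probability of E(k,k) from below uniformly in k, where E(k,l) (`eventE`)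
means that A(n,k') holds for c+1 < k' ≤ l at the first height n ≥ k for which R(n,k) holds. Summing
the conjectured bound over n gives P(E(k,k)) ≥ (1 - d_{k-c}) P(E(k,k-1)) with summable d
(`couplingLaw_eventE_ge`). Passing from E(k,k) to E(k+1,k) may raise the first height. Here barriers
help: lines on which each horizontal edge off the middle column outweighs the middle edge and all
vertical edges at the line together. A wall crosses a barrier only in the middle, and given barriers
above and below the origin the wall between them does not depend on the height of the sublattice
(`mem_eventA_of_barriers`). So this step fails only if R happens too early or the barriers come too
late.

Let q_k be the probability of a barrier at a given height. R(n,k) implies two independent barriers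
and 4k-2 further independent comparisons of probability at most 1/2 (`couplingLaw_eventR_le`),
whereas barriers are found within about k^2/q_k heights, since -log q_k is at most of order k^2.
Hence the failure has probability at most q_k b_k with summable b
(`exists_couplingLaw_eventBad_le`). The factor q_k is essential: a barrier through the origin forces
A, so the recursion starts at some k₀ with at least q_{k₀} (`barrierProb_le_couplingLaw_eventE`),
and the later errors, at most q_{k₀} b_k with small tails, leave at least q_{k₀}/2 for ever
(`exists_le_couplingLaw_eventE`). The limit superior of the events E(k,k) therefore has positive
probability. -/

noncomputable section
-- Stability under flips, uniqueness for generic couplings, barriers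
namespace EASpinGlass

/-! ### Bonds, flips and cuts -/

/-- The product of the two spins at the ends of an edge, as a unit of `ℤ`. -/
def unitBond (σ : State) (e : Edge) : ℤˣ := σ e.src * σ e.tgt

lemma bond_eq (σ : State) (e : Edge) : bond σ e = ((unitBond σ e : ℤ) : ℝ) := rfl

lemma bond_cases (σ : State) (e : Edge) : bond σ e = 1 ∨ bond σ e = -1 := by
  rw [bond_eq]
  rcases Int.units_eq_one_or (unitBond σ e) with h | h <;> simp [h]

lemma abs_bond (σ : State) (e : Edge) : |bond σ e| = 1 := by
  rcases bond_cases σ e with h | h <;> simp [h]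

/-- The edges with exactly one endpoint in `A`. -/
def cutEdges (A : Finset Site) : Finset Edge :=
  (A.biUnion incidentEdges).filter fun e => ¬ (e.src ∈ A ↔ e.tgt ∈ A)

lemma mem_incidentEdges {p : Site} {e : Edge} : e ∈ incidentEdges p ↔ e.src = p ∨ e.tgt = p := by
  obtain ⟨a, b⟩ := p
  cases e with
  | hor x y =>
    simp only [incidentEdges, Edge.src, Edge.tgt, Finset.mem_insert, Finset.mem_singleton,
      Edge.hor.injEq, Prod.mk.injEq, reduceCtorEq, or_false]
    omega
  | ver x y =>
    simp only [incidentEdges, Edge.src, Edge.tgt, Finset.mem_insert, Finset.mem_singleton,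
      Edge.ver.injEq, Prod.mk.injEq, reduceCtorEq, false_or]
    omega

lemma mem_cutEdges {A : Finset Site} {e : Edge} :
    e ∈ cutEdges A ↔ ¬ (e.src ∈ A ↔ e.tgt ∈ A) := by
  simp only [cutEdges, Finset.mem_filter, Finset.mem_biUnion, mem_incidentEdges,
    and_iff_right_iff_imp]
  intro h
  by_cases h1 : e.src ∈ A
  · exact ⟨_, h1, Or.inl rfl⟩
  · exact ⟨e.tgt, by tauto, Or.inr rfl⟩

/-- The state obtained from `σ` by flipping the spins in `A`. -/
def flipOn (A : Finset Site) (σ : State) : State := fun x => if x ∈ A then -σ x else σ x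

lemma bond_flipOn (A : Finset Site) (σ : State) (e : Edge) :
    bond (flipOn A σ) e = if e ∈ cutEdges A then -bond σ e else bond σ e := by
  simp only [bond, flipOn, mem_cutEdges]
  by_cases h1 : e.src ∈ A <;> by_cases h2 : e.tgt ∈ A <;> simp [h1, h2]

lemma energyOn_flipOn (J : Couplings) (σ : State) {A : Finset Site} {F : Finset Edge}
    (h : cutEdges A ⊆ F) :
    energyOn F J (flipOn A σ) = energyOn F J σ + 2 * ∑ e ∈ cutEdges A, J e * bond σ e := by
  have key : ∑ e ∈ cutEdges A, J e * bond σ e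
      = ∑ e ∈ F, if e ∈ cutEdges A then J e * bond σ e else 0 := by
    rw [← Finset.sum_filter, Finset.filter_mem_eq_inter, Finset.inter_eq_right.mpr h]
  rw [key, Finset.mul_sum]
  simp only [energyOn]
  rw [← Finset.sum_neg_distrib, ← Finset.sum_neg_distrib, ← Finset.sum_add_distrib]
  refine Finset.sum_congr rfl fun e _ => ?_
  rw [bond_flipOn]
  split_ifs <;> ring

/-- Flipping the spins in `A` does not lower the energy. -/
def FlipStable (J : Couplings) (σ : State) (A : Finset Site) : Prop :=
  0 ≤ ∑ e ∈ cutEdges A, J e * bond σ e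

/-- A state that differs from `σ` at finitely many sites arises by flipping the set where it
differs. -/
lemma isGroundState_of_flipStable {J : Couplings} {σ : State} (h : ∀ A, FlipStable J σ A) :
    IsGroundState J σ := by
  intro W τ hτ
  set A := W.filter fun x => τ x ≠ σ x with hA
  have h1 : τ = flipOn A σ := by
    funext x
    simp only [flipOn, hA, Finset.mem_filter]
    by_cases hx : τ x = σ x
    · simp [hx]
    · have hW : x ∈ W := by
        by_contra hW
        exact hx (hτ x hW)
      simp only [hW, ne_eq, hx, not_false_eq_true, and_self, if_true]
      exact Int.units_ne_iff_eq_neg.mp hx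
  have h2 : cutEdges A ⊆ W.biUnion incidentEdges := by
    intro e he
    have he' := mem_cutEdges.mp he
    simp only [Finset.mem_biUnion, mem_incidentEdges]
    by_cases h1 : e.src ∈ A
    · exact ⟨_, (Finset.mem_filter.mp h1).1, Or.inl rfl⟩
    · have h2 : e.tgt ∈ A := by tauto
      exact ⟨_, (Finset.mem_filter.mp h2).1, Or.inr rfl⟩
  rw [h1, energyOn_flipOn J σ h2]
  have := h A
  unfold FlipStable at this
  linarith

/-- The open box `(-k, k) × (b, t)`. -/
def openBox (k : ℕ) (b t : ℤ) : Finset Site := Finset.Ioo (-(k : ℤ)) k ×ˢ Finset.Ioo b t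

lemma mem_openBox {k : ℕ} {b t : ℤ} {p : Site} :
    p ∈ openBox k b t ↔ (-(k : ℤ) < p.1 ∧ p.1 < k) ∧ b < p.2 ∧ p.2 < t := by
  simp [openBox]

lemma hor_mem_edges {n k : ℕ} {x y : ℤ} :
    Edge.hor x y ∈ edges n k ↔ (-(k : ℤ) ≤ x ∧ x < k) ∧ -(n : ℤ) ≤ y ∧ y ≤ n := by
  simp [edges]

lemma ver_mem_edges {n k : ℕ} {x y : ℤ} :
    Edge.ver x y ∈ edges n k ↔ (-(k : ℤ) ≤ x ∧ x ≤ k) ∧ -(n : ℤ) ≤ y ∧ y < n := by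
  simp [edges]

lemma mem_sites {n k : ℕ} {p : Site} :
    p ∈ sites n k ↔ (-(k : ℤ) ≤ p.1 ∧ p.1 ≤ k) ∧ -(n : ℤ) ≤ p.2 ∧ p.2 ≤ n := by
  simp [sites]

lemma cutEdges_subset_edges {n k : ℕ} {A : Finset Site} (hA : A ⊆ openBox k (-n) n) :
    cutEdges A ⊆ edges n k := by
  intro e he
  have he' := mem_cutEdges.mp he
  have : e.src ∈ A ∨ e.tgt ∈ A := by tauto
  cases e with
  | hor x y =>
    rw [hor_mem_edges]
    rcases this with h | h <;>
    · have := mem_openBox.mp (hA h)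
      simp only [Edge.src, Edge.tgt] at this
      omega
  | ver x y =>
    rw [ver_mem_edges]
    rcases this with h | h <;>
    · have := mem_openBox.mp (hA h)
      simp only [Edge.src, Edge.tgt] at this
      omega

/-- Flips in the open box leave the boundary spins alone. The geometric arguments use minimality of
the energy only in this form. -/
lemma IsCGroundState.flipStable {J : Couplings} {n k : ℕ} {σ : State} (h : IsCGroundState J n k σ)
    {A : Finset Site} (hA : A ⊆ openBox k (-n) n) : FlipStable J σ A := by
  have h1 := h.2 (flipOn A σ) (by
    intro x hx
    have : x ∉ A := by
      intro hxA
      have h2 := mem_openBox.mp (hA hxA)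
      simp only [boundarySites, Finset.mem_filter] at hx
      omega
    simp [flipOn, this])
  rw [energyOn_flipOn J σ (cutEdges_subset_edges hA)] at h1
  unfold FlipStable
  linarith

/-! ### Generic couplings and uniqueness -/

/-- No nonempty finite signed sum of couplings vanishes. -/
def Generic (J : Couplings) : Prop :=
  ∀ F : Finset Edge, F.Nonempty → ∀ ε : Edge → ℤˣ, ∑ e ∈ F, J e * ((ε e : ℤ) : ℝ) ≠ 0

lemma Generic.ne_zero {J : Couplings} (h : Generic J) (e : Edge) : J e ≠ 0 := by
  have := h {e} (Finset.singleton_nonempty e) (fun _ => 1)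
  simpa using this

lemma Generic.unitBond_eq_iff {J : Couplings} (h : Generic J) {σ τ : State} {e : Edge} :
    unitBond σ e = unitBond τ e ↔ (Satisfied J σ e ↔ Satisfied J τ e) := by
  have h0 := h.ne_zero e
  unfold Satisfied
  rw [bond_eq, bond_eq]
  rcases Int.units_eq_one_or (unitBond σ e) with h1 | h1 <;>
  rcases Int.units_eq_one_or (unitBond τ e) with h2 | h2 <;> rw [h1, h2] <;>
  rcases lt_or_gt_of_ne h0 with h3 | h3 <;>
  simp [h3, not_lt.mpr h3.le]

lemma eq_left_of_forall_eq_succ {α : Type*} {f : ℤ → α} {a b : ℤ}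
    (h : ∀ i, a ≤ i → i < b → f i = f (i + 1)) : ∀ i, a ≤ i → i ≤ b → f i = f a := by
  intro i hi
  induction i, hi using Int.leInduction with
  | base => simp
  | succ i hi ih => exact fun hb => (h i hi (by omega)).symm.trans (ih (by omega))

lemma unitBond_eq_iff_mul_eq {σ τ : State} {e : Edge} :
    unitBond σ e = unitBond τ e ↔ σ e.src * τ e.src = σ e.tgt * τ e.tgt := by
  unfold unitBond
  rcases Int.units_eq_one_or (σ e.src) with h1 | h1 <;>
  rcases Int.units_eq_one_or (σ e.tgt) with h2 | h2 <;>
  rcases Int.units_eq_one_or (τ e.src) with h3 | h3 <;>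
  rcases Int.units_eq_one_or (τ e.tgt) with h4 | h4 <;> simp [h1, h2, h3, h4]

/-- Two flip stable states with the same bonds on the boundary of a box (except perhaps for the
middle edge of the bottom line) agree in the box up to reversing all spins. -/
theorem Generic.eq_in_box {J : Couplings} (hJ : Generic J) {k : ℕ} (hk : 1 ≤ k) {b t : ℤ}
    (hbt : b ≤ t) {σ τ : State}
    (hσ : ∀ A ⊆ openBox k b t, FlipStable J σ A) (hτ : ∀ A ⊆ openBox k b t, FlipStable J τ A)
    (hl : ∀ y, b ≤ y → y < t → unitBond σ (.ver (-k) y) = unitBond τ (.ver (-k) y))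
    (hr : ∀ y, b ≤ y → y < t → unitBond σ (.ver k y) = unitBond τ (.ver k y))
    (ht : ∀ x, -(k : ℤ) ≤ x → x < k → unitBond σ (.hor x t) = unitBond τ (.hor x t))
    (hb : ∀ x, -(k : ℤ) ≤ x → x < k → x ≠ 0 → unitBond σ (.hor x b) = unitBond τ (.hor x b)) :
    ∃ u : ℤˣ, ∀ x y, -(k : ℤ) ≤ x → x ≤ k → b ≤ y → y ≤ t → σ (x, y) = u * τ (x, y) := by
  simp only [unitBond_eq_iff_mul_eq, Edge.src, Edge.tgt] at hl hr ht hb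
  -- Equal bonds mean that the overlap `d` is constant along the edge, so `d` can be followed around
  -- the boundary.
  set d : Site → ℤˣ := fun p => σ p * τ p with hd
  have top : ∀ x, -(k : ℤ) ≤ x → x ≤ k → d (x, t) = d (-k, t) :=
    eq_left_of_forall_eq_succ (f := fun x => d (x, t)) ht
  have left : ∀ y, b ≤ y → y ≤ t → d (-k, y) = d (-k, b) :=
    eq_left_of_forall_eq_succ (f := fun y => d (-k, y)) hl
  have right : ∀ y, b ≤ y → y ≤ t → d (k, y) = d (k, b) :=
    eq_left_of_forall_eq_succ (f := fun y => d (k, y)) hr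
  -- A cycle minus one edge is still connected: the halves of the bottom line are reached from the
  -- left side and, by way of the top, from the right side.
  have botl : ∀ x, -(k : ℤ) ≤ x → x ≤ 0 → d (x, b) = d (-k, b) :=
    eq_left_of_forall_eq_succ (f := fun x => d (x, b)) (fun i h1 h2 => hb i h1 (by omega) (by omega))
  have botr : ∀ x, (1 : ℤ) ≤ x → x ≤ k → d (x, b) = d (1, b) :=
    eq_left_of_forall_eq_succ (f := fun x => d (x, b)) (fun i h1 h2 => hb i (by omega) h2 (by omega))
  set u := d (-k, b) with hu
  have htl : d (-k, t) = u := left t hbt le_rfl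
  have hrb : d (k, b) = u := by
    rw [← right t hbt le_rfl, top k (by omega) le_rfl, htl]
  have bdry : ∀ x y, -(k : ℤ) ≤ x → x ≤ k → b ≤ y → y ≤ t → (x, y) ∉ openBox k b t →
      d (x, y) = u := by
    intro x y h1 h2 h3 h4 h5
    rw [mem_openBox] at h5
    have h6 : x = -k ∨ x = k ∨ y = t ∨ y = b := by
      simp only at h5
      omega
    rcases h6 with rfl | rfl | rfl | rfl
    · exact left y h3 h4
    · exact (right y h3 h4).trans hrb
    · exact (top x h1 h2).trans htl
    · by_cases hx : x ≤ 0
      · exact botl x h1 hx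
      · rw [botr x (by omega) h2, ← botr k (by omega) le_rfl, hrb]
  -- On the cut of the disagreement set the bonds of `σ` and `τ` are opposite. Stability of both
  -- makes the cut sum nonnegative and nonpositive, hence zero, which genericity allows only for an
  -- empty cut.
  set A := (openBox k b t).filter fun p => d p ≠ u with hA
  have hAs : A ⊆ openBox k b t := Finset.filter_subset _ _
  have notA : ∀ x y, -(k : ℤ) ≤ x → x ≤ k → b ≤ y → y ≤ t → (x, y) ∉ A → d (x, y) = u := by
    intro x y h1 h2 h3 h4 h5
    by_cases h6 : (x, y) ∈ openBox k b t
    · by_contra h7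
      exact h5 (Finset.mem_filter.mpr ⟨h6, h7⟩)
    · exact bdry x y h1 h2 h3 h4 h6
  have inA : ∀ p ∈ A, d p ≠ u := fun p hp => (Finset.mem_filter.mp hp).2
  have notA' : ∀ e ∈ cutEdges A, unitBond σ e ≠ unitBond τ e := by
    intro e he
    rw [mem_cutEdges] at he
    rw [Ne, unitBond_eq_iff_mul_eq]
    change d e.src ≠ d e.tgt
    have hcase : (e.src ∈ A ∧ e.tgt ∉ A) ∨ (e.src ∉ A ∧ e.tgt ∈ A) := by tauto
    rcases hcase with ⟨h1, h2⟩ | ⟨h1, h2⟩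
    · have h3 := mem_openBox.mp (hAs h1)
      have h4 : d e.tgt = u := by
        cases e <;> simp only [Edge.src, Edge.tgt] at h3 h2 ⊢ <;>
        exact notA _ _ (by omega) (by omega) (by omega) (by omega) h2
      rw [h4]
      exact inA _ h1
    · have h3 := mem_openBox.mp (hAs h2)
      have h4 : d e.src = u := by
        cases e <;> simp only [Edge.src, Edge.tgt] at h3 h1 ⊢ <;>
        exact notA _ _ (by omega) (by omega) (by omega) (by omega) h1
      rw [h4]
      exact (inA _ h2).symm
  have hsum : ∑ e ∈ cutEdges A, J e * bond τ e = - ∑ e ∈ cutEdges A, J e * bond σ e := by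
    rw [← Finset.sum_neg_distrib]
    refine Finset.sum_congr rfl fun e he => ?_
    have := Int.units_ne_iff_eq_neg.mp (notA' e he)
    rw [bond_eq, bond_eq, this]
    simp
  have hempty : cutEdges A = ∅ := by
    by_contra hne
    refine hJ _ (Finset.nonempty_iff_ne_empty.mpr hne) (unitBond σ) ?_
    have h1 := hσ A hAs
    have h2 := hτ A hAs
    unfold FlipStable at h1 h2
    rw [hsum] at h2
    simp only [bond_eq] at h1 h2
    linarith
  have hAempty : A = ∅ := by
    by_contra hne
    -- The edge to the right of a rightmost site would belong to the cut.
    obtain ⟨p, hp, hmax⟩ := A.exists_max_image (fun p => p.1) (Finset.nonempty_iff_ne_empty.mpr hne)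
    have h1 : Edge.hor p.1 p.2 ∈ cutEdges A := by
      rw [mem_cutEdges]
      simp only [Edge.src, Edge.tgt, Prod.mk.eta, hp, true_iff]
      intro h2
      have := hmax _ h2
      simp only at this
      omega
    rw [hempty] at h1
    simp at h1
  refine ⟨u, fun x y h1 h2 h3 h4 => ?_⟩
  rw [← notA x y h1 h2 h3 h4 (by simp [hAempty])]
  simp only [hd]
  rw [mul_assoc, Int.units_mul_self, mul_one]

/-! ### Barriers -/

/-- The middle edge of the line of height `h` and the vertical edges incident to that line. -/
def lightEdges (h : ℤ) (k : ℕ) : Finset Edge :=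
  insert (.hor 0 h) ((Finset.Icc (-(k : ℤ)) k ×ˢ Finset.Icc (h - 1) h).image
    fun p => Edge.ver p.1 p.2)

lemma ver_mem_lightEdges {h : ℤ} {k : ℕ} {x y : ℤ} :
    Edge.ver x y ∈ lightEdges h k ↔ (-(k : ℤ) ≤ x ∧ x ≤ k) ∧ h - 1 ≤ y ∧ y ≤ h := by
  simp [lightEdges]

lemma hor_mem_lightEdges {h : ℤ} {k : ℕ} {x y : ℤ} :
    Edge.hor x y ∈ lightEdges h k ↔ x = 0 ∧ y = h := by
  simp [lightEdges]

/-- In the strip of half-width `k`, the horizontal edges of height `h` outside of the middle column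
are heavier than all edges of `lightEdges h k` together. -/
def IsBarrier (J : Couplings) (h : ℤ) (k : ℕ) : Prop :=
  ∀ x ∈ Finset.Ico (-(k : ℤ)) k, x ≠ 0 → ∑ e ∈ lightEdges h k, |J e| < |J (.hor x h)|

lemma lightEdges_mono {h : ℤ} {k k' : ℕ} (hk : k ≤ k') : lightEdges h k ⊆ lightEdges h k' := by
  intro e he
  cases e with
  | hor x y => rw [hor_mem_lightEdges] at *; exact he
  | ver x y => rw [ver_mem_lightEdges] at *; omega

lemma IsBarrier.anti {J : Couplings} {h : ℤ} {k k' : ℕ} (hk : k ≤ k') (hB : IsBarrier J h k') :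
    IsBarrier J h k := by
  intro x hx h0
  rw [Finset.mem_Ico] at hx
  exact lt_of_le_of_lt (Finset.sum_le_sum_of_subset_of_nonneg (lightEdges_mono hk)
    fun _ _ _ => abs_nonneg _) (hB x (Finset.mem_Ico.mpr (by omega)) h0)

/-- If a dominant edge of the cut were dissatisfied, its negative contribution could not be
compensated by the rest, and flipping `A` would lower the energy. -/
lemma satisfied_of_cut_subset {J : Couplings} {σ : State} {A : Finset Site} {F : Finset Edge}
    {e : Edge} (hA : FlipStable J σ A) (he : e ∈ cutEdges A) (hF : cutEdges A ⊆ insert e F)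
    (hlt : ∑ e' ∈ F, |J e'| < |J e|) : Satisfied J σ e := by
  unfold FlipStable at hA
  rw [← Finset.add_sum_erase _ _ he] at hA
  have h1 : ∑ e' ∈ (cutEdges A).erase e, J e' * bond σ e' ≤ ∑ e' ∈ F, |J e'| := by
    calc ∑ e' ∈ (cutEdges A).erase e, J e' * bond σ e'
        ≤ ∑ e' ∈ (cutEdges A).erase e, |J e'| := by
          refine Finset.sum_le_sum fun e' _ => ?_
          calc J e' * bond σ e' ≤ |J e' * bond σ e'| := le_abs_self _
            _ = |J e'| := by rw [abs_mul, abs_bond, mul_one]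
      _ ≤ ∑ e' ∈ F, |J e'| :=
          Finset.sum_le_sum_of_subset_of_nonneg (Finset.subset_insert_iff.mp hF)
            fun _ _ _ => abs_nonneg _
  have h2 : -|J e| < J e * bond σ e := by linarith
  unfold Satisfied
  rcases bond_cases σ e with h | h <;> rw [h] at h2 ⊢ <;>
  rcases abs_cases (J e) with h3 | h3 <;> linarith [h3.1, h3.2]

/-- A flip stable state satisfies all edges of a barrier except perhaps for the middle one. -/
theorem IsBarrier.satisfied {J : Couplings} {h : ℤ} {k : ℕ} (hB : IsBarrier J h k) {σ : State}
    (hσ : ∀ A ⊆ openBox k (h - 1) (h + 1), FlipStable J σ A) {x : ℤ} (hx1 : -(k : ℤ) ≤ x)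
    (hx2 : x < k) (hx0 : x ≠ 0) : Satisfied J σ (.hor x h) := by
  have hlt := hB x (Finset.mem_Ico.mpr ⟨hx1, hx2⟩) hx0
  rcases lt_or_gt_of_ne hx0 with hx | hx
  -- Flip the segment of the line between the edge and the middle edge: apart from the edge itself
  -- its cut consists of the middle edge and vertical edges, all of them light.
  · refine satisfied_of_cut_subset (A := Finset.Icc (x + 1) 0 ×ˢ {h}) (hσ _ ?_) ?_ ?_ hlt
    · intro p hp
      rw [mem_openBox]
      simp only [Finset.mem_product, Finset.mem_Icc, Finset.mem_singleton] at hp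
      omega
    · rw [mem_cutEdges]
      simp only [Edge.src, Edge.tgt, Finset.mem_product, Finset.mem_Icc, Finset.mem_singleton, and_true]
      rw [not_iff]; omega
    · intro e he
      rw [mem_cutEdges] at he
      cases e with
      | hor a b =>
        simp only [Edge.src, Edge.tgt, Finset.mem_product, Finset.mem_Icc, Finset.mem_singleton] at he
        rw [Finset.mem_insert, hor_mem_lightEdges, Edge.hor.injEq]
        omega
      | ver a b =>
        simp only [Edge.src, Edge.tgt, Finset.mem_product, Finset.mem_Icc, Finset.mem_singleton] at he
        rw [Finset.mem_insert, ver_mem_lightEdges]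
        omega
  · refine satisfied_of_cut_subset (A := Finset.Icc 1 x ×ˢ {h}) (hσ _ ?_) ?_ ?_ hlt
    · intro p hp
      rw [mem_openBox]
      simp only [Finset.mem_product, Finset.mem_Icc, Finset.mem_singleton] at hp
      omega
    · rw [mem_cutEdges]
      simp only [Edge.src, Edge.tgt, Finset.mem_product, Finset.mem_Icc, Finset.mem_singleton, and_true]
      rw [not_iff]; omega
    · intro e he
      rw [mem_cutEdges] at he
      cases e with
      | hor a b =>
        simp only [Edge.src, Edge.tgt, Finset.mem_product, Finset.mem_Icc, Finset.mem_singleton] at he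
        rw [Finset.mem_insert, hor_mem_lightEdges, Edge.hor.injEq]
        omega
      | ver a b =>
        simp only [Edge.src, Edge.tgt, Finset.mem_product, Finset.mem_Icc, Finset.mem_singleton] at he
        rw [Finset.mem_insert, ver_mem_lightEdges]
        omega

end EASpinGlass
end

/-! ### Parities in the dual graph, even boundaries, existence of c-groundstates -/

noncomputable section
namespace EASpinGlass

/-! ### Dual edges and the handshake lemma -/

lemma mem_plaquetteEdges {p : Plaquette} {e : Edge} : e ∈ plaquetteEdges p ↔ p ∈ dualEdge e := by
  obtain ⟨a, b⟩ := p
  cases e with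
  | hor x y =>
    simp only [plaquetteEdges, dualEdge, Finset.mem_insert, Finset.mem_singleton,
      Edge.hor.injEq, Prod.mk.injEq, reduceCtorEq, or_false, Sym2.mem_iff]
    omega
  | ver x y =>
    simp only [plaquetteEdges, dualEdge, Finset.mem_insert, Finset.mem_singleton,
      Edge.ver.injEq, Prod.mk.injEq, reduceCtorEq, false_or, Sym2.mem_iff]
    omega

lemma dualEdge_injective : Function.Injective dualEdge := by
  intro e f h
  cases e <;> cases f <;>
    simp only [dualEdge, Sym2.eq_iff, Prod.mk.injEq, Edge.hor.injEq, Edge.ver.injEq,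
      reduceCtorEq] at h ⊢ <;> omega

lemma dualEdge_not_isDiag (e : Edge) : ¬ (dualEdge e).IsDiag := by
  cases e <;> simp [dualEdge]

/-- The graph of the plaquettes in which the duals of the edges in `D` are present. -/
abbrev wallGraph (D : Finset Edge) : SimpleGraph Plaquette :=
  SimpleGraph.fromEdgeSet (dualEdge '' (D : Set Edge))

lemma wallGraph_adj {D : Finset Edge} {p q : Plaquette} :
    (wallGraph D).Adj p q ↔ ∃ e ∈ D, dualEdge e = s(p, q) := by
  rw [SimpleGraph.fromEdgeSet_adj]
  constructor
  · rintro ⟨⟨e, he, h⟩, -⟩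
    exact ⟨e, he, h⟩
  · rintro ⟨e, he, h⟩
    refine ⟨⟨e, he, h⟩, fun hpq => ?_⟩
    have := dualEdge_not_isDiag e
    rw [h, hpq] at this
    simp at this

/-- The dual edge has two distinct ends, and `S` contains both or neither. -/
lemma card_filter_mem_dualEdge (S : Finset Plaquette) (e : Edge)
    (h : ∀ p q, dualEdge e = s(p, q) → (p ∈ S ↔ q ∈ S)) :
    Even (S.filter fun p => e ∈ plaquetteEdges p).card := by
  induction hs : dualEdge e using Sym2.ind with
  | _ a b =>
    have hab : a ≠ b := by
      intro hab
      have := dualEdge_not_isDiag e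
      rw [hs, hab] at this
      simp at this
    have h1 := h a b hs
    have h2 : (S.filter fun p => e ∈ plaquetteEdges p) = S ∩ {a, b} := by
      ext p
      rw [Finset.mem_filter, mem_plaquetteEdges, hs, Sym2.mem_iff, Finset.mem_inter,
        Finset.mem_insert, Finset.mem_singleton]
    rw [h2]
    by_cases ha : a ∈ S
    · rw [Finset.inter_eq_right.mpr (by
        intro p hp
        simp only [Finset.mem_insert, Finset.mem_singleton] at hp
        rcases hp with rfl | rfl
        · exact ha
        · exact h1.mp ha), Finset.card_pair hab]
      exact even_two
    · have : S ∩ {a, b} = ∅ := by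
        ext p
        simp only [Finset.mem_inter, Finset.mem_insert, Finset.mem_singleton,
          Finset.notMem_empty, iff_false, not_and]
        rintro hp (rfl | rfl)
        · exact ha hp
        · exact ha (h1.mpr hp)
      simp [this]

/-- In a finite set of dual edges, a plaquette of odd degree is joined to another one. -/
theorem exists_reachable_odd (D : Finset Edge) {p : Plaquette}
    (hp : Odd (D.filter fun e => e ∈ plaquetteEdges p).card) :
    ∃ q, q ≠ p ∧ Odd (D.filter fun e => e ∈ plaquetteEdges q).card ∧
      (wallGraph D).Reachable p q := by
  classical
  by_contra hcon
  push Not at hcon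
  -- A finite version of the component of `p`. Counting its incidences with `D` by edges gives an
  -- even number, so `p` cannot be its only plaquette of odd degree.
  set S := (D.biUnion fun e => (dualEdge e).toFinset).filter fun q => (wallGraph D).Reachable p q
    with hS
  have memS : ∀ {e q}, e ∈ D → q ∈ dualEdge e → (q ∈ S ↔ (wallGraph D).Reachable p q) := by
    intro e q he hq
    simp only [hS, Finset.mem_filter, Finset.mem_biUnion, Sym2.mem_toFinset, and_iff_right_iff_imp]
    exact fun _ => ⟨e, he, hq⟩
  have hpS : p ∈ S := by
    obtain ⟨e, he⟩ := Finset.card_pos.mp hp.pos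
    rw [Finset.mem_filter, mem_plaquetteEdges] at he
    exact (memS he.1 he.2).mpr (SimpleGraph.Reachable.refl p)
  have h1 : ∑ q ∈ S, (D.filter fun e => e ∈ plaquetteEdges q).card
      = ∑ e ∈ D, (S.filter fun q => e ∈ plaquetteEdges q).card :=
    Finset.sum_card_bipartiteAbove_eq_sum_card_bipartiteBelow (fun q e => e ∈ plaquetteEdges q)
  have h2 : Even (∑ e ∈ D, (S.filter fun q => e ∈ plaquetteEdges q).card) := by
    refine Finset.even_sum _ fun e he => card_filter_mem_dualEdge S e fun a b hab => ?_
    rw [memS he (by rw [hab]; simp), memS he (by rw [hab]; simp)]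
    have hadj : (wallGraph D).Adj a b := wallGraph_adj.mpr ⟨e, he, hab⟩
    exact ⟨fun h => h.trans hadj.reachable, fun h => h.trans hadj.symm.reachable⟩
  rw [← h1, ← Finset.add_sum_erase _ _ hpS] at h2
  have h3 : Even (∑ q ∈ S.erase p, (D.filter fun e => e ∈ plaquetteEdges q).card) := by
    refine Finset.even_sum _ fun q hq => ?_
    rw [Finset.mem_erase] at hq
    rw [← Nat.not_odd_iff_even]
    intro hodd
    exact hcon q hq.1 hodd (Finset.mem_filter.mp hq.2).2
  rw [Nat.even_add] at h2
  exact (Nat.not_even_iff_odd.mpr hp) (h2.mpr h3)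

/-! ### Signs and parities -/

/-- The sign of a coupling constant. -/
def sgn (J : Couplings) (e : Edge) : ℤˣ := if J e < 0 then -1 else 1

lemma prod_ite_neg_one {ι : Type*} (F : Finset ι) (P : ι → Prop) [DecidablePred P] :
    ∏ e ∈ F, (if P e then -1 else 1 : ℤˣ) = (-1) ^ (F.filter P).card := by
  rw [Finset.prod_ite]
  simp

lemma odd_card_filter_iff {ι : Type*} (F : Finset ι) (P : ι → Prop) [DecidablePred P] :
    Odd (F.filter P).card ↔ ∏ e ∈ F, (if P e then -1 else 1 : ℤˣ) = -1 := by
  rw [prod_ite_neg_one, neg_one_pow_eq_neg_one_iff_odd (by decide)]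

lemma even_card_filter_iff {ι : Type*} (F : Finset ι) (P : ι → Prop) [DecidablePred P] :
    Even (F.filter P).card ↔ ∏ e ∈ F, (if P e then -1 else 1 : ℤˣ) = 1 := by
  rw [prod_ite_neg_one, neg_one_pow_eq_one_iff_even (by decide)]

lemma frustrated_iff {J : Couplings} {p : Plaquette} :
    Frustrated J p ↔ ∏ e ∈ plaquetteEdges p, sgn J e = -1 :=
  odd_card_filter_iff _ _

lemma evenBoundary_iff {J : Couplings} {n k : ℕ} :
    EvenBoundary J n k ↔ ∏ e ∈ boundaryEdges n k, sgn J e = 1 :=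
  even_card_filter_iff _ _

lemma satisfied_iff_sgn {J : Couplings} {σ : State} {e : Edge} (h : J e ≠ 0) :
    Satisfied J σ e ↔ unitBond σ e = sgn J e := by
  unfold Satisfied sgn
  rw [bond_eq]
  rcases Int.units_eq_one_or (unitBond σ e) with h1 | h1 <;>
  rcases lt_or_gt_of_ne h with h3 | h3 <;> simp [h1, h3, not_lt.mpr h3.le]

lemma prod_plaquetteEdges (f : Edge → ℤˣ) (p : Plaquette) :
    ∏ e ∈ plaquetteEdges p, f e
      = f (.hor p.1 p.2) * f (.hor p.1 (p.2 + 1)) * f (.ver p.1 p.2) * f (.ver (p.1 + 1) p.2) := by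
  unfold plaquetteEdges
  rw [Finset.prod_insert (by simp), Finset.prod_insert (by simp), Finset.prod_insert (by simp),
    Finset.prod_singleton]
  simp only [mul_assoc]

lemma prod_unitBond_plaquetteEdges (σ : State) (p : Plaquette) :
    ∏ e ∈ plaquetteEdges p, unitBond σ e = 1 := by
  rw [prod_plaquetteEdges]
  simp only [unitBond, Edge.src, Edge.tgt]
  rcases Int.units_eq_one_or (σ (p.1, p.2)) with h1 | h1 <;>
  rcases Int.units_eq_one_or (σ (p.1 + 1, p.2)) with h2 | h2 <;>
  rcases Int.units_eq_one_or (σ (p.1, p.2 + 1)) with h3 | h3 <;>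
  rcases Int.units_eq_one_or (σ (p.1 + 1, p.2 + 1)) with h4 | h4 <;> simp [h1, h2, h3, h4]

-- An edge is dissatisfied if the sign of its coupling times its bond is -1. Around a plaquette each
-- spin enters two bonds, so the bonds cancel and only the signs of the couplings decide the parity.
open Classical in
lemma odd_unsatisfied_iff {J : Couplings} (hJ : ∀ e, J e ≠ 0) (σ : State) (p : Plaquette) :
    Odd ((plaquetteEdges p).filter fun e => ¬ Satisfied J σ e).card ↔ Frustrated J p := by
  rw [odd_card_filter_iff, frustrated_iff]
  have : ∏ e ∈ plaquetteEdges p, (if ¬ Satisfied J σ e then -1 else 1 : ℤˣ)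
      = ∏ e ∈ plaquetteEdges p, (sgn J e * unitBond σ e) := by
    refine Finset.prod_congr rfl fun e _ => ?_
    rw [satisfied_iff_sgn (hJ e)]
    rcases Int.units_eq_one_or (unitBond σ e) with h1 | h1 <;>
    rcases Int.units_eq_one_or (sgn J e) with h2 | h2 <;> simp [h1, h2]
  rw [this, Finset.prod_mul_distrib, prod_unitBond_plaquetteEdges, mul_one]

/-! ### Boundaries -/

lemma hor_mem_boundaryEdges {n k : ℕ} {x y : ℤ} :
    Edge.hor x y ∈ boundaryEdges n k ↔ (-(k : ℤ) ≤ x ∧ x < k) ∧ (y = n ∨ y = -n) := by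
  simp only [boundaryEdges, Finset.mem_union, Finset.mem_image, Finset.mem_Ico, Edge.hor.injEq,
    reduceCtorEq, and_false, exists_false, or_false]
  constructor
  · rintro (⟨a, h, rfl, rfl⟩ | ⟨a, h, rfl, rfl⟩) <;> simp [h]
  · rintro ⟨h, rfl | rfl⟩
    · exact Or.inl ⟨x, h, rfl, rfl⟩
    · exact Or.inr ⟨x, h, rfl, rfl⟩

lemma ver_mem_boundaryEdges {n k : ℕ} {x y : ℤ} :
    Edge.ver x y ∈ boundaryEdges n k ↔ (-(n : ℤ) ≤ y ∧ y < n) ∧ (x = k ∨ x = -k) := by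
  simp only [boundaryEdges, Finset.mem_union, Finset.mem_image, Finset.mem_Ico, Edge.ver.injEq,
    reduceCtorEq, and_false, exists_false, false_or]
  constructor
  · rintro (⟨a, h, rfl, rfl⟩ | ⟨a, h, rfl, rfl⟩) <;> simp [h]
  · rintro ⟨h, rfl | rfl⟩
    · exact Or.inl ⟨y, h, rfl, rfl⟩
    · exact Or.inr ⟨y, h, rfl, rfl⟩

lemma boundaryEdges_subset_edges (n k : ℕ) : boundaryEdges n k ⊆ edges n k := by
  intro e he
  cases e with
  | hor x y => rw [hor_mem_boundaryEdges] at he; rw [hor_mem_edges]; omega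
  | ver x y => rw [ver_mem_boundaryEdges] at he; rw [ver_mem_edges]; omega

lemma prod_boundaryEdges {n k : ℕ} (hn : 1 ≤ n) (hk : 1 ≤ k) (f : Edge → ℤˣ) :
    ∏ e ∈ boundaryEdges n k, f e
      = (∏ x ∈ Finset.Ico (-(k : ℤ)) k, f (.hor x n)) * (∏ x ∈ Finset.Ico (-(k : ℤ)) k, f (.hor x (-n)))
        * (∏ y ∈ Finset.Ico (-(n : ℤ)) n, f (.ver k y))
        * ∏ y ∈ Finset.Ico (-(n : ℤ)) n, f (.ver (-k) y) := by
  unfold boundaryEdges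
  rw [Finset.prod_union, Finset.prod_union, Finset.prod_union, Finset.prod_image, Finset.prod_image,
    Finset.prod_image, Finset.prod_image]
  · intro a _ b _ h; simpa using h
  · intro a _ b _ h; simpa using h
  · intro a _ b _ h; simpa using h
  · intro a _ b _ h; simpa using h
  · rw [Finset.disjoint_left]
    intro e h1 h2
    simp only [Finset.mem_image] at h1 h2
    obtain ⟨a, _, rfl⟩ := h1
    obtain ⟨b, _, h⟩ := h2
    simp only [Edge.hor.injEq] at h
    omega
  · rw [Finset.disjoint_left]
    intro e h1 h2
    simp only [Finset.mem_union, Finset.mem_image] at h1 h2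
    obtain ⟨b, _, rfl⟩ := h2
    simp at h1
  · rw [Finset.disjoint_left]
    intro e h1 h2
    simp only [Finset.mem_union, Finset.mem_image] at h1 h2
    obtain ⟨b, _, rfl⟩ := h2
    simp only [reduceCtorEq, and_false, exists_false, Edge.ver.injEq, false_or] at h1
    obtain ⟨a, _, h, _⟩ := h1
    omega

lemma prod_Ico_add_one (f : ℤ → ℤˣ) {a b : ℤ} (h : a ≤ b) :
    ∏ i ∈ Finset.Ico a (b + 1), f i = (∏ i ∈ Finset.Ico a b, f i) * f b := by
  have : Finset.Ico a (b + 1) = insert b (Finset.Ico a b) := by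
    ext i
    simp only [Finset.mem_Ico, Finset.mem_insert]
    omega
  rw [this, Finset.prod_insert (by simp), mul_comm]

/-- Signs with product one on the boundary cycle are the bonds of a state. -/
lemma exists_unitBond_boundary {n k : ℕ} (hn : 1 ≤ n) (hk : 1 ≤ k) (f : Edge → ℤˣ)
    (hf : ∏ e ∈ boundaryEdges n k, f e = 1) :
    ∃ σ : State, ∀ e ∈ boundaryEdges n k, unitBond σ e = f e := by
  -- The spins are the partial products of `f` along the sides, starting with spin one at the lower
  -- left corner.
  set T : ℤ → ℤˣ := fun x => ∏ i ∈ Finset.Ico (-(k : ℤ)) x, f (.hor i n) with hT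
  set B : ℤ → ℤˣ := fun x => ∏ i ∈ Finset.Ico (-(k : ℤ)) x, f (.hor i (-n)) with hB
  set R : ℤ → ℤˣ := fun y => ∏ i ∈ Finset.Ico (-(n : ℤ)) y, f (.ver k i) with hR
  set L : ℤ → ℤˣ := fun y => ∏ i ∈ Finset.Ico (-(n : ℤ)) y, f (.ver (-k) i) with hL
  rw [prod_boundaryEdges hn hk] at hf
  change T k * B k * R n * L n = 1 at hf
  have hclose : L n * T k = B k * R n := by
    rcases Int.units_eq_one_or (T k) with h1 | h1 <;>
    rcases Int.units_eq_one_or (B k) with h2 | h2 <;>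
    rcases Int.units_eq_one_or (R n) with h3 | h3 <;>
    rcases Int.units_eq_one_or (L n) with h4 | h4 <;> simp_all
  have cancel : ∀ a b : ℤˣ, a * (a * b) = b := by
    intro a b
    rw [← mul_assoc, Int.units_mul_self, one_mul]
  set σ : State := fun p => if p.1 = -k then L p.2 else if p.2 = n then L n * T p.1
    else if p.2 = -n then B p.1 else B k * R p.2 with hσ
  have hleft : ∀ y, σ (-k, y) = L y := fun y => by simp [hσ]
  have htop : ∀ x, σ (x, n) = L n * T x := by
    intro x
    by_cases hx : x = -k
    · subst hx; simp [hσ, hT]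
    · simp [hσ, hx]
  have hbot : ∀ x, σ (x, -n) = B x := by
    intro x
    by_cases hx : x = -k
    · subst hx; simp [hσ, hL, hB]
    · have : (-(n : ℤ)) ≠ n := by omega
      simp [hσ, hx, this]
  have hright : ∀ y, σ (k, y) = B k * R y := by
    intro y
    have hkk : (k : ℤ) ≠ -k := by omega
    by_cases hy : y = n
    · subst hy; rw [htop, hclose]
    · by_cases hy' : y = -n
      · subst hy'; rw [hbot]; simp [hR]
      · simp [hσ, hkk, hy, hy']
  refine ⟨σ, fun e he => ?_⟩
  unfold unitBond
  cases e with
  | hor x y =>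
    rw [hor_mem_boundaryEdges] at he
    obtain ⟨⟨h1, h2⟩, rfl | rfl⟩ := he
    · simp only [Edge.src, Edge.tgt, htop]
      simp only [hT]
      rw [prod_Ico_add_one _ h1, ← mul_assoc (L n), cancel]
    · simp only [Edge.src, Edge.tgt, hbot]
      simp only [hB]
      rw [prod_Ico_add_one _ h1, cancel]
  | ver x y =>
    rw [ver_mem_boundaryEdges] at he
    obtain ⟨⟨h1, h2⟩, rfl | rfl⟩ := he
    · simp only [Edge.src, Edge.tgt, hright]
      simp only [hR]
      rw [prod_Ico_add_one _ h1, ← mul_assoc (B k), cancel]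
    · simp only [Edge.src, Edge.tgt, hleft]
      simp only [hL]
      rw [prod_Ico_add_one _ h1, cancel]

/-- An even boundary cycle has spins that satisfy all of its edges, so a maximal number of satisfied
edges means all. -/
theorem IsCGroundState.satisfied_boundary {J : Couplings} (hJ : ∀ e, J e ≠ 0) {n k : ℕ}
    (hn : 1 ≤ n) (hk : 1 ≤ k) (hE : EvenBoundary J n k) {σ : State} (hσ : IsCGroundState J n k σ)
    {e : Edge} (he : e ∈ boundaryEdges n k) : Satisfied J σ e := by
  classical
  obtain ⟨τ, hτ⟩ := exists_unitBond_boundary hn hk (sgn J) (evenBoundary_iff.mp hE)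
  have h1 := hσ.1 τ
  have h2 : boundarySatisfied J n k τ = (boundaryEdges n k).card := by
    unfold boundarySatisfied
    rw [Finset.filter_true_of_mem]
    exact fun e he => (satisfied_iff_sgn (hJ e)).mpr (hτ e he)
  rw [h2] at h1
  have h3 := Finset.eq_of_subset_of_card_le (Finset.filter_subset (fun e => Satisfied J σ e) _)
    (by simpa [boundarySatisfied] using h1)
  rw [← h3] at he
  exact (Finset.mem_filter.mp he).2

/-! ### States restricted to finite sublattices, existence of c-groundstates -/

lemma src_mem_sites {n k : ℕ} {e : Edge} (he : e ∈ edges n k) : e.src ∈ sites n k := by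
  cases e with
  | hor x y => rw [hor_mem_edges] at he; rw [mem_sites]; simp only [Edge.src]; omega
  | ver x y => rw [ver_mem_edges] at he; rw [mem_sites]; simp only [Edge.src]; omega

lemma tgt_mem_sites {n k : ℕ} {e : Edge} (he : e ∈ edges n k) : e.tgt ∈ sites n k := by
  cases e with
  | hor x y => rw [hor_mem_edges] at he; rw [mem_sites]; simp only [Edge.tgt]; omega
  | ver x y => rw [ver_mem_edges] at he; rw [mem_sites]; simp only [Edge.tgt]; omega

lemma endpoints_mem_boundarySites {n k : ℕ} {e : Edge} (he : e ∈ boundaryEdges n k) :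
    e.src ∈ boundarySites n k ∧ e.tgt ∈ boundarySites n k := by
  have h := boundaryEdges_subset_edges n k he
  simp only [boundarySites, Finset.mem_filter]
  refine ⟨⟨src_mem_sites h, ?_⟩, ⟨tgt_mem_sites h, ?_⟩⟩ <;>
  · cases e with
    | hor x y => rw [hor_mem_boundaryEdges] at he; simp only [Edge.src, Edge.tgt]; omega
    | ver x y => rw [ver_mem_boundaryEdges] at he; simp only [Edge.src, Edge.tgt]; omega

lemma bond_congr {σ τ : State} {n k : ℕ} (h : ∀ x ∈ sites n k, σ x = τ x) {e : Edge}
    (he : e ∈ edges n k) : bond σ e = bond τ e := by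
  unfold bond
  rw [h _ (src_mem_sites he), h _ (tgt_mem_sites he)]

lemma energyOn_congr {J : Couplings} {σ τ : State} {n k : ℕ} (h : ∀ x ∈ sites n k, σ x = τ x) :
    energyOn (edges n k) J σ = energyOn (edges n k) J τ := by
  unfold energyOn
  rw [Finset.sum_congr rfl fun e he => by rw [bond_congr h he]]

lemma boundarySatisfied_congr {J : Couplings} {σ τ : State} {n k : ℕ}
    (h : ∀ x ∈ boundarySites n k, σ x = τ x) :
    boundarySatisfied J n k σ = boundarySatisfied J n k τ := by
  classical
  unfold boundarySatisfied
  congr 1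
  refine Finset.filter_congr fun e he => ?_
  have := endpoints_mem_boundarySites he
  unfold Satisfied bond
  rw [h _ this.1, h _ this.2]

/-- The state that agrees with `σ` in `C(n,k)` and is constant outside. -/
def clip (n k : ℕ) (σ : State) : State := fun x => if x ∈ sites n k then σ x else 1

lemma clip_apply {n k : ℕ} {σ : State} {x : Site} (hx : x ∈ sites n k) : clip n k σ x = σ x := by
  simp [clip, hx]

lemma finite_range_clip (n k : ℕ) : (Set.range (clip n k)).Finite := by
  refine (Set.finite_range fun (f : sites n k → ℤˣ) (x : Site) =>
    if hx : x ∈ sites n k then f ⟨x, hx⟩ else 1).subset ?_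
  rintro _ ⟨σ, rfl⟩
  refine ⟨fun x => σ x, ?_⟩
  funext x
  by_cases hx : x ∈ sites n k <;> simp [clip, hx]

lemma boundarySites_subset (n k : ℕ) : boundarySites n k ⊆ sites n k := Finset.filter_subset _ _

/-- Energy and boundary count read only the spins in C(n,k), so both extrema are attained among the
finitely many clipped states. -/
theorem exists_isCGroundState (J : Couplings) (n k : ℕ) : ∃ σ, IsCGroundState J n k σ := by
  classical
  have hbdd : BddAbove (Set.range (boundarySatisfied J n k)) := by
    refine ⟨(boundaryEdges n k).card, ?_⟩
    rintro _ ⟨τ, rfl⟩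
    exact Finset.card_filter_le _ _
  obtain ⟨τ₀, hτ₀⟩ := Nat.sSup_mem (Set.range_nonempty (boundarySatisfied J n k)) hbdd
  have hmax : ∀ τ, boundarySatisfied J n k τ ≤ boundarySatisfied J n k τ₀ := fun τ => by
    rw [hτ₀]
    exact le_csSup hbdd ⟨τ, rfl⟩
  set S : Set State := {τ ∈ Set.range (clip n k) | ∀ x ∈ boundarySites n k, τ x = τ₀ x} with hS
  have hfin : S.Finite := (finite_range_clip n k).subset fun _ h => h.1
  have hne : S.Nonempty :=
    ⟨clip n k τ₀, ⟨_, rfl⟩, fun x hx => clip_apply (boundarySites_subset n k hx)⟩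
  obtain ⟨σ, hσ, hmin⟩ := Set.exists_min_image S (energyOn (edges n k) J) hfin hne
  refine ⟨σ, fun τ => ?_, fun τ hτ => ?_⟩
  · rw [boundarySatisfied_congr hσ.2]
    exact hmax τ
  · have h1 : energyOn (edges n k) J τ = energyOn (edges n k) J (clip n k τ) :=
      energyOn_congr fun x hx => (clip_apply hx).symm
    rw [h1]
    refine hmin _ ⟨⟨_, rfl⟩, fun x hx => ?_⟩
    rw [clip_apply (boundarySites_subset n k hx), hτ x hx, hσ.2 x hx]

end EASpinGlass
end

/-! ### The wall of a regular pair and its crossings of barriers -/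

noncomputable section
namespace EASpinGlass

/-! ### Domain walls between c-groundstates -/

open Classical in
/-- The non-boundary edges of `C(n,k)` dissatisfied by `σ`. -/
def disEdges (J : Couplings) (n k : ℕ) (σ : State) : Finset Edge :=
  (edges n k \ boundaryEdges n k).filter fun e => ¬ Satisfied J σ e

lemma mem_disEdges {J : Couplings} {n k : ℕ} {σ : State} {e : Edge} :
    e ∈ disEdges J n k σ ↔ (e ∈ edges n k ∧ e ∉ boundaryEdges n k) ∧ ¬ Satisfied J σ e := by
  simp [disEdges]

lemma disDual_eq (J : Couplings) (n k : ℕ) (σ : State) :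
    disDual J n k σ = dualEdge '' (disEdges J n k σ : Set Edge) := by
  unfold disDual
  congr 1
  ext e
  simp [mem_disEdges, and_assoc]

/-- The edges dissatisfied by exactly one of the states `r` of `C(n-1,k)` and `s` of `C(n,k)`. -/
def wall (J : Couplings) (n k : ℕ) (r s : State) : Finset Edge :=
  symmDiff (disEdges J (n - 1) k r) (disEdges J n k s)

lemma fromEdgeSet_symmDiff_disDual (J : Couplings) (n k : ℕ) (r s : State) :
    SimpleGraph.fromEdgeSet (symmDiff (disDual J (n - 1) k r) (disDual J n k s))
      = wallGraph (wall J n k r s) := by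
  rw [disDual_eq, disDual_eq, ← Set.image_symmDiff dualEdge_injective, wallGraph, wall,
    Finset.coe_symmDiff]

/-- Omitting the boundary edges does not change the number of dissatisfied edges of a plaquette of
C(n,k), because they are all satisfied. Plaquettes outside have no inner edge at all. -/
lemma odd_disEdges_iff {J : Couplings} (hJ : ∀ e, J e ≠ 0) {n k : ℕ} {σ : State}
    (hσ : ∀ e ∈ boundaryEdges n k, Satisfied J σ e) (p : Plaquette) :
    Odd ((disEdges J n k σ).filter fun e => e ∈ plaquetteEdges p).card ↔
      ((-(k : ℤ) ≤ p.1 ∧ p.1 < k) ∧ -(n : ℤ) ≤ p.2 ∧ p.2 < n) ∧ Frustrated J p := by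
  classical
  by_cases hp : (-(k : ℤ) ≤ p.1 ∧ p.1 < k) ∧ -(n : ℤ) ≤ p.2 ∧ p.2 < n
  · rw [← odd_unsatisfied_iff hJ σ p]
    have : (disEdges J n k σ).filter (fun e => e ∈ plaquetteEdges p)
        = (plaquetteEdges p).filter fun e => ¬ Satisfied J σ e := by
      ext e
      rw [Finset.mem_filter, Finset.mem_filter, mem_disEdges]
      constructor
      · tauto
      · rintro ⟨h1, h2⟩
        refine ⟨⟨⟨?_, fun h => h2 (hσ e h)⟩, h2⟩, h1⟩
        rw [mem_plaquetteEdges] at h1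
        obtain ⟨a, b⟩ := p
        cases e with
        | hor x y =>
          simp only [dualEdge, Sym2.mem_iff, Prod.mk.injEq] at h1
          rw [hor_mem_edges]
          simp only at hp
          omega
        | ver x y =>
          simp only [dualEdge, Sym2.mem_iff, Prod.mk.injEq] at h1
          rw [ver_mem_edges]
          simp only at hp
          omega
    rw [this]
    simp [hp]
  · have : (disEdges J n k σ).filter (fun e => e ∈ plaquetteEdges p) = ∅ := by
      rw [Finset.filter_eq_empty_iff]
      intro e he h1
      rw [mem_disEdges] at he
      rw [mem_plaquetteEdges] at h1
      obtain ⟨a, b⟩ := p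
      apply hp
      cases e with
      | hor x y =>
        simp only [dualEdge, Sym2.mem_iff, Prod.mk.injEq] at h1
        rw [hor_mem_edges, hor_mem_boundaryEdges] at he
        simp only
        omega
      | ver x y =>
        simp only [dualEdge, Sym2.mem_iff, Prod.mk.injEq] at h1
        rw [ver_mem_edges, ver_mem_boundaryEdges] at he
        simp only
        omega
    rw [this]
    simp [hp]

lemma odd_card_filter_symmDiff {ι : Type*} [DecidableEq ι] (A B : Finset ι) (P : ι → Prop)
    [DecidablePred P] :
    Odd ((symmDiff A B).filter P).card ↔ Xor (Odd (A.filter P).card) (Odd (B.filter P).card) := by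
  have h1 : (symmDiff A B).filter P = (A.filter P \ B.filter P) ∪ (B.filter P \ A.filter P) := by
    ext x
    simp only [Finset.mem_filter, Finset.mem_symmDiff, Finset.mem_union, Finset.mem_sdiff]
    tauto
  rw [h1, Finset.card_union_of_disjoint disjoint_sdiff_sdiff]
  have h2 := Finset.card_sdiff_add_card_inter (A.filter P) (B.filter P)
  have h3 := Finset.card_sdiff_add_card_inter (B.filter P) (A.filter P)
  rw [Finset.inter_comm] at h3
  rw [xor_iff_not_iff, ← h2, ← h3]
  simp only [Nat.odd_iff]
  omega

/-- The part of regularity of the pair `C(n,k), C(n-1,k)` that concerns the half-width `k` only. -/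
structure IsRegularAt (J : Couplings) (n k : ℕ) : Prop where
  two_le : 2 ≤ n
  one_le : 1 ≤ k
  even : EvenBoundary J n k
  even_pred : EvenBoundary J (n - 1) k
  upper : ∀ x : ℤ, -(k : ℤ) ≤ x → x < k → (Frustrated J (x, (n : ℤ) - 1) ↔ x = 0)
  lower : ∀ x : ℤ, -(k : ℤ) ≤ x → x < k → (Frustrated J (x, -(n : ℤ)) ↔ x = 0)

lemma IsRegularAt.of_eventR {J : Couplings} {n k k' : ℕ} (hn : 2 ≤ n) (hk' : 1 ≤ k') (hk : k' ≤ k)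
    (hJ : J ∈ eventR n k) : IsRegularAt J n k' := by
  obtain ⟨⟨-, h1, h2, h3⟩, -⟩ := hJ
  refine ⟨hn, hk', (h1 k' hk' hk).1, (h1 k' hk' hk).2, fun x hx1 hx2 => ?_, fun x hx1 hx2 => ?_⟩
  · rw [h2 (x, (n : ℤ) - 1) (by simp [upperPart]; omega), Prod.mk.injEq]
    omega
  · rw [h3 (x, -(n : ℤ)) (by simp [lowerPart]; omega), Prod.mk.injEq]
    omega

variable {J : Couplings} {n k : ℕ} {r s : State}

/-- Degrees in a symmetric difference add modulo 2. A frustrated plaquette of C(n-1,k) is odd for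
both states and cancels; what remains is the frustration of the two rows that C(n,k) adds. -/
lemma IsRegularAt.odd_wall_iff (hR : IsRegularAt J n k) (hJ : Generic J)
    (hr : IsCGroundState J (n - 1) k r) (hs : IsCGroundState J n k s) (p : Plaquette) :
    Odd ((wall J n k r s).filter fun e => e ∈ plaquetteEdges p).card ↔
      p = (0, (n : ℤ) - 1) ∨ p = (0, -(n : ℤ)) := by
  have h2 := hR.two_le
  have h1 := hR.one_le
  rw [wall, odd_card_filter_symmDiff,
    odd_disEdges_iff hJ.ne_zero
      (fun e he => hr.satisfied_boundary hJ.ne_zero (by omega) hR.one_le hR.even_pred he),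
    odd_disEdges_iff hJ.ne_zero
      (fun e he => hs.satisfied_boundary hJ.ne_zero (by omega) hR.one_le hR.even he)]
  obtain ⟨x, y⟩ := p
  simp only [Prod.mk.injEq]
  rw [show ((n - 1 : ℕ) : ℤ) = n - 1 by omega, xor_iff_not_iff]
  by_cases hx : -(k : ℤ) ≤ x ∧ x < k
  · by_cases hy : y = n - 1
    · subst hy
      rw [hR.upper x hx.1 hx.2]
      omega
    · by_cases hy' : y = -n
      · subst hy'
        rw [hR.lower x hx.1 hx.2]
        omega
      · have : (-((n : ℤ) - 1) ≤ y ∧ y < (n : ℤ) - 1) ↔ (-(n : ℤ) ≤ y ∧ y < n) := by omega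
        rw [this]
        tauto
  · simp only [hx, false_and, iff_self, not_true_eq_false, false_iff]
    omega

lemma IsRegularAt.reachable (hR : IsRegularAt J n k) (hJ : Generic J)
    (hr : IsCGroundState J (n - 1) k r) (hs : IsCGroundState J n k s) :
    (wallGraph (wall J n k r s)).Reachable (0, (n : ℤ) - 1) (0, -(n : ℤ)) := by
  obtain ⟨q, h1, h2, h3⟩ := exists_reachable_odd (wall J n k r s) (p := (0, (n : ℤ) - 1))
    ((hR.odd_wall_iff hJ hr hs _).mpr (Or.inl rfl))
  rw [hR.odd_wall_iff hJ hr hs] at h2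
  rcases h2 with h2 | h2
  · exact absurd h2 h1
  · rwa [h2] at h3

/-- Some path in `G` from `p` to `q` contains the dual of an edge near the origin. -/
def PathNearOrigin (G : SimpleGraph Plaquette) (p q : Plaquette) : Prop :=
  ∃ P : G.Walk p q, P.IsPath ∧ ∃ e : Edge, dualEdge e ∈ P.edges ∧ NearOrigin e

/-- Each added part is a single row with one frustrated plaquette, so the end points of the path are
forced. -/
lemma IsRegularAt.mem_eventA_iff (hR : IsRegularAt J n k) :
    J ∈ eventA n k ↔ ∃ r s : State, IsCGroundState J (n - 1) k r ∧ IsCGroundState J n k s ∧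
      PathNearOrigin (wallGraph (wall J n k r s)) (0, (n : ℤ) - 1) (0, -(n : ℤ)) := by
  have h2 := hR.two_le
  have h1 := hR.one_le
  simp only [eventA, Set.mem_ofPred_eq]
  constructor
  · rintro ⟨r, s, hr, hs, ⟨x, y⟩, hp, ⟨x', y'⟩, hq, hFp, hFq, P, hP⟩
    simp only [upperPart, lowerPart, Finset.mem_product, Finset.mem_Ico] at hp hq
    obtain rfl : y = n - 1 := by omega
    obtain rfl : y' = -n := by omega
    obtain rfl := (hR.upper x hp.1.1 hp.1.2).mp hFp
    obtain rfl := (hR.lower x' hq.1.1 hq.1.2).mp hFq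
    have hPO : PathNearOrigin _ _ _ := ⟨P, hP⟩
    rw [fromEdgeSet_symmDiff_disDual] at hPO
    exact ⟨r, s, hr, hs, hPO⟩
  · rintro ⟨r, s, hr, hs, hPO⟩
    rw [← fromEdgeSet_symmDiff_disDual] at hPO
    obtain ⟨P, hP⟩ := hPO
    refine ⟨r, s, hr, hs, _, ?_, _, ?_, ?_, ?_, P, hP⟩
    · simp only [upperPart, Finset.mem_product, Finset.mem_Ico]
      omega
    · simp only [lowerPart, Finset.mem_product, Finset.mem_Ico]
      omega
    · exact (hR.upper 0 (by omega) (by omega)).mpr rfl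
    · exact (hR.lower 0 (by omega) (by omega)).mpr rfl

/-! ### Domain walls and barriers -/

lemma openBox_mono {k : ℕ} {b t b' t' : ℤ} (hb : b' ≤ b) (ht : t ≤ t') :
    openBox k b t ⊆ openBox k b' t' := by
  intro p hp
  rw [mem_openBox] at *
  omega

lemma IsCGroundState.satisfied_barrier {σ : State} (hσ : IsCGroundState J n k σ) {h : ℤ}
    (hB : IsBarrier J h k) (h1 : -(n : ℤ) < h) (h2 : h < n) {x : ℤ} (hx1 : -(k : ℤ) ≤ x)
    (hx2 : x < k) (hx0 : x ≠ 0) : Satisfied J σ (.hor x h) :=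
  hB.satisfied (fun _ hA => hσ.flipStable (hA.trans (openBox_mono (by omega) (by omega))))
    hx1 hx2 hx0

/-- Both states satisfy all barrier edges off the middle column, so none of these is in the wall:
the middle edge is the only gate through a barrier. -/
lemma eq_zero_of_hor_mem_wall (hr : IsCGroundState J (n - 1) k r)
    (hs : IsCGroundState J n k s) {h : ℤ} (hB : IsBarrier J h k) (h1 : -((n : ℤ) - 1) < h)
    (h2 : h < (n : ℤ) - 1) {x : ℤ} (hx : Edge.hor x h ∈ wall J n k r s) : x = 0 := by
  by_contra hx0
  rw [wall, Finset.mem_symmDiff, mem_disEdges, mem_disEdges, hor_mem_edges, hor_mem_edges] at hx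
  rcases hx with ⟨⟨⟨h3, -⟩, h4⟩, -⟩ | ⟨⟨⟨h3, -⟩, h4⟩, -⟩
  · exact h4 (hr.satisfied_barrier hB (by omega) (by omega) h3.1.1 h3.1.2 hx0)
  · exact h4 (hs.satisfied_barrier hB (by omega) (by omega) h3.1.1 h3.1.2 hx0)

lemma support_subset_of_closed {V : Type*} {G : SimpleGraph V} {S : Set V}
    (hS : ∀ a b, G.Adj a b → b ∈ S) {u v : V} (P : G.Walk u v) (hu : u ∈ S) :
    ∀ x ∈ P.support, x ∈ S := by
  induction P with
  | nil => simpa using hu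
  | cons h p ih =>
    intro x hx
    rw [SimpleGraph.Walk.support_cons, List.mem_cons] at hx
    rcases hx with rfl | hx
    · exact hu
    · exact ih (hS _ _ h) x hx

/-- A family of parity conditions forces a path on one side of a line. -/
lemma exists_path_of_parity {D : Finset Edge} {S : Set Plaquette} {p q : Plaquette} {m : Edge}
    (hpS : p ∈ S) (hpm : p ∉ dualEdge m) (hqm : q ∈ dualEdge m)
    (hqS : ∀ a ∈ S, a ∈ dualEdge m → a = q)
    (hcross : ∀ e ∈ D, e ≠ m → ∀ a b, dualEdge e = s(a, b) → a ∈ S → b ∈ S)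
    (hodd : ∀ a ∈ S, Odd (D.filter fun e => e ∈ plaquetteEdges a).card ↔ a = p) :
    m ∈ D ∧ ∃ P : (wallGraph D).Walk p q, P.IsPath ∧ ∀ x ∈ P.support, x ∈ S := by
  classical
  -- Close the gate `m` and keep the edges inside `S`. Only degrees at ends of `m` can change, so
  -- `p` stays odd and needs an odd partner in `S`.
  set D' := D.filter fun e => e ≠ m ∧ ∀ a ∈ dualEdge e, a ∈ S with hD'
  have hin : ∀ e ∈ D, e ≠ m → ∀ a ∈ S, a ∈ dualEdge e → e ∈ D' := by
    intro e he hem a ha hae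
    rw [hD', Finset.mem_filter]
    refine ⟨he, hem, ?_⟩
    obtain ⟨b, hb⟩ := Sym2.mem_iff_exists.mp hae
    have := hcross e he hem a b hb ha
    intro c hc
    rw [hb, Sym2.mem_iff] at hc
    rcases hc with rfl | rfl <;> assumption
  have hsame : ∀ a ∈ S, (m ∈ D → a ∉ dualEdge m) →
      D'.filter (fun e => e ∈ plaquetteEdges a) = D.filter fun e => e ∈ plaquetteEdges a := by
    intro a ha ham
    refine Finset.ext fun e => ⟨fun h => ?_, fun h => ?_⟩
    · obtain ⟨h1, h2⟩ := Finset.mem_filter.mp h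
      exact Finset.mem_filter.mpr ⟨(Finset.mem_filter.mp h1).1, h2⟩
    · obtain ⟨h1, h2⟩ := Finset.mem_filter.mp h
      refine Finset.mem_filter.mpr ⟨hin e h1 ?_ a ha (mem_plaquetteEdges.mp h2), h2⟩
      rintro rfl
      exact ham h1 (mem_plaquetteEdges.mp h2)
  obtain ⟨q', h1, h2, h3⟩ := exists_reachable_odd D' (p := p) (by
    rw [hsame p hpS fun _ => hpm]
    exact (hodd p hpS).mpr rfl)
  have hq'S : q' ∈ S := by
    obtain ⟨e, he⟩ := Finset.card_pos.mp h2.pos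
    rw [Finset.mem_filter, mem_plaquetteEdges, hD', Finset.mem_filter] at he
    exact he.1.2.2 _ he.2
  -- The partner has even degree in `D`, so it must have lost `m`; this shows at once that `m` is in
  -- `D` and that the partner is `q`.
  have hq' : ¬ (m ∈ D → q' ∉ dualEdge m) := by
    intro h
    rw [hsame q' hq'S h, hodd q' hq'S] at h2
    exact h1 h2
  push Not at hq'
  obtain ⟨hm, hq'm⟩ := hq'
  obtain rfl := hqS q' hq'S hq'm
  refine ⟨hm, ?_⟩
  obtain ⟨P, hP⟩ := h3.exists_isPath
  have hle : wallGraph D' ≤ wallGraph D := by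
    intro a b hab
    rw [wallGraph_adj] at *
    obtain ⟨e, he, h⟩ := hab
    exact ⟨e, (Finset.mem_filter.mp he).1, h⟩
  refine ⟨P.mapLe hle, hP.mapLe hle, ?_⟩
  rw [SimpleGraph.Walk.support_mapLe_eq_support]
  refine support_subset_of_closed (fun a b hab => ?_) P hpS
  obtain ⟨e, he, h⟩ := wallGraph_adj.mp hab
  refine (Finset.mem_filter.mp he).2.2 b ?_
  rw [h]
  simp

section Lines

variable (hR : IsRegularAt J n k) (hJ : Generic J) (hr : IsCGroundState J (n - 1) k r)
  (hs : IsCGroundState J n k s) {h : ℤ} (hB : IsBarrier J h k) (h1 : -((n : ℤ) - 1) < h)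
  (h2 : h < (n : ℤ) - 1)

lemma dualEdge_crossing {e : Edge} {a b : Plaquette} (he : dualEdge e = s(a, b)) {h : ℤ}
    (ha : h ≤ a.2) (hb : b.2 < h) : ∃ x, e = .hor x h ∧ a = (x, h) ∧ b = (x, h - 1) := by
  obtain ⟨a1, a2⟩ := a
  obtain ⟨b1, b2⟩ := b
  cases e with
  | hor x y =>
    refine ⟨x, ?_⟩
    simp only [dualEdge, Sym2.eq_iff, Prod.mk.injEq, Edge.hor.injEq, true_and] at he ha hb ⊢
    rcases he with he | he
    · omega
    · refine ⟨?_, ⟨?_, ?_⟩, ?_, ?_⟩ <;> omega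
  | ver x y =>
    simp only [dualEdge, Sym2.eq_iff, Prod.mk.injEq] at he ha hb
    omega

include hr hs hB h1 h2 in
lemma wall_crossing {e : Edge} (he : e ∈ wall J n k r s) {a b : Plaquette}
    (hab : dualEdge e = s(a, b)) (ha : h ≤ a.2) (hb : b.2 < h) :
    e = .hor 0 h ∧ a = (0, h) ∧ b = (0, h - 1) := by
  obtain ⟨x, rfl, rfl, rfl⟩ := dualEdge_crossing hab ha hb
  obtain rfl := eq_zero_of_hor_mem_wall hr hs hB h1 h2 he
  exact ⟨rfl, rfl, rfl⟩

-- The region above the barrier contains just one plaquette of odd degree and has the middle edge as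
-- its only exit, so the wall must use that exit.
include hR hJ hr hs hB h1 h2 in
lemma exists_path_above : Edge.hor 0 h ∈ wall J n k r s ∧
    ∃ P : (wallGraph (wall J n k r s)).Walk (0, (n : ℤ) - 1) (0, h),
      P.IsPath ∧ ∀ x ∈ P.support, h ≤ x.2 := by
  refine exists_path_of_parity (S := {x | h ≤ x.2}) (m := .hor 0 h) ?_ ?_ ?_ ?_ ?_ ?_
  · simp only [Set.mem_ofPred_eq]; omega
  · simp only [dualEdge, Sym2.mem_iff, Prod.mk.injEq]; omega
  · simp [dualEdge]
  · rintro ⟨x, y⟩ ha hm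
    simp only [Set.mem_ofPred_eq, dualEdge, Sym2.mem_iff, Prod.mk.injEq] at ha hm ⊢
    omega
  · intro e he hem a b hab ha
    by_contra hb
    exact hem (wall_crossing hr hs hB h1 h2 he hab ha (not_le.mp hb)).1
  · rintro ⟨x, y⟩ ha
    rw [hR.odd_wall_iff hJ hr hs]
    simp only [Set.mem_ofPred_eq, Prod.mk.injEq] at ha ⊢
    omega

include hR hJ hr hs hB h1 h2 in
lemma exists_path_below :
    ∃ P : (wallGraph (wall J n k r s)).Walk (0, h - 1) (0, -(n : ℤ)),
      P.IsPath ∧ ∀ x ∈ P.support, x.2 < h := by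
  have key := exists_path_of_parity (D := wall J n k r s) (S := {x | x.2 < h})
    (p := (0, -(n : ℤ))) (q := (0, h - 1)) (m := .hor 0 h) ?_ ?_ ?_ ?_ ?_ ?_
  · obtain ⟨-, P, hP, hS⟩ := key
    exact ⟨P.reverse, hP.reverse, by simpa using hS⟩
  · simp only [Set.mem_ofPred_eq]; omega
  · simp only [dualEdge, Sym2.mem_iff, Prod.mk.injEq]; omega
  · simp [dualEdge]
  · rintro ⟨x, y⟩ ha hm
    simp only [Set.mem_ofPred_eq, dualEdge, Sym2.mem_iff, Prod.mk.injEq] at ha hm ⊢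
    omega
  · intro e he hem a b hab ha
    by_contra hb
    exact hem (wall_crossing hr hs hB h1 h2 he (hab.trans Sym2.eq_swap) (not_lt.mp hb) ha).1
  · rintro ⟨x, y⟩ ha
    rw [hR.odd_wall_iff hJ hr hs]
    simp only [Set.mem_ofPred_eq, Prod.mk.injEq] at ha ⊢
    omega

end Lines

/-- A barrier through the origin forces the event `A`. -/
theorem mem_eventA_of_barrier (hJ : Generic J) (hR : IsRegularAt J n k) (hn : 3 ≤ n)
    (hB : IsBarrier J 0 k) : J ∈ eventA n k := by
  rw [hR.mem_eventA_iff]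
  obtain ⟨r, hr⟩ := exists_isCGroundState J (n - 1) k
  obtain ⟨s, hs⟩ := exists_isCGroundState J n k
  obtain ⟨P, hP⟩ := (hR.reachable hJ hr hs).exists_isPath
  refine ⟨r, s, hr, hs, P, hP, .hor 0 0, ?_, by simp [NearOrigin, Edge.src]⟩
  -- The path ends below height 0 and so crosses the barrier, necessarily through its middle edge,
  -- which is incident to the origin.
  obtain ⟨d, hd, hd1, hd2⟩ := P.exists_boundary_dart {x | 0 ≤ x.2}
    (by simp only [Set.mem_ofPred_eq]; omega) (by simp only [Set.mem_ofPred_eq]; omega)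
  obtain ⟨e, he, hed⟩ := wallGraph_adj.mp d.adj
  have h3 := (wall_crossing hr hs hB (by omega) (by omega) he hed hd1 (not_le.mp hd2)).1
  rw [← h3, hed]
  exact List.mem_map.mpr ⟨d, hd, rfl⟩

end EASpinGlass
end

/-! ### Independence of the event A from the height of the sublattice -/

noncomputable section
namespace EASpinGlass

/-! ### Transferring paths between two regular pairs -/

/-- The set `S` separates the two supports, so gluing creates no repetition. -/
lemma IsPath.append_cons {V : Type*} {G : SimpleGraph V} {S : Set V} {u a b v : V}
    {p : G.Walk u a} {q : G.Walk b v} (hp : p.IsPath) (hq : q.IsPath) (h : G.Adj a b)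
    (hpS : ∀ x ∈ p.support, x ∈ S) (hqS : ∀ x ∈ q.support, x ∉ S) :
    (p.append (.cons h q)).IsPath := by
  rw [SimpleGraph.Walk.isPath_def, SimpleGraph.Walk.support_append,
    SimpleGraph.Walk.support_cons, List.tail_cons]
  exact List.Nodup.append hp.support_nodup hq.support_nodup
    fun x h1 h2 => hqS x h2 (hpS x h1)

/-- A path that leaves a set which has a unique exit splits at that exit. -/
lemma IsPath.exists_split {V : Type*} {G : SimpleGraph V} {S : Set V} {a b : V}
    (hcross : ∀ x y, G.Adj x y → x ∈ S → y ∉ S → x = a ∧ y = b) {u v : V}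
    (P : G.Walk u v) (hP : P.IsPath) (hu : u ∈ S) (hv : v ∉ S) :
    ∃ (P₁ : G.Walk u a) (P₂ : G.Walk b v), P₁.IsPath ∧ P₂.IsPath ∧
      (∀ x ∈ P₁.support, x ∈ S ∧ x ∈ P.support) ∧ (∀ x ∈ P₂.support, x ∉ S) ∧
      ∀ e ∈ P.edges, e ∈ P₁.edges ∨ e = s(a, b) ∨ e ∈ P₂.edges := by
  induction P with
  | nil => exact absurd hu hv
  | @cons u w v h p ih =>
    rw [SimpleGraph.Walk.cons_isPath_iff] at hP
    by_cases hw : w ∈ S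
    · obtain ⟨P₁, P₂, h1, h2, h3, h4, h5⟩ := ih hP.1 hw hv
      refine ⟨.cons h P₁, P₂, ?_, h2, ?_, h4, ?_⟩
      · rw [SimpleGraph.Walk.cons_isPath_iff]
        exact ⟨h1, fun hc => hP.2 (h3 _ hc).2⟩
      · intro x hx
        rw [SimpleGraph.Walk.support_cons, List.mem_cons] at hx ⊢
        rcases hx with rfl | hx
        · exact ⟨hu, Or.inl rfl⟩
        · exact ⟨(h3 x hx).1, Or.inr (h3 x hx).2⟩
      · intro e he
        rw [SimpleGraph.Walk.edges_cons, List.mem_cons] at he ⊢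
        rcases he with rfl | he
        · exact Or.inl (Or.inl rfl)
        · rcases h5 e he with h | h
          · exact Or.inl (Or.inr h)
          · exact Or.inr h
    · obtain ⟨rfl, rfl⟩ := hcross _ _ h hu hw
      refine ⟨.nil, p, SimpleGraph.Walk.IsPath.nil, hP.1, ?_, ?_, ?_⟩
      · intro x hx
        rw [SimpleGraph.Walk.support_nil, List.mem_singleton] at hx
        subst hx
        exact ⟨hu, by simp⟩
      · classical
        intro x hx hxS
        -- If the rest of the path met `S` again, then, followed backwards from there, it would
        -- leave `S` through `a`, which the path has already visited.
        obtain ⟨d, hd, hd1, hd2⟩ := (p.takeUntil x hx).reverse.exists_boundary_dart S hxS hw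
        have h1 := (hcross _ _ d.adj hd1 hd2).1
        refine hP.2 (p.support_takeUntil_subset_support hx ?_)
        rw [← h1]
        have := SimpleGraph.Walk.dart_fst_mem_support_of_mem_darts _ hd
        simpa using this
      · intro e he
        rw [SimpleGraph.Walk.edges_cons, List.mem_cons] at he
        rcases he with rfl | he
        · exact Or.inr (Or.inl rfl)
        · exact Or.inr (Or.inr he)

variable {J : Couplings}

/-- `e` lies in the strip of half-width `k`, off its boundary. -/
def InColumns (k : ℕ) : Edge → Prop
  | .hor x _ => -(k : ℤ) ≤ x ∧ x < k
  | .ver x _ => -(k : ℤ) < x ∧ x < k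

/-- `e` lies strictly between the lines of heights `b` and `t`. -/
def Between (b t : ℤ) : Edge → Prop
  | .hor _ y => b < y ∧ y < t
  | .ver _ y => b ≤ y ∧ y < t

lemma mem_disEdges_iff_of_between {m k : ℕ} {σ : State} {b t : ℤ} (ht : t ≤ m) (hb : -(m : ℤ) ≤ b)
    {e : Edge} (he : Between b t e) :
    e ∈ disEdges J m k σ ↔ InColumns k e ∧ ¬ Satisfied J σ e := by
  rw [mem_disEdges]
  refine and_congr_left fun _ => ?_
  cases e with
  | hor x y =>
    simp only [Between, InColumns, hor_mem_edges, hor_mem_boundaryEdges] at *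
    omega
  | ver x y =>
    simp only [Between, InColumns, ver_mem_edges, ver_mem_boundaryEdges] at *
    omega

/-- The right-hand side does not mention `n`, which makes walls of sublattices of different heights
comparable. -/
lemma mem_wall_iff_of_between {n k : ℕ} {r s : State} {b t : ℤ} (ht : t ≤ (n : ℤ) - 1)
    (hb : -((n : ℤ) - 1) ≤ b) {e : Edge} (he : Between b t e) :
    e ∈ wall J n k r s ↔ InColumns k e ∧ ¬ (Satisfied J r e ↔ Satisfied J s e) := by
  rw [wall, Finset.mem_symmDiff, mem_disEdges_iff_of_between (by omega) (by omega) he,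
    mem_disEdges_iff_of_between (by omega) (by omega) he]
  tauto

/-- c-groundstates of two sublattices which agree on the middle edge of the upper one of two
barriers agree between the barriers. -/
lemma satisfied_iff_of_barriers (hJ : Generic J) {k : ℕ} (hk : 1 ≤ k) {b t : ℤ} (hbt : b ≤ t)
    (hBt : IsBarrier J t k) (hBb : IsBarrier J b k) {m m' : ℕ} {σ τ : State}
    (hσ : IsCGroundState J m k σ) (hτ : IsCGroundState J m' k τ)
    (hE : EvenBoundary J m k) (hE' : EvenBoundary J m' k)
    (h1 : t < m) (h2 : -(m : ℤ) < b) (h3 : t < m') (h4 : -(m' : ℤ) < b)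
    (hmid : Satisfied J σ (.hor 0 t) ↔ Satisfied J τ (.hor 0 t)) {e : Edge}
    (hcol : InColumns k e) (hbet : Between b t e) : Satisfied J σ e ↔ Satisfied J τ e := by
  have side : ∀ {e}, e ∈ boundaryEdges m k → e ∈ boundaryEdges m' k →
      unitBond σ e = unitBond τ e := by
    intro e h5 h6
    rw [hJ.unitBond_eq_iff]
    have h7 := hσ.satisfied_boundary hJ.ne_zero (by omega) hk hE h5
    have h8 := hτ.satisfied_boundary hJ.ne_zero (by omega) hk hE' h6
    tauto
  have line : ∀ {h}, IsBarrier J h k → b ≤ h → h ≤ t → ∀ x, -(k : ℤ) ≤ x → x < k → x ≠ 0 →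
      unitBond σ (.hor x h) = unitBond τ (.hor x h) := by
    intro h hB h5 h6 x hx1 hx2 hx0
    rw [hJ.unitBond_eq_iff]
    have h7 := hσ.satisfied_barrier hB (by omega) (by omega) hx1 hx2 hx0
    have h8 := hτ.satisfied_barrier hB (by omega) (by omega) hx1 hx2 hx0
    tauto
  -- The sides lie on satisfied boundaries and the two lines on barriers. Only the middle edge of
  -- the upper line needs a hypothesis, since `eq_in_box` does not ask for the one of the bottom
  -- line.
  obtain ⟨u, hu⟩ := hJ.eq_in_box hk hbt (σ := σ) (τ := τ)
    (fun _ hA => hσ.flipStable (hA.trans (openBox_mono (by omega) (by omega))))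
    (fun _ hA => hτ.flipStable (hA.trans (openBox_mono (by omega) (by omega))))
    (fun y h5 h6 => side (by rw [ver_mem_boundaryEdges]; omega) (by rw [ver_mem_boundaryEdges]; omega))
    (fun y h5 h6 => side (by rw [ver_mem_boundaryEdges]; omega) (by rw [ver_mem_boundaryEdges]; omega))
    (fun x h5 h6 => by
      by_cases hx : x = 0
      · subst hx
        rwa [hJ.unitBond_eq_iff]
      · exact line hBt hbt le_rfl x h5 h6 hx)
    (fun x h5 h6 hx => line hBb le_rfl hbt x h5 h6 hx)
  rw [← hJ.unitBond_eq_iff]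
  have key : ∀ a b : ℤˣ, u * a * (u * b) = a * b := fun a b => by
    rw [mul_mul_mul_comm, Int.units_mul_self, one_mul]
  unfold unitBond
  cases e with
  | hor x y =>
    simp only [InColumns, Between, Edge.src, Edge.tgt] at *
    rw [hu x y (by omega) (by omega) (by omega) (by omega),
      hu (x + 1) y (by omega) (by omega) (by omega) (by omega), key]
  | ver x y =>
    simp only [InColumns, Between, Edge.src, Edge.tgt] at *
    rw [hu x y (by omega) (by omega) (by omega) (by omega),
      hu x (y + 1) (by omega) (by omega) (by omega) (by omega), key]

/-- A plaquette may reach one unit below the edge. By this bound, barriers at heights at least 102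
and at most -102 enclose everything near the origin. -/
lemma NearOrigin.mem_dualEdge {e : Edge} (he : NearOrigin e) {p : Plaquette} (hp : p ∈ dualEdge e) :
    -101 ≤ p.2 ∧ p.2 ≤ 100 := by
  have key : ∀ x y : ℤ, x ^ 2 + y ^ 2 ≤ 100 ^ 2 → -100 ≤ y ∧ y ≤ 100 := fun x y h =>
    abs_le.mp (abs_le_of_sq_le_sq (by nlinarith [sq_nonneg x]) (by norm_num))
  obtain ⟨a, b⟩ := p
  cases e with
  | hor x y =>
    simp only [dualEdge, Sym2.mem_iff, Prod.mk.injEq, NearOrigin, Edge.src, Edge.tgt] at *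
    rcases he with he | he <;> · have := key _ _ he; omega
  | ver x y =>
    simp only [dualEdge, Sym2.mem_iff, Prod.mk.injEq, NearOrigin, Edge.src, Edge.tgt] at *
    rcases he with he | he <;> · have := key _ _ he; omega

lemma between_of_dualEdge {b t : ℤ} {e : Edge}
    (h : ∀ p ∈ dualEdge e, b ≤ p.2 ∧ p.2 < t) : Between b t e := by
  cases e with
  | hor x y =>
    have h1 := h (x, y - 1) (by simp [dualEdge])
    have h2 := h (x, y) (by simp [dualEdge])
    simp only [Between] at *
    omega
  | ver x y =>
    have h2 := h (x, y) (by simp [dualEdge])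
    simp only [Between] at *
    omega

/-- Given barriers above and below the origin, the event `A` does not depend on the height of the
sublattice. -/
theorem mem_eventA_of_barriers (hJ : Generic J) {n n' k : ℕ} (hR : IsRegularAt J n k)
    (hR' : IsRegularAt J n' k) {b t : ℤ} (hBt : IsBarrier J t k) (hBb : IsBarrier J b k)
    (ht : 102 ≤ t) (hb : b ≤ -102) (htn : t < (n : ℤ) - 1) (hbn : -((n : ℤ) - 1) < b)
    (htn' : t < (n' : ℤ) - 1) (hbn' : -((n' : ℤ) - 1) < b) (hA : J ∈ eventA n k) :
    J ∈ eventA n' k := by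
  obtain ⟨r, s, hr, hs, P, hP, e, he, hnear⟩ := hR.mem_eventA_iff.mp hA
  obtain ⟨r', hr'⟩ := exists_isCGroundState J (n' - 1) k
  obtain ⟨s', hs'⟩ := exists_isCGroundState J n' k
  have hk := hR.one_le
  -- the walls agree between the barriers
  have mid : ∀ {n r s}, IsRegularAt J n k → IsCGroundState J (n - 1) k r → IsCGroundState J n k s →
      t < (n : ℤ) - 1 → -((n : ℤ) - 1) < b →
      ¬ (Satisfied J r (.hor 0 t) ↔ Satisfied J s (.hor 0 t)) := by
    intro n r s hR hr hs h1 h2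
    exact ((mem_wall_iff_of_between (n := n) (b := b) (t := t + 1) (e := .hor 0 t) (by omega)
      (by omega) (by simp only [Between]; omega)).mp
        (exists_path_above hR hJ hr hs hBt (by omega) h1).1).2
  have hwall : ∀ f, Between b t f → (f ∈ wall J n k r s ↔ f ∈ wall J n' k r' s') := by
    intro f hf
    rw [mem_wall_iff_of_between htn.le hbn.le hf, mem_wall_iff_of_between htn'.le hbn'.le hf]
    refine and_congr_right fun hcol => ?_
    have m1 := mid hR hr hs htn hbn
    have m2 := mid hR' hr' hs' htn' hbn'
    have h2 := hR.two_le
    have h2' := hR'.two_le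
    -- At the middle edge of the upper barrier `r` and `s` differ, and so do `r'` and `s'`. Hence
    -- `r` agrees there with exactly one of `r'` and `s'`; the roles may be interchanged, but the
    -- wall is symmetric in the two states.
    by_cases hc : Satisfied J r (.hor 0 t) ↔ Satisfied J r' (.hor 0 t)
    · rw [satisfied_iff_of_barriers hJ hk (by omega) hBt hBb hr hr' hR.even_pred hR'.even_pred
        (by omega) (by omega) (by omega) (by omega) hc hcol hf,
        satisfied_iff_of_barriers hJ hk (by omega) hBt hBb hs hs' hR.even hR'.even
        (by omega) (by omega) (by omega) (by omega) (by tauto) hcol hf]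
    · rw [satisfied_iff_of_barriers hJ hk (by omega) hBt hBb hr hs' hR.even_pred hR'.even
        (by omega) (by omega) (by omega) (by omega) (by tauto) hcol hf,
        satisfied_iff_of_barriers hJ hk (by omega) hBt hBb hs hr' hR.even hR'.even_pred
        (by omega) (by omega) (by omega) (by omega) (by tauto) hcol hf]
      tauto
  -- the part of the path between the barriers
  obtain ⟨P₁, P₂, -, hP₂, hS₁, hS₂, hed⟩ := IsPath.exists_split (S := {x | t ≤ x.2})
    (a := (0, t)) (b := (0, t - 1)) (by
      intro x y hxy hx hy
      obtain ⟨f, hf, hfe⟩ := wallGraph_adj.mp hxy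
      exact (wall_crossing hr hs hBt (by omega) htn hf hfe hx (not_le.mp hy)).2)
    P hP (by simp only [Set.mem_ofPred_eq]; omega) (by simp only [Set.mem_ofPred_eq]; omega)
  obtain ⟨Q, P₃, hQ, -, hSQ, hS₃, hed'⟩ := IsPath.exists_split (S := {x | b ≤ x.2})
    (a := (0, b)) (b := (0, b - 1)) (by
      intro x y hxy hx hy
      obtain ⟨f, hf, hfe⟩ := wallGraph_adj.mp hxy
      exact (wall_crossing hr hs hBb hbn (by omega) hf hfe hx (not_le.mp hy)).2)
    P₂ hP₂ (by simp only [Set.mem_ofPred_eq]; omega) (by simp only [Set.mem_ofPred_eq]; omega)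
  have hQS : ∀ x ∈ Q.support, b ≤ x.2 ∧ x.2 < t := fun x hx =>
    ⟨(hSQ x hx).1, not_le.mp (hS₂ x (hSQ x hx).2)⟩
  have hnear' : ∀ x ∈ dualEdge e, b ≤ x.2 ∧ x.2 < t := by
    intro x hx
    have := hnear.mem_dualEdge hx
    omega
  -- The edge near the origin lies strictly between the barriers and so belongs neither to the outer
  -- pieces nor to the two crossings.
  have heQ : dualEdge e ∈ Q.edges := by
    rcases hed _ he with h | h | h
    · induction h0 : dualEdge e using Sym2.ind with
      | _ x y =>
        rw [h0] at h hnear'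
        have h1 := (hS₁ x (P₁.fst_mem_support_of_mem_edges h)).1
        have h2 := hnear' x (by simp)
        simp only [Set.mem_ofPred_eq] at h1
        omega
    · have := hnear' (0, t) (by simp [h])
      simp only at this
      omega
    · rcases hed' _ h with h | h | h
      · exact h
      · have := hnear' (0, b - 1) (by simp [h])
        simp only at this
        omega
      · induction h0 : dualEdge e using Sym2.ind with
        | _ x y =>
          rw [h0] at h hnear'
          exact absurd (hnear' x (by simp)).1 (hS₃ x (P₃.fst_mem_support_of_mem_edges h))
  -- The middle piece stays between the barriers, where the two walls coincide.
  have hQe : ∀ f ∈ Q.edges, f ∈ (wallGraph (wall J n' k r' s')).edgeSet := by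
    intro f hf
    induction f using Sym2.ind with
    | _ x y =>
      have hxy := Q.adj_of_mem_edges hf
      obtain ⟨g, hg, hge⟩ := wallGraph_adj.mp hxy
      rw [SimpleGraph.mem_edgeSet, wallGraph_adj]
      refine ⟨g, (hwall g (between_of_dualEdge fun p hp => ?_)).mp hg, hge⟩
      rw [hge, Sym2.mem_iff] at hp
      rcases hp with rfl | rfl
      · exact hQS _ (Q.fst_mem_support_of_mem_edges hf)
      · exact hQS _ (Q.snd_mem_support_of_mem_edges hf)
  -- the new path
  obtain ⟨htw, U, hU, hUS⟩ := exists_path_above hR' hJ hr' hs' hBt (by omega) htn'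
  obtain ⟨hbw, -⟩ := exists_path_above hR' hJ hr' hs' hBb hbn' (by omega)
  obtain ⟨L, hL, hLS⟩ := exists_path_below hR' hJ hr' hs' hBb hbn' (by omega)
  have adjt : (wallGraph (wall J n' k r' s')).Adj (0, t) (0, t - 1) :=
    wallGraph_adj.mpr ⟨_, htw, Sym2.eq_swap⟩
  have adjb : (wallGraph (wall J n' k r' s')).Adj (0, b) (0, b - 1) :=
    wallGraph_adj.mpr ⟨_, hbw, Sym2.eq_swap⟩
  have hlow : ((Q.transfer _ hQe).append (.cons adjb L)).IsPath := by
    refine IsPath.append_cons (S := {x | b ≤ x.2}) (hQ.transfer hQe) hL adjb ?_ ?_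
    · intro x hx
      rw [SimpleGraph.Walk.support_transfer] at hx
      exact (hQS x hx).1
    · exact fun x hx => not_le.mpr (hLS x hx)
  refine hR'.mem_eventA_iff.mpr ⟨r', s', hr', hs', U.append (.cons adjt _),
    IsPath.append_cons (S := {x : Plaquette | t ≤ x.2}) hU hlow adjt
      (fun x hx => hUS x hx) ?_, e, ?_, hnear⟩
  · intro x hx
    rw [SimpleGraph.Walk.mem_support_append_iff, SimpleGraph.Walk.support_transfer,
      SimpleGraph.Walk.support_cons, List.mem_cons] at hx
    rw [Set.mem_ofPred_eq, not_le]
    rcases hx with hx | rfl | hx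
    · exact (hQS x hx).2
    · simp only; omega
    · have := hLS x hx
      omega
  · simp only [SimpleGraph.Walk.edges_append, SimpleGraph.Walk.edges_cons,
      SimpleGraph.Walk.edges_transfer, List.mem_append, List.mem_cons]
    tauto

end EASpinGlass
end

/-! ### Limits along a nested sequence of sublattices -/

noncomputable section
namespace EASpinGlass

/-! ### Compactness -/

/-- Tychonoff for finite discrete factors: convergence in the product is eventual equality in each
coordinate, and countability of `ι` gives subsequences. -/
lemma exists_subseq_eventually_eq {ι α : Type*} [Countable ι] (g : ℕ → ι → α) (K : ι → Set α)
    (hK : ∀ i, (K i).Finite) (hg : ∀ j i, g j i ∈ K i) :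
    ∃ φ : ℕ → ℕ, StrictMono φ ∧ ∃ f : ι → α, ∀ i, ∀ᶠ j in Filter.atTop, g (φ j) i = f i := by
  let _ : TopologicalSpace α := ⊥
  have _ : DiscreteTopology α := ⟨rfl⟩
  have hc : IsCompact (Set.univ.pi K) := isCompact_univ_pi fun i => (hK i).isCompact
  obtain ⟨f, -, φ, hφ, hlim⟩ := hc.tendsto_subseq (x := g) fun j i _ => hg j i
  refine ⟨φ, hφ, f, fun i => ?_⟩
  exact (tendsto_pi_nhds.mp hlim i).eventually_mem
    (IsOpen.mem_nhds (isOpen_discrete {f i}) (Set.mem_singleton _))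

lemma abs_sub_le_of_step {F : ℤ → ℤ} (h : ∀ i, |F (i + 1) - F i| ≤ 1) (i : ℤ) :
    |F i - F 0| ≤ |i| := by
  induction i using Int.induction_on with
  | zero => simp
  | succ i ih =>
    have := h i
    rw [abs_le] at *
    rw [abs_of_nonneg (by omega)] at *
    omega
  | pred i ih =>
    have := h (-i - 1)
    rw [show -(i : ℤ) - 1 + 1 = -i by ring] at this
    rw [abs_le] at *
    rw [abs_of_nonpos (by omega)] at *
    omega

lemma dualEdge_step {e : Edge} {p q : Plaquette} (h : dualEdge e = s(p, q)) :
    |q.1 - p.1| ≤ 1 ∧ |q.2 - p.2| ≤ 1 := by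
  obtain ⟨a, b⟩ := p
  obtain ⟨c, d⟩ := q
  simp only [abs_le]
  cases e <;> simp only [dualEdge, Sym2.eq_iff, Prod.mk.injEq] at h <;> omega

lemma wallGraph_getVert_step {D : Finset Edge} {p q : Plaquette} (P : (wallGraph D).Walk p q)
    (m : ℕ) : |(P.getVert (m + 1)).1 - (P.getVert m).1| ≤ 1 ∧
      |(P.getVert (m + 1)).2 - (P.getVert m).2| ≤ 1 := by
  rcases lt_or_ge m P.length with h | h
  · obtain ⟨e, -, he⟩ := wallGraph_adj.mp (P.adj_getVert_succ h)
    exact dualEdge_step he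
  · rw [P.getVert_of_length_le h, P.getVert_of_length_le (by omega)]
    simp

lemma NearOrigin.mem_dualEdge_fst {e : Edge} (he : NearOrigin e) {p : Plaquette}
    (hp : p ∈ dualEdge e) : -101 ≤ p.1 ∧ p.1 ≤ 100 := by
  have key : ∀ x y : ℤ, x ^ 2 + y ^ 2 ≤ 100 ^ 2 → -100 ≤ x ∧ x ≤ 100 := fun x y h =>
    abs_le.mp (abs_le_of_sq_le_sq (by nlinarith [sq_nonneg y]) (by norm_num))
  obtain ⟨a, b⟩ := p
  cases e with
  | hor x y =>
    simp only [dualEdge, Sym2.mem_iff, Prod.mk.injEq, NearOrigin, Edge.src, Edge.tgt] at *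
    rcases he with he | he <;> · have := key _ _ he; omega
  | ver x y =>
    simp only [dualEdge, Sym2.mem_iff, Prod.mk.injEq, NearOrigin, Edge.src, Edge.tgt] at *
    rcases he with he | he <;> · have := key _ _ he; omega

/-- A path from height `n - 1` to height `-n` through a dual edge near the origin, parametrized by
the integers with the origin near `0`. -/
lemma exists_centred_parametrization {D : Finset Edge} {n : ℕ}
    (h : PathNearOrigin (wallGraph D) (0, (n : ℤ) - 1) (0, -(n : ℤ))) :
    ∃ f : ℤ → Plaquette,
      (∀ i, f i ∈ Set.Icc (-101 - |i|) (101 + |i|) ×ˢ Set.Icc (-101 - |i|) (101 + |i|)) ∧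
      (∀ i i' : ℤ, |i| ≤ n - 103 → |i'| ≤ n - 103 → f i = f i' → i = i') ∧
      ∀ i : ℤ, |i| ≤ n - 104 → ∃ e ∈ D, dualEdge e = s(f i, f (i + 1)) := by
  obtain ⟨P, hP, e, he, hnear⟩ := h
  obtain ⟨d, hd, hde⟩ := List.mem_map.mp he
  obtain ⟨a, ha, rfl⟩ := List.mem_iff_getElem.mp hd
  rw [SimpleGraph.Walk.length_darts] at ha
  -- Position 0 is the dart near the origin. Beyond the ends of the path `toNat` and `getVert` make
  -- `f` constant, so it moves by at most one in each coordinate everywhere.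
  set f : ℤ → Plaquette := fun i => P.getVert (a + i).toNat with hf
  have hf0 : f 0 ∈ dualEdge e := by
    have h0 : f 0 = (P.darts[a]'(by rwa [SimpleGraph.Walk.length_darts])).fst := by
      rw [SimpleGraph.Walk.darts_getElem_eq_getVert]
      simp [hf]
    rw [← hde, h0]
    exact Sym2.mem_mk_left _ _
  have h2 := hnear.mem_dualEdge hf0
  have h1 := hnear.mem_dualEdge_fst hf0
  have step : ∀ i, |(f (i + 1)).1 - (f i).1| ≤ 1 ∧ |(f (i + 1)).2 - (f i).2| ≤ 1 := by
    intro i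
    rcases lt_or_ge (a + i) 0 with hi | hi
    · simp only [hf]
      rw [Int.toNat_of_nonpos hi.le, Int.toNat_of_nonpos (by omega)]
      simp
    · simp only [hf]
      rw [show (a + (i + 1)).toNat = (a + i).toNat + 1 by omega]
      exact wallGraph_getVert_step P _
  have b1 := abs_sub_le_of_step (F := fun i => (f i).1) fun i => (step i).1
  have b2 := abs_sub_le_of_step (F := fun i => (f i).2) fun i => (step i).2
  -- The height changes by at most one per step, so climbing from near the origin to the end of the
  -- path takes about `n` steps; this keeps the path injective on a window that grows with `n`.
  have ha' : (n : ℤ) - 102 ≤ a := by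
    have := b2 (-a)
    rw [show f (-a) = (0, (n : ℤ) - 1) by simp [hf]] at this
    rw [abs_le, abs_neg, Nat.abs_cast] at this
    simp only at this
    omega
  have hl' : (n : ℤ) - 102 ≤ P.length - a := by
    have := b2 (P.length - a)
    rw [show f (P.length - a) = (0, -(n : ℤ)) by simp [hf]] at this
    rw [abs_le, abs_of_nonneg (by omega)] at this
    simp only at this
    omega
  refine ⟨f, fun i => ?_, fun i i' hi hi' hfi => ?_, fun i hi => ?_⟩
  · have c1 := b1 i
    have c2 := b2 i
    rw [abs_le] at c1 c2
    simp only [Set.mem_prod, Set.mem_Icc]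
    omega
  · rw [abs_le] at hi hi'
    have := hP.getVert_injOn (x₁ := (a + i).toNat) (x₂ := (a + i').toNat)
      (by simp only [Set.mem_ofPred_eq]; omega) (by simp only [Set.mem_ofPred_eq]; omega) hfi
    omega
  · rw [abs_le] at hi
    have := P.adj_getVert_succ (i := (a + i).toNat) (by omega)
    obtain ⟨g, hg, hge⟩ := wallGraph_adj.mp this
    refine ⟨g, hg, ?_⟩
    rw [hge]
    simp only [hf]
    rw [show (a + (i + 1)).toNat = (a + i).toNat + 1 by omega]

/-! ### The nested sequence -/

variable {J : Couplings}

/-- Two c-groundstates satisfy all boundary edges, so `eq_in_box` applies to the whole sublattice.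
This is why arbitrary choices of c-groundstates converge along with chosen ones. -/
lemma IsCGroundState.unique (hJ : Generic J) {n k : ℕ} (hn : 1 ≤ n) (hk : 1 ≤ k)
    (hE : EvenBoundary J n k) {σ τ : State} (hσ : IsCGroundState J n k σ)
    (hτ : IsCGroundState J n k τ) : ∃ u : ℤˣ, ∀ x ∈ sites n k, σ x = u * τ x := by
  have side : ∀ {e}, e ∈ boundaryEdges n k → unitBond σ e = unitBond τ e := by
    intro e h5
    rw [hJ.unitBond_eq_iff]
    have h7 := hσ.satisfied_boundary hJ.ne_zero hn hk hE h5
    have h8 := hτ.satisfied_boundary hJ.ne_zero hn hk hE h5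
    tauto
  obtain ⟨u, hu⟩ := hJ.eq_in_box hk (b := -(n : ℤ)) (t := n) (by omega)
    (fun _ hA => hσ.flipStable hA) (fun _ hA => hτ.flipStable hA)
    (fun y h5 h6 => side (by rw [ver_mem_boundaryEdges]; omega))
    (fun y h5 h6 => side (by rw [ver_mem_boundaryEdges]; omega))
    (fun y h5 h6 => side (by rw [hor_mem_boundaryEdges]; omega))
    (fun y h5 h6 _ => side (by rw [hor_mem_boundaryEdges]; omega))
  refine ⟨u, fun x hx => ?_⟩
  rw [mem_sites] at hx
  exact hu x.1 x.2 hx.1.1 hx.1.2 hx.2.1 hx.2.2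

/-- A finite set lies in the open box for large `j`, and its stability involves only finitely many
spins, which are eventually those of the limit. -/
lemma isGroundState_of_limit {n k : ℕ → ℕ} (hn : ∀ j, j ≤ n j) (hk : ∀ j, j ≤ k j)
    {r : ℕ → State} (hr : ∀ j, IsCGroundState J (n j) (k j) (r j)) {σ : State}
    (hσ : ∀ x, ∀ᶠ j in Filter.atTop, r j x = σ x) : IsGroundState J σ := by
  refine isGroundState_of_flipStable fun A => ?_
  have h1 : ∀ᶠ j in Filter.atTop, ∀ e ∈ cutEdges A, r j e.src = σ e.src ∧ r j e.tgt = σ e.tgt :=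
    (Filter.eventually_all_finset _).mpr fun e _ => (hσ e.src).and (hσ e.tgt)
  have h2 : ∀ᶠ j in Filter.atTop, ∀ p ∈ A, p ∈ openBox (k j) (-(n j : ℤ)) (n j) := by
    refine (Filter.eventually_all_finset _).mpr fun p _ => ?_
    filter_upwards [Filter.eventually_gt_atTop (p.1.natAbs + p.2.natAbs)] with j hj
    have := hn j
    have := hk j
    rw [mem_openBox]
    omega
  obtain ⟨j, hj1, hj2⟩ := (h1.and h2).exists
  have := (hr j).flipStable (A := A) hj2
  unfold FlipStable at *
  rwa [Finset.sum_congr rfl fun e he => by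
    rw [show bond σ e = bond (r j) e by unfold bond; rw [(hj1 e he).1, (hj1 e he).2]]]

lemma convergesTo_of_unique (hJ : Generic J) {n k : ℕ → ℕ} (hn : ∀ j, j + 1 ≤ n j)
    (hk : ∀ j, j + 1 ≤ k j) (hE : ∀ j, EvenBoundary J (n j) (k j)) {r o : ℕ → State}
    (hr : ∀ j, IsCGroundState J (n j) (k j) (r j)) (ho : ∀ j, IsCGroundState J (n j) (k j) (o j))
    {σ : State} (hσ : ∀ x, ∀ᶠ j in Filter.atTop, r j x = σ x) : ConvergesTo o σ := by
  intro W
  have h1 : ∀ᶠ j in Filter.atTop, ∀ x ∈ W, r j x = σ x :=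
    (Filter.eventually_all_finset _).mpr fun x _ => hσ x
  have h2 : ∀ᶠ j in Filter.atTop, ∀ p ∈ W, p ∈ sites (n j) (k j) := by
    refine (Filter.eventually_all_finset _).mpr fun p _ => ?_
    filter_upwards [Filter.eventually_gt_atTop (p.1.natAbs + p.2.natAbs)] with j hj
    have := hn j
    have := hk j
    rw [mem_sites]
    omega
  filter_upwards [h1, h2] with j h3 h4
  obtain ⟨u, hu⟩ := IsCGroundState.unique hJ (by have := hn j; omega) (by have := hk j; omega)
    (hE j) (ho j) (hr j)
  rcases Int.units_eq_one_or u with rfl | rfl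
  · left
    intro x hx
    rw [hu x (h4 x hx), h3 x hx, one_mul]
  · right
    intro x hx
    rw [hu x (h4 x hx), h3 x hx, neg_one_mul]

/-- Injectivity at two indices and membership of one edge in the wall concern finitely many
plaquettes and spins, so they pass to the limit one at a time. -/
lemma finitelyIncongruent_of_limit {n k : ℕ → ℕ} (hn : ∀ j, j + 1 ≤ n j)
    {r s : ℕ → State} {f : ℕ → ℤ → Plaquette}
    (hinj : ∀ j (i i' : ℤ), |i| ≤ n j - 103 → |i'| ≤ n j - 103 → f j i = f j i' → i = i')
    (hf : ∀ j (i : ℤ), |i| ≤ n j - 104 →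
      ∃ e ∈ wall J (n j) (k j) (r j) (s j), dualEdge e = s(f j i, f j (i + 1)))
    {σ τ : State} {p : ℤ → Plaquette} (hσ : ∀ x, ∀ᶠ j in Filter.atTop, r j x = σ x)
    (hτ : ∀ x, ∀ᶠ j in Filter.atTop, s j x = τ x)
    (hp : ∀ i, ∀ᶠ j in Filter.atTop, f j i = p i) : FinitelyIncongruent J σ τ := by
  refine ⟨p, fun i i' hii => ?_, fun i => ?_⟩
  · obtain ⟨j, h1, h2, h3⟩ := ((hp i).and ((hp i').and
      (Filter.eventually_gt_atTop (i.natAbs + i'.natAbs + 103)))).exists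
    have := hn j
    exact hinj j i i' (by rw [Int.abs_eq_natAbs]; omega) (by rw [Int.abs_eq_natAbs]; omega) (by rw [h1, h2, hii])
  · have h1 : ∀ᶠ j in Filter.atTop, ∃ e ∈ wall J (n j) (k j) (r j) (s j),
        dualEdge e = s(p i, p (i + 1)) := by
      filter_upwards [hp i, hp (i + 1), Filter.eventually_gt_atTop (i.natAbs + 104)] with j h2 h3 h4
      have := hn j
      rw [← h2, ← h3]
      exact hf j i (by rw [Int.abs_eq_natAbs]; omega)
    obtain ⟨-, e, -, he⟩ := h1.exists
    refine ⟨e, ?_, he⟩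
    obtain ⟨j, ⟨e', he', hee⟩, h2, h3, h4, h5, h6⟩ := (h1.and ((hσ e.src).and ((hσ e.tgt).and
      ((hτ e.src).and ((hτ e.tgt).and
      (Filter.eventually_gt_atTop (e.src.2.natAbs + 2))))))).exists
    obtain rfl : e' = e := dualEdge_injective (hee.trans he.symm)
    have hnj := hn j
    have hb : Between (-((n j : ℤ) - 1)) ((n j : ℤ) - 1) e' := by
      cases e' <;> simp only [Edge.src, Between] at * <;> omega
    have h7 := ((mem_wall_iff_of_between le_rfl le_rfl hb).mp he').2
    rw [Set.mem_ofPred_eq, xor_iff_not_iff]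
    unfold Satisfied bond at *
    rwa [h2, h3, h4, h5] at h7

lemma sites_mono {n k n' k' : ℕ} (hn : n ≤ n') (hk : k ≤ k') : sites n k ⊆ sites n' k' := by
  intro p hp
  rw [mem_sites] at *
  omega

/-- For generic couplings for which the events `R` and `A` occur together in arbitrarily large
sublattices, there is a sequence of sublattices with finitely incongruent limits. -/
theorem exists_incongruent_limits (hJ : Generic J)
    (h : ∀ K : ℕ, ∃ n k : ℕ, K ≤ k ∧ k ≤ n ∧ J ∈ eventR n k ∧ J ∈ eventA n k) :
    ∃ n k : ℕ → ℕ, (∀ i, 0 < n i ∧ 0 < k i) ∧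
      (∀ i, sites (n i) (k i) ⊆ sites (n (i + 1)) (k (i + 1))) ∧
      (∀ x : Site, ∃ i, x ∈ sites (n i) (k i)) ∧
      ∀ o e : ℕ → State,
        (∀ j, IsCGroundState J (n (2 * j)) (k (2 * j)) (o j)) →
        (∀ j, IsCGroundState J (n (2 * j + 1)) (k (2 * j + 1)) (e j)) →
        ∃ oLim eLim : State, ConvergesTo o oLim ∧ ConvergesTo e eLim ∧
          FinitelyIncongruent J oLim eLim ∧ IsGroundState J oLim ∧ IsGroundState J eLim := by
  choose N K hK hKN hRN hAN using h
  -- The next half-width is required to exceed the last height. As k ≤ n, this nests the sublattices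
  -- along every subsequence.
  set t : ℕ → ℕ := fun j => Nat.rec 3 (fun _ x => N x + 1) j with ht
  have ht1 : ∀ j, t (j + 1) = N (t j) + 1 := fun j => rfl
  have htj : ∀ j, j + 3 ≤ t j := by
    intro j
    induction j with
    | zero => exact le_rfl
    | succ j ih =>
      rw [ht1]
      have := hK (t j)
      have := hKN (t j)
      omega
  have htmono : StrictMono t := strictMono_nat_of_lt_succ fun j => by
    rw [ht1]
    have := hK (t j)
    have := hKN (t j)
    omega
  have hreg : ∀ j, IsRegularAt J (N (t j)) (K (t j)) := fun j => by
    have := htj j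
    have := hK (t j)
    have := hKN (t j)
    exact .of_eventR (by omega) (by omega) le_rfl (hRN (t j))
  have hA : ∀ j, _ := fun j => (hreg j).mem_eventA_iff.mp (hAN (t j))
  choose r s hr hs hpath using hA
  choose f hf1 hf2 hf3 using fun j => exists_centred_parametrization (hpath j)
  -- Three successive extractions: for the inner states, the outer states and the paths between
  -- them.
  obtain ⟨φ₁, hφ₁, σ, hσ⟩ := exists_subseq_eventually_eq r (fun _ => Set.univ)
    (fun _ => Set.toFinite _) (fun _ _ => Set.mem_univ _)
  obtain ⟨φ₂, hφ₂, τ, hτ⟩ := exists_subseq_eventually_eq (fun j => s (φ₁ j)) (fun _ => Set.univ)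
    (fun _ => Set.toFinite _) (fun _ _ => Set.mem_univ _)
  obtain ⟨φ₃, hφ₃, p, hp⟩ := exists_subseq_eventually_eq (fun j => f (φ₁ (φ₂ j))) _
    (fun i => Set.Finite.prod (Set.finite_Icc _ _) (Set.finite_Icc _ _)) (fun j i => hf1 _ i)
  set φ : ℕ → ℕ := fun j => φ₁ (φ₂ (φ₃ j)) with hφ
  have hφm : StrictMono φ := hφ₁.comp (hφ₂.comp hφ₃)
  have hσ' : ∀ x, ∀ᶠ j in Filter.atTop, r (φ j) x = σ x := fun x =>
    ((hφ₂.comp hφ₃).tendsto_atTop).eventually (hσ x)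
  have hτ' : ∀ x, ∀ᶠ j in Filter.atTop, s (φ j) x = τ x := fun x =>
    (hφ₃.tendsto_atTop).eventually (hτ x)
  have big : ∀ j, j + 3 ≤ K (t (φ j)) ∧ K (t (φ j)) ≤ N (t (φ j)) := fun j => by
    have h1 := hφm.id_le j
    have h2 := htj (φ j)
    have h3 := hK (t (φ j))
    have h4 := hKN (t (φ j))
    simp only [id] at h1
    omega
  have grow : ∀ j, N (t (φ j)) + 1 ≤ K (t (φ (j + 1))) := fun j => by
    have h1 : φ j + 1 ≤ φ (j + 1) := hφm (Nat.lt_succ_self j)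
    have h2 := htmono.monotone h1
    rw [ht1] at h2
    exact h2.trans (hK _)
  -- Even indices get height n - 1 and odd ones height n, with the same half-width, so that
  -- consecutive terms form the regular pairs.
  refine ⟨fun i => N (t (φ (i / 2))) - (1 - i % 2), fun i => K (t (φ (i / 2))), ?_, ?_, ?_, ?_⟩
  · intro i
    have := big (i / 2)
    simp only
    omega
  · intro i
    have h1 := big (i / 2)
    have h2 := grow (i / 2)
    have h3 := big (i / 2 + 1)
    simp only
    rcases Nat.mod_two_eq_zero_or_one i with hi | hi
    · rw [show (i + 1) / 2 = i / 2 by omega]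
      exact sites_mono (by omega) le_rfl
    · rw [show (i + 1) / 2 = i / 2 + 1 by omega]
      exact sites_mono (by omega) (by omega)
  · intro x
    refine ⟨2 * (x.1.natAbs + x.2.natAbs), ?_⟩
    rw [mem_sites]
    beta_reduce
    rw [show 2 * (x.1.natAbs + x.2.natAbs) / 2 = x.1.natAbs + x.2.natAbs by omega]
    have := big (x.1.natAbs + x.2.natAbs)
    omega
  · intro o e ho he
    have ho' : ∀ j, IsCGroundState J (N (t (φ j)) - 1) (K (t (φ j))) (o j) := fun j => by
      have := ho j
      beta_reduce at this
      rwa [show 2 * j / 2 = j by omega, show 2 * j % 2 = 0 by omega] at this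
    have he' : ∀ j, IsCGroundState J (N (t (φ j))) (K (t (φ j))) (e j) := fun j => by
      have := he j
      beta_reduce at this
      rwa [show (2 * j + 1) / 2 = j by omega, show (2 * j + 1) % 2 = 1 by omega] at this
    refine ⟨σ, τ, ?_, ?_, ?_, ?_, ?_⟩
    · exact convergesTo_of_unique hJ (fun j => by have := big j; omega)
        (fun j => by have := big j; omega) (fun j => (hreg (φ j)).even_pred)
        (fun j => hr (φ j)) ho' hσ'
    · exact convergesTo_of_unique hJ (fun j => by have := big j; omega)
        (fun j => by have := big j; omega) (fun j => (hreg (φ j)).even)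
        (fun j => hs (φ j)) he' hτ'
    · exact finitelyIncongruent_of_limit (n := fun j => N (t (φ j)))
        (fun j => by have := big j; omega) (fun j => hf2 (φ j))
        (fun j => hf3 (φ j)) hσ' hτ' hp
    · exact isGroundState_of_limit (n := fun j => N (t (φ j)) - 1)
        (fun j => by have := big j; omega) (k := fun j => K (t (φ j)))
        (fun j => by have := big j; omega) (fun j => hr (φ j)) hσ'
    · exact isGroundState_of_limit (n := fun j => N (t (φ j)))
        (fun j => by have := big j; omega) (k := fun j => K (t (φ j)))
        (fun j => by have := big j; omega) (fun j => hs (φ j)) hτ'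

end EASpinGlass
end

/-! ### The product law: independence, genericity, measurability -/

noncomputable section
namespace EASpinGlass
open MeasureTheory ProbabilityTheory

/-! ### The law of the coupling constants -/

instance (v : ℝ≥0) : IsProbabilityMeasure (couplingLaw v) := by
  unfold couplingLaw
  infer_instance

instance : Countable Edge := by
  refine Function.Injective.countable (β := Bool × ℤ × ℤ)
    (f := fun e => match e with | .hor x y => (true, x, y) | .ver x y => (false, x, y)) ?_
  intro e f h
  cases e <;> cases f <;> simp_all

lemma measurable_coupling (e : Edge) : Measurable fun J : Couplings => J e := measurable_pi_apply e

/-- Events that depend on disjoint finite sets of edges are independent. -/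
lemma couplingLaw_inter (v : ℝ≥0) {A B : Set Couplings} (hA : MeasurableSet A)
    (hB : MeasurableSet B) {S T : Finset Edge} (dA : DependsOn (· ∈ A) (S : Set Edge))
    (dB : DependsOn (· ∈ B) (T : Set Edge)) (hST : Disjoint S T) :
    (couplingLaw v).real (A ∩ B) = (couplingLaw v).real A * (couplingLaw v).real B := by
  have hind : iIndepFun (fun (e : Edge) (J : Couplings) => J e) (couplingLaw v) :=
    iIndepFun_infinitePi (P := fun _ : Edge => gaussianReal 0 v) (X := fun _ x => x)
      fun _ => measurable_id
  have h := hind.indepFun_finset S T hST measurable_coupling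
  have key : ∀ {A : Set Couplings} {S : Finset Edge}, MeasurableSet A →
      DependsOn (· ∈ A) (S : Set Edge) → ∃ A' : Set (S → ℝ), MeasurableSet A' ∧
        A = (fun (J : Couplings) (e : S) => J e) ⁻¹' A' := by
    intro A S hA dA
    refine ⟨(fun f e => if he : e ∈ S then f ⟨e, he⟩ else 0) ⁻¹' A, ?_, ?_⟩
    · refine measurableSet_preimage (measurable_pi_iff.mpr fun e => ?_) hA
      by_cases he : e ∈ S
      · simpa [he] using measurable_pi_apply _
      · simp [he]
    · ext J
      exact iff_of_eq (dA fun e he => by simp [Finset.mem_coe.mp he])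
  obtain ⟨A', hA', rfl⟩ := key hA dA
  obtain ⟨B', hB', rfl⟩ := key hB dB
  rw [measureReal_def, h.measure_inter_preimage_eq_mul _ _ hA' hB', ENNReal.toReal_mul]
  rfl

/-- Relabelling the edges preserves the law of the coupling constants. -/
lemma measurePreserving_relabel (v : ℝ≥0) (T : Edge ≃ Edge) :
    MeasurePreserving (fun (J : Couplings) e => J (T e)) (couplingLaw v) (couplingLaw v) := by
  have hm : Measurable fun (J : Couplings) e => J (T e) :=
    measurable_pi_iff.mpr fun e => measurable_coupling _
  refine ⟨hm, ?_⟩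
  refine Measure.eq_infinitePi _ fun s t ht => ?_
  rw [Measure.map_apply hm (MeasurableSet.pi s.countable_toSet fun e _ => ht e)]
  have : (fun (J : Couplings) e => J (T e)) ⁻¹' (s : Set Edge).pi t
      = ((s.map T.toEmbedding : Finset Edge) : Set Edge).pi fun e => t (T.symm e) := by
    ext J
    simp only [Set.mem_preimage, Set.mem_pi, Finset.mem_coe, Finset.mem_map_equiv]
    refine ⟨fun h e he => by simpa using h _ he, fun h e he => ?_⟩
    simpa using h (T e) (by simpa using he)
  rw [this]
  unfold couplingLaw
  rw [Measure.infinitePi_pi _ fun e _ => ht _, Finset.prod_map]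
  simp

lemma couplingLaw_pi (v : ℝ≥0) (s : Finset Edge) {t : Edge → Set ℝ}
    (ht : ∀ e, MeasurableSet (t e)) :
    (couplingLaw v).real {J | ∀ e ∈ s, J e ∈ t e} = ∏ e ∈ s, (gaussianReal 0 v).real (t e) := by
  have h : {J : Couplings | ∀ e ∈ s, J e ∈ t e} = (s : Set Edge).pi t := by
    ext J
    simp [Set.mem_pi]
  rw [h, measureReal_def, couplingLaw, Measure.infinitePi_pi _ fun e _ => ht e, ENNReal.toReal_prod]
  rfl

lemma map_signed_sum (v : ℝ≥0) (ε : Edge → ℤˣ) (F : Finset Edge) :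
    (couplingLaw v).map (∑ e ∈ F, fun J : Couplings => J e * ((ε e : ℤ) : ℝ))
      = gaussianReal 0 (F.card * v) := by
  have hind : iIndepFun (fun (e : Edge) (J : Couplings) => J e * ((ε e : ℤ) : ℝ)) (couplingLaw v) :=
    iIndepFun_infinitePi (P := fun _ : Edge => gaussianReal 0 v)
      (X := fun e x => x * ((ε e : ℤ) : ℝ)) fun _ => measurable_id.mul_const _
  have hm : ∀ e, Measurable fun J : Couplings => J e * ((ε e : ℤ) : ℝ) :=
    fun e => (measurable_coupling e).mul_const _
  induction F using Finset.induction_on with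
  | empty =>
    simp only [Finset.sum_empty, Finset.card_empty, Nat.cast_zero, zero_mul, gaussianReal_zero_var]
    change (couplingLaw v).map (fun _ => 0) = _
    rw [Measure.map_const]
    simp
  | insert e F he ih =>
    rw [Finset.sum_insert he, add_comm, Finset.card_insert_of_notMem he]
    have h1 : (couplingLaw v).map (fun J : Couplings => J e * ((ε e : ℤ) : ℝ))
        = gaussianReal 0 v := by
      have h2 : (fun J : Couplings => J e * ((ε e : ℤ) : ℝ))
          = (fun x : ℝ => x * ((ε e : ℤ) : ℝ)) ∘ fun J : Couplings => J e := rfl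
      rw [h2, ← Measure.map_map (by fun_prop) (measurable_coupling e), couplingLaw,
        Measure.infinitePi_map_eval, gaussianReal_map_mul_const]
      rcases Int.units_eq_one_or (ε e) with h | h <;> simp [h]
    rw [gaussianReal_add_gaussianReal_of_indepFun (hind.indepFun_finsetSum_of_notMem hm he) ih h1]
    congr 1
    · simp
    · push_cast; ring

/-- A nonempty signed sum is Gaussian with positive variance, hence has no atom at zero. Coding the
signs on `F` by a finite set `P` of positive ones leaves countably many cases. -/
theorem ae_generic {v : ℝ≥0} (hv : v ≠ 0) : ∀ᵐ J ∂(couplingLaw v), Generic J := by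
  have key : ∀ (F P : Finset Edge), F.Nonempty → ∀ᵐ J ∂(couplingLaw v),
      ∑ e ∈ F, J e * (((if e ∈ P then 1 else -1 : ℤˣ) : ℤ) : ℝ) ≠ 0 := by
    intro F P hF
    set ε : Edge → ℤˣ := fun e => if e ∈ P then 1 else -1
    have h1 := map_signed_sum v ε F
    have hv' : (F.card : ℝ≥0) * v ≠ 0 := by
      simp [hv, hF.ne_empty]
    have := nullSingletonClass_gaussianReal (μ := 0) hv'
    have h2 : (couplingLaw v).map (∑ e ∈ F, fun J : Couplings => J e * ((ε e : ℤ) : ℝ)) {0} = 0 := by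
      rw [h1]
      exact measure_singleton _
    have hm : Measurable (∑ e ∈ F, fun J : Couplings => J e * ((ε e : ℤ) : ℝ)) := by
      have h3 : Measurable fun J : Couplings => ∑ e ∈ F, J e * ((ε e : ℤ) : ℝ) :=
        Finset.measurable_sum _ fun e _ => (measurable_coupling e).mul_const _
      convert! h3 using 1
      funext J
      rw [Finset.sum_apply]
    rw [Measure.map_apply hm (measurableSet_singleton _)] at h2
    rw [ae_iff]
    convert! h2 using 2
    ext J
    simp [ε]
  have hall : ∀ᵐ J ∂(couplingLaw v), ∀ (F P : Finset Edge), F.Nonempty →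
      ∑ e ∈ F, J e * (((if e ∈ P then 1 else -1 : ℤˣ) : ℤ) : ℝ) ≠ 0 :=
    ae_all_iff.mpr fun F => ae_all_iff.mpr fun P => ae_all_iff.mpr fun hF => key F P hF
  filter_upwards [hall] with J hJ F hF ε
  have := hJ F (F.filter fun e => ε e = 1) hF
  convert this using 1
  refine Finset.sum_congr rfl fun e he => ?_
  rcases Int.units_eq_one_or (ε e) with h | h <;> simp [h, he]

/-! ### Measurability -/

/-- Such a set is a finite union of atoms of the algebra generated by the `S i`. Events defined
through states and paths become measurable without unfolding their quantifiers. -/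
lemma measurableSet_of_finite_data {Ω ι : Type*} [MeasurableSpace Ω] [Finite ι] {S : ι → Set Ω}
    (hS : ∀ i, MeasurableSet (S i)) {E : Set Ω}
    (hE : ∀ x y, (∀ i, x ∈ S i ↔ y ∈ S i) → x ∈ E → y ∈ E) : MeasurableSet E := by
  set f : Ω → ι → Prop := fun x i => x ∈ S i with hf
  have hfm : Measurable f := measurable_pi_iff.mpr fun i => measurableSet_setOfPred.mp (hS i)
  have : E = f ⁻¹' (f '' E) := by
    ext x
    refine ⟨fun h => ⟨x, h, rfl⟩, ?_⟩
    rintro ⟨y, hy, hyx⟩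
    exact hE y x (fun i => iff_of_eq (congrFun hyx i)) hy
  rw [this]
  exact hfm (Set.toFinite _).measurableSet

lemma measurable_odd_negative (F : Finset Edge) :
    Measurable fun J : Couplings => Odd (F.filter fun e => J e < 0).card := by
  refine measurableSet_setOfPred.mp ?_
  refine measurableSet_of_finite_data (ι := F) (S := fun e => {J : Couplings | J e.1 < 0})
    (fun e => measurableSet_lt (measurable_coupling e.1) measurable_const) fun J J' h hJ => ?_
  have : F.filter (fun e => J' e < 0) = F.filter fun e => J e < 0 :=
    Finset.filter_congr fun e he => (h ⟨e, he⟩).symm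
  simpa [this] using hJ

lemma measurable_frustrated (p : Plaquette) : Measurable fun J => Frustrated J p :=
  measurable_odd_negative _

lemma measurable_evenBoundary (n k : ℕ) : Measurable fun J => EvenBoundary J n k := by
  simpa only [EvenBoundary, ← Nat.not_odd_iff_even] using (measurable_odd_negative _).not

lemma measurable_sum_abs_lt (F : Finset Edge) (e : Edge) :
    Measurable fun J : Couplings => ∑ e' ∈ F, |J e'| < |J e| := by
  refine measurableSet_setOfPred.mp (measurableSet_lt ?_ ?_)
  · exact Finset.measurable_sum _ fun e _ => (measurable_coupling e).abs
  · exact (measurable_coupling e).abs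

lemma measurable_isBarrier (h : ℤ) (k : ℕ) : Measurable fun J => IsBarrier J h k :=
  Measurable.forall fun _ => measurable_const.imp
    (measurable_const.imp (measurable_sum_abs_lt _ _))

lemma measurable_isIsolation (k : ℕ) (y : ℤ) : Measurable fun J => IsIsolation J k y := by
  refine Measurable.and ?_ ?_
  · exact Measurable.forall fun _ => measurable_const.imp
      ((measurable_frustrated _).iff measurable_const)
  · exact Measurable.forall fun _ => measurable_const.imp (Measurable.forall fun _ =>
      measurable_const.imp (measurable_const.imp (measurable_sum_abs_lt _ _)))

lemma measurableSet_eventR (n k : ℕ) : MeasurableSet (eventR n k) := by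
  refine measurableSet_setOfPred.mpr (Measurable.and (Measurable.and measurable_const (Measurable.and ?_
    (Measurable.and ?_ ?_))) ((measurable_isIsolation _ _).and (measurable_isIsolation _ _)))
  · exact Measurable.forall fun _ => measurable_const.imp (measurable_const.imp
      ((measurable_evenBoundary _ _).and (measurable_evenBoundary _ _)))
  · exact Measurable.forall fun _ => measurable_const.imp
      ((measurable_frustrated _).iff measurable_const)
  · exact Measurable.forall fun _ => measurable_const.imp
      ((measurable_frustrated _).iff measurable_const)

lemma measurableSet_eventR' (n k : ℕ) : MeasurableSet (eventR' n k) := by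
  refine (measurableSet_eventR n k).inter (measurableSet_setOfPred.mpr ?_)
  exact Measurable.forall fun _ => measurable_const.imp (measurable_const.imp
    (measurableSet_setOfPred.mp (measurableSet_eventR _ k).compl))

lemma satisfied_congr_couplings {J J' : Couplings} {e : Edge} (h : J e < 0 ↔ J' e < 0)
    (h' : 0 < J e ↔ 0 < J' e) (σ : State) : Satisfied J σ e ↔ Satisfied J' σ e := by
  unfold Satisfied
  rcases bond_cases σ e with hb | hb <;> simp [hb, h, h']

/-- Only satisfaction of edges and the order of the energies of finitely many clipped states matter
for being a c-groundstate. -/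
lemma IsCGroundState.congr_couplings {J J' : Couplings} {n k : ℕ}
    (hs : ∀ e ∈ edges n k, ∀ σ, Satisfied J σ e ↔ Satisfied J' σ e)
    (he : ∀ σ ∈ Set.range (clip n k), ∀ τ ∈ Set.range (clip n k),
      energyOn (edges n k) J σ ≤ energyOn (edges n k) J τ ↔
      energyOn (edges n k) J' σ ≤ energyOn (edges n k) J' τ)
    {σ : State} (hσ : IsCGroundState J n k σ) : IsCGroundState J' n k σ := by
  classical
  have hb : ∀ τ, boundarySatisfied J' n k τ = boundarySatisfied J n k τ := by
    intro τ
    unfold boundarySatisfied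
    congr 1
    exact Finset.filter_congr fun e h => (hs e (boundaryEdges_subset_edges n k h) τ).symm
  refine ⟨fun τ => by rw [hb, hb]; exact hσ.1 τ, fun τ hτ => ?_⟩
  have hc : ∀ J τ, energyOn (edges n k) J τ = energyOn (edges n k) J (clip n k τ) := fun J τ =>
    energyOn_congr fun x hx => (clip_apply hx).symm
  have := hσ.2 τ hτ
  rw [hc J, hc J τ, he _ ⟨_, rfl⟩ _ ⟨_, rfl⟩] at this
  rwa [hc J', hc J' τ]

lemma edges_mono {n n' k k' : ℕ} (hn : n ≤ n') (hk : k ≤ k') : edges n k ⊆ edges n' k' := by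
  intro e he
  cases e with
  | hor x y => rw [hor_mem_edges] at *; omega
  | ver x y => rw [ver_mem_edges] at *; omega

lemma plaquetteEdges_subset_edges {n k : ℕ} {p : Plaquette} (h1 : -(k : ℤ) ≤ p.1) (h2 : p.1 < k)
    (h3 : -(n : ℤ) ≤ p.2) (h4 : p.2 < n) : plaquetteEdges p ⊆ edges n k := by
  obtain ⟨x, y⟩ := p
  intro e he
  simp only [plaquetteEdges, Finset.mem_insert, Finset.mem_singleton] at he h1 h2 h3 h4
  rcases he with rfl | rfl | rfl | rfl
  · rw [hor_mem_edges]; omega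
  · rw [hor_mem_edges]; omega
  · rw [ver_mem_edges]; omega
  · rw [ver_mem_edges]; omega

lemma frustrated_congr {J J' : Couplings} {p : Plaquette}
    (h : ∀ e ∈ plaquetteEdges p, (J e < 0 ↔ J' e < 0)) : Frustrated J p ↔ Frustrated J' p := by
  unfold Frustrated
  rw [Finset.filter_congr h]

/-- The event is decided by the signs of the couplings and by finitely many comparisons of energies
in the two sublattices. -/
lemma measurableSet_eventA (n k : ℕ) : MeasurableSet (eventA n k) := by
  have hen : ∀ F (σ : State), Measurable fun J => energyOn F J σ := fun F σ =>
    (Finset.measurable_sum _ fun e _ => (measurable_coupling e).mul_const _).neg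
  have f1 : Finite (Set.range (clip n k)) := finite_range_clip n k
  have f2 : Finite (Set.range (clip (n - 1) k)) := finite_range_clip (n - 1) k
  refine measurableSet_of_finite_data
    (ι := (edges n k ⊕ edges n k) ⊕ (Set.range (clip n k) × Set.range (clip n k)) ⊕
      (Set.range (clip (n - 1) k) × Set.range (clip (n - 1) k)))
    (S := Sum.elim (Sum.elim (fun e => {J | J e < 0}) (fun e => {J | 0 < J e}))
      (Sum.elim (fun q => {J | energyOn (edges n k) J q.1 ≤ energyOn (edges n k) J q.2})
        (fun q => {J | energyOn (edges (n - 1) k) J q.1 ≤ energyOn (edges (n - 1) k) J q.2}))) ?_ ?_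
  · rintro ((e | e) | (q | q))
    · exact measurableSet_lt (measurable_coupling _) measurable_const
    · exact measurableSet_lt measurable_const (measurable_coupling _)
    · exact measurableSet_le (hen _ _) (hen _ _)
    · exact measurableSet_le (hen _ _) (hen _ _)
  · intro J J' h hJ
    have hneg : ∀ e ∈ edges n k, (J e < 0 ↔ J' e < 0) := fun e he => h (.inl (.inl ⟨e, he⟩))
    have hpos : ∀ e ∈ edges n k, (0 < J e ↔ 0 < J' e) := fun e he => h (.inl (.inr ⟨e, he⟩))
    have hsat : ∀ e ∈ edges n k, ∀ σ, Satisfied J σ e ↔ Satisfied J' σ e := fun e he =>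
      satisfied_congr_couplings (hneg e he) (hpos e he)
    have hsub : edges (n - 1) k ⊆ edges n k := edges_mono (Nat.sub_le n 1) le_rfl
    have hdis : ∀ {m}, edges m k ⊆ edges n k → ∀ σ, disDual J m k σ = disDual J' m k σ := by
      intro m hm σ
      unfold disDual
      congr 1
      ext e
      simp only [Set.mem_ofPred_eq]
      refine and_congr_right fun he => and_congr_right fun _ => not_congr (hsat e (hm he) σ)
    have hfr : ∀ p : Plaquette, -(k : ℤ) ≤ p.1 → p.1 < k → -(n : ℤ) ≤ p.2 → p.2 < n →
        Frustrated J p → Frustrated J' p := fun p h1 h2 h3 h4 =>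
      (frustrated_congr fun e he => hneg e (plaquetteEdges_subset_edges h1 h2 h3 h4 he)).mp
    obtain ⟨r, s, hr, hs, p, hp, q, hq, hFp, hFq, P, hP⟩ := hJ
    have hPO : PathNearOrigin _ p q := ⟨P, hP⟩
    rw [hdis hsub, hdis subset_rfl] at hPO
    refine ⟨r, s, hr.congr_couplings (fun e he => hsat e (hsub he))
        (fun σ hσ τ hτ => h (.inr (.inr (⟨σ, hσ⟩, ⟨τ, hτ⟩)))),
      hs.congr_couplings hsat (fun σ hσ τ hτ => h (.inr (.inl (⟨σ, hσ⟩, ⟨τ, hτ⟩)))),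
      p, hp, q, hq, hfr p ?_ ?_ ?_ ?_ hFp, hfr q ?_ ?_ ?_ ?_ hFq, hPO⟩ <;>
    · simp only [upperPart, lowerPart, Finset.mem_product, Finset.mem_Ico] at hp hq
      omega

end EASpinGlass
end

/-! ### Almost surely R(n,k) holds at some large height -/

noncomputable section
namespace EASpinGlass
open MeasureTheory ProbabilityTheory

/-! ### The events `R(n,k)` occur -/

lemma dependsOn_of_imp {A : Set Couplings} {S : Set Edge}
    (h : ∀ J J' : Couplings, (∀ e ∈ S, J e = J' e) → J ∈ A → J' ∈ A) : DependsOn (· ∈ A) S :=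
  fun J J' hJ => propext ⟨h J J' hJ, h J' J fun e he => (hJ e he).symm⟩

lemma sgn_congr {J J' : Couplings} {e : Edge} (h : J e = J' e) : sgn J e = sgn J' e := by
  unfold sgn
  rw [h]

/-- One row beyond C(n,k) is needed, because isolation weighs the vertical edges that leave the
outermost rows. -/
lemma dependsOn_eventR {n k : ℕ} (hn : 1 ≤ n) (hk : 1 ≤ k) :
    DependsOn (· ∈ eventR n k) (edges (n + 1) k : Set Edge) := by
  refine dependsOn_of_imp fun J J' h => ?_
  have hE : ∀ n' k', n' ≤ n → k' ≤ k → EvenBoundary J n' k' → EvenBoundary J' n' k' := by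
    intro n' k' hn' hk' hE
    rw [evenBoundary_iff] at *
    rw [← hE]
    refine Finset.prod_congr rfl fun e he => (sgn_congr (h e ?_)).symm
    exact edges_mono (by omega) hk' (boundaryEdges_subset_edges _ _ he)
  have hF : ∀ x y : ℤ, -(k : ℤ) ≤ x → x < k → -(n : ℤ) ≤ y → y < n →
      (Frustrated J (x, y) ↔ Frustrated J' (x, y)) := fun x y h1 h2 h3 h4 =>
    frustrated_congr fun e he => by
      rw [h e (edges_mono (Nat.le_succ n) le_rfl (plaquetteEdges_subset_edges h1 h2 h3 h4 he))]
  have hI : ∀ y : ℤ, -(n : ℤ) ≤ y → y < n → IsIsolation J k y → IsIsolation J' k y := by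
    rintro y h1 h2 ⟨h3, h4⟩
    refine ⟨fun x hx => ?_, fun x hx e he hne => ?_⟩
    · rw [← h3 x hx]
      rw [Finset.mem_Ico] at hx
      exact (hF x y hx.1 hx.2 h1 h2).symm
    · have h5 := h4 x hx e he hne
      rw [Finset.mem_Ico] at hx
      have heJ : J e = J' e := by
        refine h e ?_
        simp only [Finset.mem_insert, Finset.mem_singleton] at he
        rcases he with rfl | rfl <;> rw [Finset.mem_coe, hor_mem_edges] <;> push_cast <;> omega
      rw [← heJ]
      refine lt_of_eq_of_lt (Finset.sum_congr rfl fun e' he' => ?_) h5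
      rw [h e' ?_]
      rw [Finset.mem_union] at he'
      rcases he' with he' | he'
      · exact edges_mono (Nat.le_succ n) le_rfl
          (plaquetteEdges_subset_edges (by simp) (by simp; omega) h1 h2 he')
      · obtain ⟨p, hp, rfl⟩ := Finset.mem_image.mp he'
        simp only [Finset.mem_product, Finset.mem_Icc] at hp
        rw [Finset.mem_coe, ver_mem_edges]
        push_cast
        omega
  rintro ⟨⟨h1, h2, h3, h4⟩, h5, h6⟩
  refine ⟨⟨h1, fun k' hk1 hk2 => ⟨hE _ _ le_rfl hk2 (h2 k' hk1 hk2).1,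
    hE _ _ (Nat.sub_le n 1) hk2 (h2 k' hk1 hk2).2⟩, fun p hp => ?_, fun p hp => ?_⟩,
    hI _ (by omega) (by omega) h5, hI _ (by omega) (by omega) h6⟩
  · rw [← h3 p hp]
    simp only [upperPart, Finset.mem_product, Finset.mem_Ico] at hp
    exact (hF p.1 p.2 (by omega) (by omega) (by omega) (by omega)).symm
  · rw [← h4 p hp]
    simp only [lowerPart, Finset.mem_product, Finset.mem_Ico] at hp
    exact (hF p.1 p.2 (by omega) (by omega) (by omega) (by omega)).symm

/-- The edges whose couplings decide about `R(m+3,k)`, given the parities of `columnParity`. -/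
def patternEdges (k m : ℕ) : Finset Edge :=
  (Finset.Ico (-(k : ℤ)) k ×ˢ {(m : ℤ) + 2, (m : ℤ) + 3, -(m : ℤ) - 2, -(m : ℤ) - 3}).image
    (fun p => Edge.hor p.1 p.2) ∪
  (Finset.Icc (-(k : ℤ)) k ×ˢ (Finset.Icc (m : ℤ) (m + 3) ∪ Finset.Icc (-(m : ℤ) - 4) (-m - 1))).image
    (fun p => Edge.ver p.1 p.2)

lemma hor_mem_patternEdges {k m : ℕ} {x y : ℤ} : Edge.hor x y ∈ patternEdges k m ↔
    (-(k : ℤ) ≤ x ∧ x < k) ∧ (y = m + 2 ∨ y = m + 3 ∨ y = -m - 2 ∨ y = -m - 3) := by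
  simp [patternEdges]

lemma ver_mem_patternEdges {k m : ℕ} {x y : ℤ} : Edge.ver x y ∈ patternEdges k m ↔
    (-(k : ℤ) ≤ x ∧ x ≤ k) ∧ ((m ≤ y ∧ y ≤ m + 3) ∨ (-(m : ℤ) - 4 ≤ y ∧ y ≤ -m - 1)) := by
  simp [patternEdges]
  tauto

lemma card_patternEdges_le (k m : ℕ) : (patternEdges k m).card ≤ 24 * k + 8 := by
  refine (Finset.card_union_le _ _).trans ?_
  have h1 : ({(m : ℤ) + 2, (m : ℤ) + 3, -(m : ℤ) - 2, -(m : ℤ) - 3} : Finset ℤ).card ≤ 4 :=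
    Finset.card_le_four
  have h2 := Finset.card_union_le (Finset.Icc (m : ℤ) (m + 3)) (Finset.Icc (-(m : ℤ) - 4) (-m - 1))
  have h3 : (Finset.Icc (m : ℤ) (m + 3)).card = 4 := by rw [Int.card_Icc]; omega
  have h4 : (Finset.Icc (-(m : ℤ) - 4) (-m - 1)).card = 4 := by rw [Int.card_Icc]; omega
  refine (add_le_add Finset.card_image_le Finset.card_image_le).trans ?_
  rw [Finset.card_product, Finset.card_product]
  have h5 : (Finset.Ico (-(k : ℤ)) k).card = 2 * k := by rw [Int.card_Ico]; omega
  have h6 : (Finset.Icc (-(k : ℤ)) k).card = 2 * k + 1 := by rw [Int.card_Icc]; omega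
  rw [h5, h6]
  rw [h3, h4] at h2
  nlinarith

/-- An upper bound for the light couplings of the pattern. -/
def lightBound (k : ℕ) : ℝ := 1 / (6 * k + 9)

lemma lightBound_pos (k : ℕ) : 0 < lightBound k := by unfold lightBound; positivity

/-- The ranges prescribed for the couplings of the edges in `patternEdges k m`: horizontal edges
off the middle column are heavy, the other edges are light, and the signs are such that precisely
the middle plaquettes of the outer rows are frustrated; the edges `ver k' m` with `k' ∈ w` are used
to correct the parities of the boundaries. -/
def patternSet (k m : ℕ) (w : Finset ℕ) : Edge → Set ℝ
  | .hor x y =>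
    if x = 0 then
      if y = m + 3 ∨ y = -m - 3 then Set.Ioo (-lightBound k) 0 else Set.Ioo 0 (lightBound k)
    else Set.Ioi 1
  | .ver x y =>
    if y = m ∧ 1 ≤ x ∧ x.toNat ∈ w then Set.Ioo (-lightBound k) 0 else Set.Ioo 0 (lightBound k)

lemma measurableSet_patternSet (k m : ℕ) (w : Finset ℕ) (e : Edge) :
    MeasurableSet (patternSet k m w e) := by
  cases e <;> simp only [patternSet] <;> split_ifs <;> measurability

/-- The half-widths for which the product of the signs of the vertical edges of the columns `±k'`
between the heights `-m` and `m` is negative. -/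
def columnParity (J : Couplings) (k m : ℕ) : Finset ℕ :=
  (Finset.Icc 1 k).filter fun k' =>
    ∏ y ∈ Finset.Ico (-(m : ℤ)) m, (sgn J (.ver k' y) * sgn J (.ver (-k') y)) = -1

lemma sgn_of_neg {J : Couplings} {e : Edge} (h : J e < 0) : sgn J e = -1 := if_pos h

lemma sgn_of_pos {J : Couplings} {e : Edge} (h : 0 < J e) : sgn J e = 1 := if_neg (not_lt.mpr h.le)

section Pattern

variable {J : Couplings} {k m : ℕ} {w : Finset ℕ} (hk : 1 ≤ k)
  (hJ : ∀ e ∈ patternEdges k m, J e ∈ patternSet k m w e)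

include hJ

lemma pattern_hor {x y : ℤ} (h1 : -(k : ℤ) ≤ x) (h2 : x < k)
    (hy : y = m + 2 ∨ y = m + 3 ∨ y = -m - 2 ∨ y = -m - 3) :
    sgn J (.hor x y) = (if x = 0 ∧ (y = m + 3 ∨ y = -m - 3) then -1 else 1) ∧
    (x = 0 → |J (.hor x y)| < lightBound k) ∧ (x ≠ 0 → 1 < |J (.hor x y)|) := by
  have h := hJ (.hor x y) (hor_mem_patternEdges.mpr ⟨⟨h1, h2⟩, hy⟩)
  simp only [patternSet] at h
  by_cases hx : x = 0
  · by_cases hy' : y = m + 3 ∨ y = -m - 3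
    · rw [if_pos hx, if_pos hy', Set.mem_Ioo] at h
      rw [if_pos ⟨hx, hy'⟩]
      exact ⟨sgn_of_neg h.2, fun _ => by rw [abs_of_neg h.2]; linarith, fun h => absurd hx h⟩
    · rw [if_pos hx, if_neg hy', Set.mem_Ioo] at h
      rw [if_neg (by tauto)]
      exact ⟨sgn_of_pos h.1, fun _ => by rw [abs_of_pos h.1]; linarith, fun h => absurd hx h⟩
  · rw [if_neg hx, Set.mem_Ioi] at h
    rw [if_neg (by tauto)]
    exact ⟨sgn_of_pos (by linarith), fun h => absurd h hx, fun _ => by rwa [abs_of_pos (by linarith)]⟩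

lemma pattern_ver {x y : ℤ} (h1 : -(k : ℤ) ≤ x) (h2 : x ≤ k)
    (hy : (m ≤ y ∧ y ≤ m + 3) ∨ (-(m : ℤ) - 4 ≤ y ∧ y ≤ -m - 1)) :
    sgn J (.ver x y) = (if y = m ∧ 1 ≤ x ∧ x.toNat ∈ w then -1 else 1) ∧
    |J (.ver x y)| < lightBound k := by
  have h := hJ (.ver x y) (ver_mem_patternEdges.mpr ⟨⟨h1, h2⟩, hy⟩)
  simp only [patternSet] at h
  split_ifs at h ⊢ with hc
  · exact ⟨sgn_of_neg h.2, by rw [abs_of_neg h.2]; linarith [h.1]⟩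
  · exact ⟨sgn_of_pos h.1, by rw [abs_of_pos h.1]; linarith [h.2]⟩

/-- Of the edges of such a row just one is negative, in the middle of its outer line; the correcting
vertical edges at height `m` belong to neither row. -/
lemma pattern_frustrated {x y : ℤ} (h1 : -(k : ℤ) ≤ x) (h2 : x < k) (hy : y = m + 2 ∨ y = -m - 3) :
    Frustrated J (x, y) ↔ x = 0 := by
  rw [frustrated_iff, prod_plaquetteEdges]
  simp only
  rw [(pattern_hor hJ h1 h2 (y := y) (by omega)).1, (pattern_hor hJ h1 h2 (y := y + 1) (by omega)).1,
    (pattern_ver hJ (x := x) (y := y) h1 (by omega) (by omega)).1,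
    (pattern_ver hJ (x := x + 1) (y := y) (by omega) (by omega) (by omega)).1,
    if_neg (c := y = m ∧ _) (by omega), if_neg (c := y = m ∧ _) (by omega)]
  by_cases hx : x = 0
  · rcases hy with rfl | rfl
    · rw [if_neg (by omega), if_pos (by omega)]
      simp [hx]
    · rw [if_pos (by omega), if_neg (by omega)]
      simp [hx]
  · simp [hx]

include hk in
lemma pattern_isIsolation {y : ℤ} (hy : y = m + 2 ∨ y = -m - 3) : IsIsolation J k y := by
  refine ⟨fun x hx => ?_, fun x hx e he hne => ?_⟩
  · rw [Finset.mem_Ico] at hx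
    exact pattern_frustrated hJ hx.1 hx.2 hy
  · rw [Finset.mem_Ico] at hx
    have hheavy : 1 < |J e| := by
      simp only [Finset.mem_insert, Finset.mem_singleton] at he
      rcases he with rfl | rfl
      · refine (pattern_hor hJ hx.1 hx.2 (by omega)).2.2 ?_
        rintro rfl
        exact hne (by simp [plaquetteEdges])
      · refine (pattern_hor hJ hx.1 hx.2 (by omega)).2.2 ?_
        rintro rfl
        exact hne (by simp [plaquetteEdges])
    refine lt_of_le_of_lt ?_ hheavy
    set F := plaquetteEdges (0, y) ∪ (Finset.Icc (-(k : ℤ)) k ×ˢ Finset.Icc (y - 1) (y + 1)).image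
      fun p => Edge.ver p.1 p.2 with hF
    -- Four edges of the middle plaquette and three levels of 2k+1 vertical edges; with `lightBound
    -- k` = 1/(6k+9) they weigh less than the 1 exceeded by a heavy edge.
    have hcard : F.card ≤ 6 * k + 7 := by
      refine (Finset.card_union_le _ _).trans ?_
      have h1 : (plaquetteEdges (0, y)).card ≤ 4 := Finset.card_le_four
      have h2 : ((Finset.Icc (-(k : ℤ)) k ×ˢ Finset.Icc (y - 1) (y + 1)).image
          fun p => Edge.ver p.1 p.2).card ≤ (2 * k + 1) * 3 := by
        refine Finset.card_image_le.trans ?_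
        rw [Finset.card_product, Int.card_Icc, Int.card_Icc]
        exact Nat.mul_le_mul (by omega) (by omega)
      omega
    have hlight : ∀ e ∈ F, |J e| ≤ lightBound k := by
      intro e he
      rw [hF, Finset.mem_union] at he
      rcases he with he | he
      · simp only [plaquetteEdges, Finset.mem_insert, Finset.mem_singleton] at he
        rcases he with rfl | rfl | rfl | rfl
        · exact ((pattern_hor hJ (x := 0) (by omega) (by omega) (by omega)).2.1 rfl).le
        · exact ((pattern_hor hJ (x := 0) (by omega) (by omega) (by omega)).2.1 rfl).le
        · exact (pattern_ver hJ (by omega) (by omega) (by omega)).2.le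
        · exact (pattern_ver hJ (by omega) (by omega) (by omega)).2.le
      · obtain ⟨p, hp, rfl⟩ := Finset.mem_image.mp he
        simp only [Finset.mem_product, Finset.mem_Icc] at hp
        exact (pattern_ver hJ (by omega) (by omega) (by omega)).2.le
    refine (Finset.sum_le_card_nsmul _ _ _ hlight).trans ?_
    rw [nsmul_eq_mul]
    have hc : (F.card : ℝ) ≤ 6 * k + 7 := by exact_mod_cast hcard
    unfold lightBound
    rw [mul_one_div, div_le_one (by positivity)]
    linarith

lemma pattern_prod_hor {n : ℤ} (hn : n = m + 2 ∨ n = m + 3 ∨ n = -m - 2 ∨ n = -m - 3) {k' : ℕ}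
    (hk1 : 1 ≤ k') (hk2 : k' ≤ k) :
    ∏ x ∈ Finset.Ico (-(k' : ℤ)) k', sgn J (.hor x n)
      = if n = m + 3 ∨ n = -m - 3 then -1 else 1 := by
  rw [Finset.prod_eq_single (0 : ℤ)]
  · rw [(pattern_hor hJ (by omega) (by omega) hn).1]
    simp
  · intro x hx hx0
    rw [Finset.mem_Ico] at hx
    rw [(pattern_hor hJ (by omega) (by omega) hn).1, if_neg (by tauto)]
  · intro h
    exact absurd (Finset.mem_Ico.mpr (by omega)) h

/-- The signs of top and bottom cancel by symmetry. On the sides, the old part between -m and m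
contributes its column parity, and the edge `ver k' m` repeats this sign; all other new edges are
positive. One choice of `w` thus serves all half-widths and both heights. -/
lemma pattern_evenBoundary (hw : w = columnParity J k m) {n : ℕ} (hn : n = m + 2 ∨ n = m + 3) {k' : ℕ}
    (hk1 : 1 ≤ k') (hk2 : k' ≤ k) : EvenBoundary J n k' := by
  rw [evenBoundary_iff, prod_boundaryEdges (by omega) hk1,
    pattern_prod_hor hJ (by omega) hk1 hk2, pattern_prod_hor hJ (by omega) hk1 hk2]
  have hsub : Finset.Ico (-(m : ℤ)) m ⊆ Finset.Ico (-(n : ℤ)) n :=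
    Finset.Ico_subset_Ico (by omega) (by omega)
  rw [mul_assoc _ (∏ y ∈ _, sgn J (.ver k' y)), ← Finset.prod_mul_distrib, ← Finset.prod_sdiff hsub]
  have hnew : ∏ y ∈ Finset.Ico (-(n : ℤ)) n \ Finset.Ico (-(m : ℤ)) m,
      (sgn J (.ver k' y) * sgn J (.ver (-k') y)) = if k' ∈ w then -1 else 1 := by
    rw [Finset.prod_eq_single (m : ℤ)]
    · rw [(pattern_ver hJ (by omega) (by omega) (by omega)).1,
        (pattern_ver hJ (by omega) (by omega) (by omega)).1]
      rw [if_neg (c := (m : ℤ) = m ∧ (1 : ℤ) ≤ -k' ∧ _) (by omega)]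
      simp [hk1]
    · intro y hy hym
      rw [Finset.mem_sdiff, Finset.mem_Ico, Finset.mem_Ico] at hy
      rw [(pattern_ver hJ (by omega) (by omega) (by omega)).1,
        (pattern_ver hJ (by omega) (by omega) (by omega)).1, if_neg (by tauto), if_neg (by tauto)]
      rfl
    · intro h
      exact absurd (by rw [Finset.mem_sdiff, Finset.mem_Ico, Finset.mem_Ico]; omega) h
  rw [hnew]
  have hpar : k' ∈ w ↔ ∏ y ∈ Finset.Ico (-(m : ℤ)) m,
      (sgn J (.ver k' y) * sgn J (.ver (-k') y)) = -1 := by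
    rw [hw, columnParity, Finset.mem_filter, Finset.mem_Icc]
    tauto
  have htb : (if (n : ℤ) = m + 3 ∨ (n : ℤ) = -m - 3 then -1 else 1 : ℤˣ)
      * (if -(n : ℤ) = m + 3 ∨ -(n : ℤ) = -m - 3 then -1 else 1) = 1 := by
    rcases hn with rfl | rfl
    · rw [if_neg (by omega), if_neg (by omega)]; rfl
    · rw [if_pos (by omega), if_pos (by omega)]; rfl
  rw [htb, one_mul]
  by_cases h : k' ∈ w
  · rw [if_pos h, hpar.mp h]; rfl
  · rw [if_neg h, one_mul]
    exact (Int.units_eq_one_or _).resolve_right (mt hpar.mpr h)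

include hk in
theorem pattern_mem_eventR (hw : w = columnParity J k m) : J ∈ eventR (m + 3) k := by
  refine ⟨⟨by omega, fun k' hk1 hk2 => ⟨pattern_evenBoundary hJ hw (by omega) hk1 hk2,
    pattern_evenBoundary hJ hw (by omega) hk1 hk2⟩, ?_, ?_⟩, ?_, ?_⟩
  · rintro ⟨x, y⟩ hp
    simp only [upperPart, Finset.mem_product, Finset.mem_Ico] at hp
    rw [pattern_frustrated hJ (by omega) (by omega) (by omega), Prod.mk.injEq]
    omega
  · rintro ⟨x, y⟩ hp
    simp only [lowerPart, Finset.mem_product, Finset.mem_Ico] at hp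
    rw [pattern_frustrated hJ (by omega) (by omega) (by omega), Prod.mk.injEq]
    omega
  · exact pattern_isIsolation hk hJ (by push_cast; omega)
  · exact pattern_isIsolation hk hJ (by push_cast; omega)

end Pattern

lemma gaussianReal_real_pos {v : ℝ≥0} (hv : v ≠ 0) {s : Set ℝ} (hs : IsOpen s) (hne : s.Nonempty) :
    0 < (gaussianReal 0 v).real s := by
  have : Measure.IsOpenPosMeasure (gaussianReal 0 v) :=
    (gaussianReal_absolutelyContinuous' 0 hv).isOpenPosMeasure
  exact ENNReal.toReal_pos (hs.measure_pos _ hne).ne' (measure_ne_top _ _)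

/-- A lower bound for the probability of a range of `patternSet`. -/
def patternWeight (v : ℝ≥0) (k : ℕ) : ℝ :=
  min ((gaussianReal 0 v).real (Set.Ioi 1)) (min ((gaussianReal 0 v).real (Set.Ioo 0 (lightBound k)))
    ((gaussianReal 0 v).real (Set.Ioo (-lightBound k) 0)))

lemma patternWeight_pos {v : ℝ≥0} (hv : v ≠ 0) (k : ℕ) : 0 < patternWeight v k := by
  have := lightBound_pos k
  refine lt_min (gaussianReal_real_pos hv isOpen_Ioi ⟨2, by norm_num⟩)
    (lt_min (gaussianReal_real_pos hv isOpen_Ioo (Set.nonempty_Ioo.mpr this))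
      (gaussianReal_real_pos hv isOpen_Ioo (Set.nonempty_Ioo.mpr (by linarith))))

lemma patternWeight_le_one (v : ℝ≥0) (k : ℕ) : patternWeight v k ≤ 1 :=
  (min_le_left _ _).trans measureReal_le_one

/-- The point is a bound that depends on neither `m` nor `w`. -/
lemma le_couplingLaw_pattern {v : ℝ≥0} (hv : v ≠ 0) (k m : ℕ) (w : Finset ℕ) :
    patternWeight v k ^ (24 * k + 8) ≤
      (couplingLaw v).real {J | ∀ e ∈ patternEdges k m, J e ∈ patternSet k m w e} := by
  rw [couplingLaw_pi v _ (measurableSet_patternSet k m w)]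
  refine (pow_le_pow_of_le_one (patternWeight_pos hv k).le (patternWeight_le_one v k)
    (card_patternEdges_le k m)).trans ?_
  rw [← Finset.prod_const]
  refine Finset.prod_le_prod (fun _ _ => (patternWeight_pos hv k).le) fun e _ => ?_
  unfold patternWeight
  cases e <;> simp only [patternSet] <;> split_ifs <;> simp

/-- Whatever happens in `C(m,k)`, there is a chance for `R(m+3,k)`. -/
lemma le_couplingLaw_inter_eventR {v : ℝ≥0} (hv : v ≠ 0) {k m : ℕ} (hk : 1 ≤ k)
    {G : Set Couplings} (hG : MeasurableSet G) (dG : DependsOn (· ∈ G) (edges m k : Set Edge)) :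
    patternWeight v k ^ (24 * k + 8) * (couplingLaw v).real G ≤
      (couplingLaw v).real (G ∩ eventR (m + 3) k) := by
  -- The required pattern depends on the column parities of C(m,k). Splitting `G` by their value
  -- fixes the pattern on each piece, and the pattern then concerns edges outside C(m,k) and is
  -- independent of the piece.
  set O : Finset ℕ → Set Couplings := fun w => G ∩ {J | columnParity J k m = w} with hO
  set P : Finset ℕ → Set Couplings := fun w => {J | ∀ e ∈ patternEdges k m, J e ∈ patternSet k m w e}
    with hP
  have ver_mem : ∀ {k' : ℕ} {y : ℤ}, k' ∈ Finset.Icc 1 k → y ∈ Finset.Ico (-(m : ℤ)) m →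
      Edge.ver k' y ∈ edges m k ∧ Edge.ver (-k') y ∈ edges m k := by
    intro k' y hk' hy
    rw [Finset.mem_Icc] at hk'
    rw [Finset.mem_Ico] at hy
    rw [ver_mem_edges, ver_mem_edges]
    omega
  have hpar : ∀ J J' : Couplings, (∀ e ∈ edges m k, (J e < 0 ↔ J' e < 0)) →
      columnParity J k m = columnParity J' k m := by
    intro J J' h
    refine Finset.filter_congr fun k' hk' => ?_
    rw [Finset.prod_congr rfl fun y hy => ?_]
    unfold sgn
    simp only [h _ (ver_mem hk' hy).1, h _ (ver_mem hk' hy).2]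
  have mO : ∀ w, MeasurableSet (O w) := by
    intro w
    refine hG.inter (measurableSet_of_finite_data (ι := edges m k)
      (S := fun e => {J : Couplings | J e.1 < 0})
      (fun e => measurableSet_lt (measurable_coupling e.1) measurable_const) fun J J' h hJ => ?_)
    have := hpar J J' fun e he => h ⟨e, he⟩
    exact this.symm.trans hJ
  have dO : ∀ w, DependsOn (· ∈ O w) (edges m k : Set Edge) := by
    intro w
    refine dependsOn_of_imp fun J J' h hJ => ⟨(iff_of_eq (dG h)).mp hJ.1, ?_⟩
    exact (hpar J J' fun e he => by rw [h e he]).symm.trans hJ.2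
  have mP : ∀ w, MeasurableSet (P w) := fun w => measurableSet_setOfPred.mpr <|
    Measurable.forall fun e => measurable_const.imp <|
      measurableSet_setOfPred.mp ((measurable_coupling e) (measurableSet_patternSet k m w e))
  have dP : ∀ w, DependsOn (· ∈ P w) (patternEdges k m : Set Edge) := fun w =>
    dependsOn_of_imp fun J J' h hJ e he => h e he ▸ hJ e he
  have hdisj : Disjoint (edges m k) (patternEdges k m) := by
    rw [Finset.disjoint_left]
    intro e h1 h2
    cases e with
    | hor x y => rw [hor_mem_edges] at h1; rw [hor_mem_patternEdges] at h2; omega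
    | ver x y => rw [ver_mem_edges] at h1; rw [ver_mem_patternEdges] at h2; omega
  have hpd : ∀ w w', w ≠ w' → Disjoint (O w) (O w') := by
    intro w w' hne
    rw [Set.disjoint_left]
    intro J h1 h2
    exact hne (h1.2.symm.trans h2.2)
  have hunion : G = ⋃ w ∈ (Finset.Icc 1 k).powerset, O w := by
    ext J
    simp only [hO, Set.mem_iUnion, Finset.mem_powerset]
    constructor
    · exact fun h => ⟨columnParity J k m, Finset.filter_subset _ _, h, rfl⟩
    · rintro ⟨w, -, h, -⟩
      exact h
  calc patternWeight v k ^ (24 * k + 8) * (couplingLaw v).real G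
      = ∑ w ∈ (Finset.Icc 1 k).powerset,
          (couplingLaw v).real (O w) * patternWeight v k ^ (24 * k + 8) := by
        rw [← Finset.sum_mul, mul_comm, ← measureReal_biUnion_finset
          (fun w _ w' _ h => hpd w w' h) (fun w _ => mO w), ← hunion]
    _ ≤ ∑ w ∈ (Finset.Icc 1 k).powerset, (couplingLaw v).real (O w ∩ P w) := by
        refine Finset.sum_le_sum fun w _ => ?_
        rw [couplingLaw_inter v (mO w) (mP w) (dO w) (dP w) hdisj]
        exact mul_le_mul_of_nonneg_left (le_couplingLaw_pattern hv k m w) measureReal_nonneg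
    _ = (couplingLaw v).real (⋃ w ∈ (Finset.Icc 1 k).powerset, O w ∩ P w) := by
        rw [measureReal_biUnion_finset
          (fun w _ w' _ h => (hpd w w' h).mono Set.inter_subset_left Set.inter_subset_left)
          (fun w _ => (mO w).inter (mP w))]
    _ ≤ (couplingLaw v).real (G ∩ eventR (m + 3) k) := by
        refine measureReal_mono ?_
        simp only [Set.iUnion_subset_iff]
        rintro w - J ⟨⟨h1, h2⟩, h3⟩
        exact ⟨h1, pattern_mem_eventR hk h3 h2.symm⟩

/-- Almost surely `R(n,k)` holds for some large `n`. -/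
theorem ae_exists_eventR {v : ℝ≥0} (hv : v ≠ 0) {k : ℕ} (hk : 1 ≤ k) (K : ℕ) :
    ∀ᵐ J ∂(couplingLaw v), ∃ n, K ≤ n ∧ J ∈ eventR n k := by
  set p := patternWeight v k ^ (24 * k + 8) with hp
  have hp0 : 0 < p := pow_pos (patternWeight_pos hv k) _
  have hp1 : p ≤ 1 := pow_le_one₀ (patternWeight_pos hv k).le (patternWeight_le_one v k)
  -- The trial at height K+4i+3 reads the edges of C(K+4i+4,k), which is just the box outside of
  -- which the pattern of the next trial lies.
  set G : ℕ → Set Couplings := fun j => {J | ∀ i < j, J ∉ eventR (K + 4 * i + 3) k} with hG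
  have hsucc : ∀ j, G (j + 1) = G j \ eventR (K + 4 * j + 3) k := by
    intro j
    ext J
    simp only [hG, Set.mem_ofPred_eq, Set.mem_sdiff, Nat.forall_lt_succ_right]
  have mG : ∀ j, MeasurableSet (G j) := by
    intro j
    induction j with
    | zero => simp [hG]
    | succ j ih => rw [hsucc]; exact ih.diff (measurableSet_eventR _ _)
  have dG : ∀ j, DependsOn (· ∈ G j) (edges (K + 4 * j) k : Set Edge) := by
    intro j
    refine dependsOn_of_imp fun J J' h hJ i hi hR => hJ i hi ?_
    refine (iff_of_eq (dependsOn_eventR (by omega) hk fun e he => ?_)).mpr hR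
    exact h e (edges_mono (by omega) le_rfl he)
  have hbound : ∀ j, (couplingLaw v).real (G j) ≤ (1 - p) ^ j := by
    intro j
    induction j with
    | zero => simp
    | succ j ih =>
      have h1 := le_couplingLaw_inter_eventR hv hk (mG j) (dG j)
      have h2 := measureReal_inter_add_sdiff (μ := couplingLaw v) (s := G j)
        (measurableSet_eventR (K + 4 * j + 3) k)
      rw [← hsucc] at h2
      rw [pow_succ]
      have := mul_le_mul_of_nonneg_right ih (by linarith : 0 ≤ 1 - p)
      linarith
  have hnull : (couplingLaw v).real {J | ¬ ∃ n, K ≤ n ∧ J ∈ eventR n k} = 0 := by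
    refine le_antisymm (ge_of_tendsto' (tendsto_pow_atTop_nhds_zero_of_lt_one
      (by linarith : 0 ≤ 1 - p) (by linarith)) fun j => (measureReal_mono ?_).trans (hbound j))
      measureReal_nonneg
    intro J hJ i _ hR
    exact hJ ⟨_, by omega, hR⟩
  rw [ae_iff]
  exact (measureReal_eq_zero_iff (measure_ne_top _ _)).mp hnull

end EASpinGlass
end

/-! ### Probability estimates for barriers and for R(n,k) -/

noncomputable section
namespace EASpinGlass
open MeasureTheory ProbabilityTheory

/-! ### Probabilities of barriers -/

/-- The probability of a barrier of half-width `k` at a given height. -/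
def barrierProb (v : ℝ≥0) (k : ℕ) : ℝ := (couplingLaw v).real {J | IsBarrier J 0 k}

lemma measurableSet_isBarrier (h : ℤ) (k : ℕ) : MeasurableSet {J | IsBarrier J h k} :=
  measurableSet_setOfPred.mpr (measurable_isBarrier h k)

/-- Vertical translation of the edges. -/
def shiftEdge (h : ℤ) : Edge ≃ Edge where
  toFun
    | .hor x y => .hor x (y + h)
    | .ver x y => .ver x (y + h)
  invFun
    | .hor x y => .hor x (y - h)
    | .ver x y => .ver x (y - h)
  left_inv e := by cases e <;> simp
  right_inv e := by cases e <;> simp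

lemma couplingLaw_isBarrier (v : ℝ≥0) (h : ℤ) (k : ℕ) :
    (couplingLaw v).real {J | IsBarrier J h k} = barrierProb v k := by
  have h1 := (measurePreserving_relabel v (shiftEdge h)).measureReal_preimage
    (measurableSet_isBarrier 0 k).nullMeasurableSet
  rw [barrierProb, ← h1]
  congr 1
  ext J
  simp only [Set.mem_preimage, Set.mem_ofPred_eq, IsBarrier]
  refine forall_congr' fun x => imp_congr_right fun _ => imp_congr_right fun _ => ?_
  have h2 : lightEdges h k = (lightEdges 0 k).map (shiftEdge h).toEmbedding := by
    ext e
    rw [Finset.mem_map_equiv]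
    cases e with
    | hor x y =>
      simp only [shiftEdge, Equiv.coe_fn_symm_mk, hor_mem_lightEdges]
      omega
    | ver x y =>
      simp only [shiftEdge, Equiv.coe_fn_symm_mk, ver_mem_lightEdges]
      omega
  rw [h2, Finset.sum_map]
  simp [shiftEdge]

/-- The edges that decide whether there is a barrier of half-width `k` at height `h`. -/
def barrierEdges (h : ℤ) (k : ℕ) : Finset Edge :=
  lightEdges h k ∪ (Finset.Ico (-(k : ℤ)) k).image fun x => .hor x h

lemma dependsOn_isBarrier (h : ℤ) (k : ℕ) :
    DependsOn (· ∈ {J | IsBarrier J h k}) (barrierEdges h k : Set Edge) := by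
  refine dependsOn_of_imp fun J J' hJ hB x hx hx0 => ?_
  have h1 : J' (.hor x h) = J (.hor x h) :=
    (hJ _ (Finset.mem_union_right _ (Finset.mem_image_of_mem _ hx))).symm
  rw [h1]
  refine lt_of_eq_of_lt (Finset.sum_congr rfl fun e he => ?_) (hB x hx hx0)
  rw [hJ e (Finset.mem_union_left _ he)]

lemma hor_mem_barrierEdges {h : ℤ} {k : ℕ} {x y : ℤ} (hm : Edge.hor x y ∈ barrierEdges h k) :
    y = h := by
  rw [barrierEdges, Finset.mem_union, hor_mem_lightEdges] at hm
  simp at hm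
  omega

lemma ver_mem_barrierEdges {h : ℤ} {k : ℕ} {x y : ℤ} (hm : Edge.ver x y ∈ barrierEdges h k) :
    h - 1 ≤ y ∧ y ≤ h := by
  rw [barrierEdges, Finset.mem_union, ver_mem_lightEdges] at hm
  simp at hm
  omega

lemma disjoint_barrierEdges {h h' : ℤ} (hh : h + 2 ≤ h' ∨ h' + 2 ≤ h) (k : ℕ) :
    Disjoint (barrierEdges h k) (barrierEdges h' k) := by
  rw [Finset.disjoint_left]
  intro e h1 h2
  cases e with
  | hor x y =>
    have := hor_mem_barrierEdges h1
    have := hor_mem_barrierEdges h2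
    omega
  | ver x y =>
    have := ver_mem_barrierEdges h1
    have := ver_mem_barrierEdges h2
    omega

/-- Barriers at heights at least 2 apart involve disjoint sets of edges and are independent. -/
lemma couplingLaw_no_barrier (v : ℝ≥0) (k : ℕ) {f : ℕ → ℤ}
    (hf : ∀ i j, i < j → f i + 2 ≤ f j ∨ f j + 2 ≤ f i) (M : ℕ) :
    (couplingLaw v).real {J | ∀ i < M, ¬ IsBarrier J (f i) k} = (1 - barrierProb v k) ^ M := by
  set G : ℕ → Set Couplings := fun j => {J | ∀ i < j, ¬ IsBarrier J (f i) k} with hG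
  have hsucc : ∀ j, G (j + 1) = G j ∩ {J | IsBarrier J (f j) k}ᶜ := by
    intro j
    ext J
    simp only [hG, Set.mem_ofPred_eq, Set.mem_inter_iff, Set.mem_compl_iff,
      Nat.forall_lt_succ_right]
  have mG : ∀ j, MeasurableSet (G j) := by
    intro j
    induction j with
    | zero => simp [hG]
    | succ j ih => rw [hsucc]; exact ih.inter (measurableSet_isBarrier _ _).compl
  have dG : ∀ j, DependsOn (· ∈ G j)
      (((Finset.range j).biUnion fun i => barrierEdges (f i) k : Finset Edge) : Set Edge) := by
    intro j
    refine dependsOn_of_imp fun J J' h hJ i hi hB => hJ i hi ?_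
    refine (iff_of_eq (dependsOn_isBarrier (f i) k fun e he => h e ?_)).mpr hB
    exact Finset.mem_biUnion.mpr ⟨i, Finset.mem_range.mpr hi, he⟩
  change (couplingLaw v).real (G M) = _
  induction M with
  | zero => simp [hG]
  | succ j ih =>
    rw [hsucc, couplingLaw_inter v (mG j) (measurableSet_isBarrier _ _).compl (dG j)
      (T := barrierEdges (f j) k), ih, probReal_compl_eq_one_sub (measurableSet_isBarrier _ _),
      couplingLaw_isBarrier, pow_succ]
    · exact dependsOn_of_imp fun J J' h hJ hB => hJ
        ((iff_of_eq (dependsOn_isBarrier (f j) k h)).mpr hB)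
    · rw [Finset.disjoint_biUnion_left]
      exact fun i hi => disjoint_barrierEdges (hf i j (Finset.mem_range.mp hi)) k

/-! ### An upper bound for the probability of `R(n,k)` -/

lemma measurableSet_abs_lt (e e' : Edge) : MeasurableSet {J : Couplings | |J e| < |J e'|} :=
  measurableSet_lt (measurable_coupling e).abs (measurable_coupling e').abs

/-- Exchanging the two couplings preserves the law and turns the event into a disjoint one. -/
lemma couplingLaw_abs_lt_le (v : ℝ≥0) (e e' : Edge) :
    (couplingLaw v).real {J | |J e| < |J e'|} ≤ 1 / 2 := by
  have h1 := (measurePreserving_relabel v (Equiv.swap e e')).measureReal_preimage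
    (measurableSet_abs_lt e e').nullMeasurableSet
  have h2 : (fun (J : Couplings) f => J (Equiv.swap e e' f)) ⁻¹' {J | |J e| < |J e'|}
      = {J | |J e'| < |J e|} := by
    ext J
    simp
  rw [h2] at h1
  have h3 : Disjoint {J : Couplings | |J e| < |J e'|} {J | |J e'| < |J e|} := by
    rw [Set.disjoint_left]
    intro J h4 h5
    simp only [Set.mem_ofPred_eq] at h4 h5
    exact lt_asymm h4 h5
  have h4 := measureReal_union (μ := couplingLaw v) h3 (measurableSet_abs_lt e' e)
  have h5 : (couplingLaw v).real ({J : Couplings | |J e| < |J e'|} ∪ {J | |J e'| < |J e|}) ≤ 1 :=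
    measureReal_le_one
  linarith

lemma measurableSet_forall_abs_lt {ι : Type*} (I : Finset ι) (f g : ι → Edge) :
    MeasurableSet {J : Couplings | ∀ i ∈ I, |J (g i)| < |J (f i)|} := by
  have : {J : Couplings | ∀ i ∈ I, |J (g i)| < |J (f i)|}
      = ⋂ i ∈ I, {J | |J (g i)| < |J (f i)|} := by
    ext J; simp
  rw [this]
  exact I.measurableSet_biInter fun i _ => measurableSet_abs_lt _ _

lemma dependsOn_forall_abs_lt {ι : Type*} (I : Finset ι) (f g : ι → Edge) :
    DependsOn (· ∈ {J : Couplings | ∀ i ∈ I, |J (g i)| < |J (f i)|})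
      ((I.image f ∪ I.image g : Finset Edge) : Set Edge) := by
  refine dependsOn_of_imp fun J J' h hJ i hi => ?_
  rw [← h _ (Finset.mem_union_left _ (Finset.mem_image_of_mem f hi)),
    ← h _ (Finset.mem_union_right _ (Finset.mem_image_of_mem g hi))]
  exact hJ i hi

lemma couplingLaw_forall_abs_lt_le (v : ℝ≥0) {ι : Type*} (I : Finset ι) {f g : ι → Edge}
    (hf : Function.Injective f) (hg : Function.Injective g) (hfg : ∀ i j, f i ≠ g j) :
    (couplingLaw v).real {J | ∀ i ∈ I, |J (g i)| < |J (f i)|} ≤ (1 / 2) ^ I.card := by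
  classical
  induction I using Finset.induction_on with
  | empty => simp
  | insert a I ha ih =>
    have h1 : {J : Couplings | ∀ i ∈ insert a I, |J (g i)| < |J (f i)|}
        = {J | ∀ i ∈ I, |J (g i)| < |J (f i)|}
          ∩ {J | ∀ i ∈ ({a} : Finset ι), |J (g i)| < |J (f i)|} := by
      ext J
      simp [and_comm]
    rw [h1, couplingLaw_inter v (measurableSet_forall_abs_lt _ _ _)
      (measurableSet_forall_abs_lt _ _ _) (dependsOn_forall_abs_lt _ _ _)
      (dependsOn_forall_abs_lt _ _ _), Finset.card_insert_of_notMem ha, pow_succ]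
    · refine mul_le_mul ih ?_ measureReal_nonneg (by positivity)
      simpa using couplingLaw_abs_lt_le v (g a) (f a)
    · rw [Finset.disjoint_left]
      intro e he he'
      simp only [Finset.image_singleton, Finset.mem_union, Finset.mem_image,
        Finset.mem_singleton] at he he'
      rcases he with ⟨i, hi, rfl⟩ | ⟨i, hi, rfl⟩ <;> rcases he' with he' | he'
      · exact ha (hf he' ▸ hi)
      · exact hfg _ _ he'
      · exact hfg _ _ he'.symm
      · exact ha (hg he' ▸ hi)

lemma not_mem_plaquetteEdges_of_ne {x y h : ℤ} (hx : x ≠ 0) :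
    Edge.hor x h ∉ plaquetteEdges (0, y) := by
  simp [plaquetteEdges, hx]

lemma IsIsolation.isBarrier {J : Couplings} {k : ℕ} {y h : ℤ} (hI : IsIsolation J k y)
    (hh : h = y ∨ h = y + 1) : IsBarrier J h k := by
  intro x hx hx0
  have h1 := hI.2 x hx (.hor x h) (by rcases hh with rfl | rfl <;> simp)
    (not_mem_plaquetteEdges_of_ne hx0)
  refine lt_of_le_of_lt (Finset.sum_le_sum_of_subset_of_nonneg ?_ fun _ _ _ => abs_nonneg _) h1
  intro e he
  rw [Finset.mem_union]
  cases e with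
  | hor a b =>
    rw [hor_mem_lightEdges] at he
    left
    obtain ⟨rfl, rfl⟩ := he
    rcases hh with rfl | rfl <;> simp [plaquetteEdges]
  | ver a b =>
    rw [ver_mem_lightEdges] at he
    right
    refine Finset.mem_image.mpr ⟨(a, b), ?_, rfl⟩
    simp only [Finset.mem_product, Finset.mem_Icc]
    omega

lemma IsIsolation.abs_ver_lt {J : Couplings} {k : ℕ} {y h z : ℤ} (hI : IsIsolation J k y)
    (hh : h = y ∨ h = y + 1) (hz : y - 1 ≤ z ∧ z ≤ y + 1) {x : ℤ} (hx : x ∈ Finset.Ico (-(k : ℤ)) k)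
    (hx0 : x ≠ 0) : |J (.ver x z)| < |J (.hor x h)| := by
  have h1 := hI.2 x hx (.hor x h) (by rcases hh with rfl | rfl <;> simp)
    (not_mem_plaquetteEdges_of_ne hx0)
  refine lt_of_le_of_lt ?_ h1
  refine Finset.single_le_sum (f := fun e => |J e|) (fun _ _ => abs_nonneg _)
    (Finset.mem_union_right _ (Finset.mem_image.mpr ⟨(x, z), ?_, rfl⟩))
  rw [Finset.mem_Ico] at hx
  simp only [Finset.mem_product, Finset.mem_Icc]
  omega

/-- Each isolation contains two lines. The outer lines, at heights ±n, give two independent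
barriers. On the inner ones each of the 2k-1 horizontal edges off the middle is compared with the
vertical edge pointing inwards at its left end. These edges are disjoint from those of the barriers,
and the resulting exponential gain makes the errors summable. -/
theorem couplingLaw_eventR_le (v : ℝ≥0) {n k : ℕ} (hn : 2 ≤ n) (hk : 1 ≤ k) :
    (couplingLaw v).real (eventR n k) ≤ barrierProb v k ^ 2 * (1 / 2) ^ (4 * k - 2) := by
  set I : Finset (ℤ × Bool) := ((Finset.Ico (-(k : ℤ)) k).erase 0) ×ˢ Finset.univ with hI
  set f : ℤ × Bool → Edge := fun p => .hor p.1 (if p.2 then (n : ℤ) - 1 else -n + 1) with hf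
  set g : ℤ × Bool → Edge := fun p => .ver p.1 (if p.2 then (n : ℤ) - 2 else -n + 1) with hg
  have hIcard : I.card = 4 * k - 2 := by
    rw [hI, Finset.card_product, Finset.card_erase_of_mem (Finset.mem_Ico.mpr (by omega)),
      Int.card_Ico, Finset.card_univ, Fintype.card_bool]
    omega
  have hfi : Function.Injective f := by
    rintro ⟨x, b⟩ ⟨x', b'⟩ h
    simp only [hf, Edge.hor.injEq] at h
    obtain ⟨rfl, h⟩ := h
    cases b <;> cases b' <;> simp at h ⊢ <;> omega
  have hgi : Function.Injective g := by
    rintro ⟨x, b⟩ ⟨x', b'⟩ h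
    simp only [hg, Edge.ver.injEq] at h
    obtain ⟨rfl, h⟩ := h
    cases b <;> cases b' <;> simp at h ⊢ <;> omega
  have hsub : eventR n k ⊆ ({J | IsBarrier J n k} ∩ {J | IsBarrier J (-n) k}) ∩
      {J | ∀ i ∈ I, |J (g i)| < |J (f i)|} := by
    rintro J ⟨-, h1, h2⟩
    refine ⟨⟨h1.isBarrier (by omega), h2.isBarrier (by omega)⟩, ?_⟩
    rintro ⟨x, b⟩ hx
    rw [hI, Finset.mem_product, Finset.mem_erase] at hx
    cases b
    · exact h2.abs_ver_lt (by simp) (by simp; omega) hx.1.2 hx.1.1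
    · exact h1.abs_ver_lt (by simp) (by simp; omega) hx.1.2 hx.1.1
  have hIim : ∀ e ∈ I.image f ∪ I.image g, e ∉ barrierEdges n k ∪ barrierEdges (-n) k := by
    intro e he he'
    rw [Finset.mem_union] at he he'
    rcases he with he | he
    · obtain ⟨⟨x, b⟩, -, rfl⟩ := Finset.mem_image.mp he
      rcases he' with he' | he' <;> have := hor_mem_barrierEdges he' <;> cases b <;>
        simp at this <;> omega
    · obtain ⟨⟨x, b⟩, -, rfl⟩ := Finset.mem_image.mp he
      rcases he' with he' | he' <;> have := ver_mem_barrierEdges he' <;> cases b <;>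
        simp at this <;> omega
  refine (measureReal_mono hsub).trans ?_
  have mB := (measurableSet_isBarrier n k).inter (measurableSet_isBarrier (-n) k)
  rw [couplingLaw_inter v mB (measurableSet_forall_abs_lt I f g)
    (S := barrierEdges n k ∪ barrierEdges (-n) k) ?_ (dependsOn_forall_abs_lt I f g)
    (Finset.disjoint_right.mpr hIim),
    couplingLaw_inter v (measurableSet_isBarrier n k) (measurableSet_isBarrier (-n) k)
    (dependsOn_isBarrier _ _) (dependsOn_isBarrier _ _) (disjoint_barrierEdges (by omega) k),
    couplingLaw_isBarrier, couplingLaw_isBarrier, ← hIcard, ← sq]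
  · exact mul_le_mul_of_nonneg_left (couplingLaw_forall_abs_lt_le v I hfi hgi (by simp [hf, hg]))
      (sq_nonneg _)
  · refine dependsOn_of_imp fun J J' h hJ => ⟨?_, ?_⟩
    · exact (iff_of_eq (dependsOn_isBarrier _ _ fun e he =>
        h e (Finset.mem_union_left _ he))).mp hJ.1
    · exact (iff_of_eq (dependsOn_isBarrier _ _ fun e he =>
        h e (Finset.mem_union_right _ he))).mp hJ.2

/-! ### A lower bound for the probability of a barrier -/

/-- On the interval the density is at least its value at 1. -/
lemma exists_le_gaussianReal_Ioo {v : ℝ≥0} (hv : v ≠ 0) : ∃ κ : ℝ, 0 < κ ∧ ∀ N : ℕ, 1 ≤ N →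
    κ / N ≤ (gaussianReal 0 v).real (Set.Ioo (-(1 / N : ℝ)) (1 / N)) := by
  have hpos := gaussianPDFReal_pos 0 v 1 hv
  refine ⟨2 * gaussianPDFReal 0 v 1, by positivity, fun N hN => ?_⟩
  have hN' : (1 : ℝ) ≤ N := by exact_mod_cast hN
  have hN1 : (1 : ℝ) / N ≤ 1 := by rw [div_le_one (by linarith)]; exact hN'
  have h1 : ENNReal.ofReal (gaussianPDFReal 0 v 1) * volume (Set.Ioo (-(1 / N : ℝ)) (1 / N))
      ≤ gaussianReal 0 v (Set.Ioo (-(1 / N : ℝ)) (1 / N)) := by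
    rw [gaussianReal_apply 0 hv, ← setLIntegral_const]
    refine setLIntegral_mono (measurable_gaussianPDF 0 v) fun x hx => ?_
    refine ENNReal.ofReal_le_ofReal ?_
    unfold gaussianPDFReal
    have hx2 : (x - 0) ^ 2 ≤ (1 - 0) ^ 2 := by
      rw [sub_zero, sub_zero]
      exact sq_le_sq' (by linarith [hx.1]) (by linarith [hx.2])
    gcongr
  rw [Real.volume_Ioo, ← ENNReal.ofReal_mul hpos.le] at h1
  have h2 := (ENNReal.ofReal_le_iff_le_toReal (measure_ne_top _ _)).mp h1
  refine le_trans (le_of_eq ?_) h2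
  ring

lemma card_lightEdges_le (h : ℤ) (k : ℕ) : (lightEdges h k).card ≤ 4 * k + 3 := by
  refine (Finset.card_insert_le _ _).trans ?_
  have := (Finset.card_image_le (s := Finset.Icc (-(k : ℤ)) k ×ˢ Finset.Icc (h - 1) h)
    (f := fun p => Edge.ver p.1 p.2))
  rw [Finset.card_product, Int.card_Icc, Int.card_Icc] at this
  have h1 : ((k : ℤ) + 1 - -(k : ℤ)).toNat = 2 * k + 1 := by omega
  have h2 : (h + 1 - (h - 1)).toNat = 2 := by omega
  rw [h1, h2] at this
  omega

lemma card_barrierEdges_le (h : ℤ) (k : ℕ) : (barrierEdges h k).card ≤ 6 * k + 3 := by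
  refine (Finset.card_union_le _ _).trans ?_
  have h1 := card_lightEdges_le h k
  have h2 := (Finset.card_image_le (s := Finset.Ico (-(k : ℤ)) k) (f := fun x => Edge.hor x h))
  rw [Int.card_Ico] at h2
  omega

/-- A barrier is certain if every light edge is below 1/(6k+3) in absolute value and every heavy one
exceeds 1; at most 6k+3 edges are involved. -/
theorem exists_le_barrierProb {v : ℝ≥0} (hv : v ≠ 0) : ∃ κ : ℝ, 0 < κ ∧ ∀ k : ℕ,
    (κ / (6 * k + 3)) ^ (6 * k + 3) ≤ barrierProb v k := by
  obtain ⟨κ, hκ, hle⟩ := exists_le_gaussianReal_Ioo hv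
  set θ := (gaussianReal 0 v).real (Set.Ioi 1) with hθ
  have hθ0 : 0 < θ := gaussianReal_real_pos hv isOpen_Ioi ⟨2, by norm_num⟩
  refine ⟨min κ θ, lt_min hκ hθ0, fun k => ?_⟩
  have hNc : ((6 * k + 3 : ℕ) : ℝ) = 6 * k + 3 := by push_cast; ring
  have hN1 : (1 : ℝ) ≤ 6 * k + 3 := by
    have : (0 : ℝ) ≤ k := Nat.cast_nonneg k
    linarith
  have hl := hle (6 * k + 3) (by omega)
  rw [hNc] at hl
  set a : ℝ := min κ θ / (6 * k + 3) with ha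
  have ha0 : 0 ≤ a := div_nonneg (le_min hκ.le hθ0.le) (by linarith)
  have haθ : a ≤ θ := (div_le_self (le_min hκ.le hθ0.le) hN1).trans (min_le_right _ _)
  have ha1 : a ≤ 1 := haθ.trans measureReal_le_one
  have haκ : a ≤ (gaussianReal 0 v).real (Set.Ioo (-(1 / (6 * k + 3) : ℝ)) (1 / (6 * k + 3))) := by
    refine le_trans ?_ hl
    rw [ha]
    gcongr
    exact min_le_left _ _
  set t : Edge → Set ℝ := fun e => if e ∈ lightEdges 0 k
    then Set.Ioo (-(1 / (6 * k + 3) : ℝ)) (1 / (6 * k + 3)) else Set.Ioi 1 with ht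
  have hsub : {J : Couplings | ∀ e ∈ barrierEdges 0 k, J e ∈ t e} ⊆ {J | IsBarrier J 0 k} := by
    intro J hJ x hx hx0
    have h1 : ∀ e ∈ lightEdges 0 k, |J e| ≤ 1 / (6 * k + 3) := by
      intro e he
      have := hJ e (Finset.mem_union_left _ he)
      simp only [ht, if_pos he, Set.mem_Ioo] at this
      exact (abs_lt.mpr this).le
    have h2 : 1 < |J (.hor x 0)| := by
      have := hJ (.hor x 0) (Finset.mem_union_right _ (Finset.mem_image_of_mem _ hx))
      have hne : Edge.hor x 0 ∉ lightEdges 0 k := by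
        rw [hor_mem_lightEdges]
        tauto
      simp only [ht, if_neg hne, Set.mem_Ioi] at this
      exact this.trans_le (le_abs_self _)
    refine lt_of_le_of_lt ((Finset.sum_le_card_nsmul _ _ _ h1).trans ?_) h2
    rw [nsmul_eq_mul, mul_one_div, div_le_one (by linarith)]
    have := card_lightEdges_le 0 k
    have h3 : ((lightEdges 0 k).card : ℝ) ≤ 4 * k + 3 := by exact_mod_cast this
    have : (0 : ℝ) ≤ k := Nat.cast_nonneg k
    linarith
  refine le_trans ?_ (measureReal_mono hsub)
  rw [couplingLaw_pi v _ (fun e => by simp only [ht]; split_ifs <;> measurability)]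
  refine (pow_le_pow_of_le_one ha0 ha1 (card_barrierEdges_le 0 k)).trans ?_
  rw [← Finset.prod_const]
  refine Finset.prod_le_prod (fun _ _ => ha0) fun e _ => ?_
  simp only [ht]
  split_ifs
  · exact haκ
  · exact haθ

/-- The probability of a barrier decays at most like `exp (-C k ^ 2)`. -/
theorem exists_neg_log_barrierProb_le {v : ℝ≥0} (hv : v ≠ 0) : ∃ C : ℝ, 0 < C ∧ ∀ k : ℕ, 1 ≤ k →
    0 < barrierProb v k ∧ -Real.log (barrierProb v k) ≤ C * k ^ 2 := by
  obtain ⟨κ, hκ, h⟩ := exists_le_barrierProb hv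
  refine ⟨81 / κ, by positivity, fun k hk => ?_⟩
  have hk' : (1 : ℝ) ≤ k := by exact_mod_cast hk
  have hpos : 0 < (κ / (6 * k + 3)) ^ (6 * k + 3) := by positivity
  refine ⟨hpos.trans_le (h k), ?_⟩
  have h1 := Real.log_le_log hpos (h k)
  rw [Real.log_pow] at h1
  -- The crude bound log y ≤ y - 1 suffices, since any polynomial bound would do; 81 comes from 6k +
  -- 3 ≤ 9k.
  have h2 : -Real.log (κ / (6 * k + 3)) ≤ (6 * k + 3) / κ := by
    rw [← Real.log_inv, inv_div]
    exact (Real.log_le_sub_one_of_pos (by positivity)).trans (by linarith)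
  push_cast at h1
  have h3 : (6 * (k : ℝ) + 3) * -Real.log (κ / (6 * k + 3)) ≤ (6 * k + 3) * ((6 * k + 3) / κ) :=
    mul_le_mul_of_nonneg_left h2 (by linarith)
  have h4 : (6 * (k : ℝ) + 3) * ((6 * k + 3) / κ) ≤ 81 / κ * k ^ 2 := by
    rw [mul_div_assoc', div_mul_eq_mul_div]
    exact div_le_div_of_nonneg_right (by nlinarith) hκ.le
  linarith

lemma barrierProb_anti (v : ℝ≥0) {k k' : ℕ} (h : k ≤ k') : barrierProb v k' ≤ barrierProb v k :=
  measureReal_mono fun _ hJ => IsBarrier.anti h hJ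

lemma barrierProb_le_one (v : ℝ≥0) (k : ℕ) : barrierProb v k ≤ 1 := measureReal_le_one

end EASpinGlass
end

/-! ### The recursion over the half-width and the conclusion -/

noncomputable section
namespace EASpinGlass
open MeasureTheory ProbabilityTheory Filter

/-! ### Comparing successive half-widths -/

lemma IsIsolation.anti {J : Couplings} {k k' : ℕ} (hk : k ≤ k') {y : ℤ}
    (h : IsIsolation J k' y) : IsIsolation J k y := by
  have hsub : Finset.Ico (-(k : ℤ)) k ⊆ Finset.Ico (-(k' : ℤ)) k' :=
    Finset.Ico_subset_Ico (by omega) (by omega)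
  refine ⟨fun x hx => h.1 x (hsub hx), fun x hx e he hne => ?_⟩
  refine lt_of_le_of_lt (Finset.sum_le_sum_of_subset_of_nonneg ?_ fun _ _ _ => abs_nonneg _)
    (h.2 x (hsub hx) e he hne)
  refine Finset.union_subset_union subset_rfl (Finset.image_subset_image ?_)
  exact Finset.product_subset_product (Finset.Icc_subset_Icc (by omega) (by omega)) subset_rfl

/-- Regularity asks for even boundaries at all smaller half-widths, hence this monotonicity; by it
the first height of R cannot drop when `k` grows. -/
lemma eventR_anti {n k k' : ℕ} (hk : k ≤ k') : eventR n k' ⊆ eventR n k := by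
  rintro J ⟨⟨h1, h2, h3, h4⟩, h5, h6⟩
  have hsub : Finset.Ico (-(k : ℤ)) k ⊆ Finset.Ico (-(k' : ℤ)) k' :=
    Finset.Ico_subset_Ico (by omega) (by omega)
  refine ⟨⟨h1, fun i hi hi' => h2 i hi (hi'.trans hk), fun p hp => h3 p ?_, fun p hp => h4 p ?_⟩,
    h5.anti hk, h6.anti hk⟩
  · exact Finset.product_subset_product hsub subset_rfl hp
  · exact Finset.product_subset_product hsub subset_rfl hp

/-- `R'(n,k)` holds for some `n ≥ k`, and `A(n,k')` holds for all `c + 1 < k' ≤ l`. -/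
def eventE (c k l : ℕ) : Set Couplings :=
  {J | ∃ n, k ≤ n ∧ J ∈ eventR' n k ∧ ∀ k', c + 1 < k' → k' ≤ l → J ∈ eventA n k'}

/-- The slice of `eventE` at a fixed height. -/
def sliceE (c n k l : ℕ) : Set Couplings :=
  {J | J ∈ eventR' n k ∧ ∀ k', c + 1 < k' → k' ≤ l → J ∈ eventA n k'}

lemma measurableSet_sliceE (c n k l : ℕ) : MeasurableSet (sliceE c n k l) := by
  refine (measurableSet_eventR' n k).inter (measurableSet_setOfPred.mpr ?_)
  exact Measurable.forall fun _ => measurable_const.imp (measurable_const.imp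
    (measurableSet_setOfPred.mp (measurableSet_eventA n _)))

lemma eventE_eq (c k l : ℕ) : eventE c k l = ⋃ i, sliceE c (k + i) k l := by
  ext J
  simp only [eventE, sliceE, Set.mem_ofPred_eq, Set.mem_iUnion]
  constructor
  · rintro ⟨n, hn, h⟩
    exact ⟨n - k, by rwa [Nat.add_sub_cancel' hn]⟩
  · rintro ⟨i, h⟩
    exact ⟨k + i, by omega, h⟩

lemma measurableSet_eventE (c k l : ℕ) : MeasurableSet (eventE c k l) := by
  rw [eventE_eq]
  exact MeasurableSet.iUnion fun i => measurableSet_sliceE _ _ _ _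

lemma pairwise_disjoint_sliceE (c k l : ℕ) :
    Pairwise (Function.onFun Disjoint fun i => sliceE c (k + i) k l) := by
  have key : ∀ i j, i < j → Disjoint (sliceE c (k + i) k l) (sliceE c (k + j) k l) := by
    intro i j hij
    rw [Set.disjoint_left]
    rintro J ⟨h1, -⟩ ⟨h2, -⟩
    exact h2.2 (k + i) (by omega) (by omega) h1.1
  intro i j hij
  rcases lt_or_gt_of_ne hij with h | h
  · exact key i j h
  · exact (key j i h).symm

lemma couplingLaw_eventE (v : ℝ≥0) (c k l : ℕ) :
    couplingLaw v (eventE c k l) = ∑' i, couplingLaw v (sliceE c (k + i) k l) := by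
  rw [eventE_eq, measure_iUnion (pairwise_disjoint_sliceE c k l)
    fun i => measurableSet_sliceE _ _ _ _]

lemma conditioning_eq {c n k : ℕ} (hk : c + 1 < k) : conditioning c n k = sliceE c n k (k - 1) := by
  ext J
  simp only [conditioning, sliceE, Set.mem_ofPred_eq]
  refine and_congr_right fun _ => forall_congr' fun k' => imp_congr_right fun _ => ?_
  rw [Nat.lt_iff_le_pred (by omega)]

lemma conditioning_inter_eventA {c n k : ℕ} (hk : c + 1 < k) :
    conditioning c n k ∩ eventA n k = sliceE c n k k := by
  ext J
  simp only [conditioning, sliceE, Set.mem_inter_iff, Set.mem_ofPred_eq, and_assoc]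
  refine and_congr_right fun _ => ⟨?_, fun h => ⟨fun k' h1 h2 => h k' h1 h2.le, h k hk le_rfl⟩⟩
  rintro ⟨h1, h2⟩ k' h3 h4
  rcases h4.lt_or_eq with h | rfl
  · exact h1 k' h3 h
  · exact h2

/-- The conditional probability bound, summed over the heights. -/
lemma couplingLaw_eventE_ge {v : ℝ≥0} {c k : ℕ} (hk : c + 1 < k) {x : ℝ}
    (h : ∀ n, k ≤ n → couplingLaw v (conditioning c n k) ≠ 0 →
      x ≤ (ProbabilityTheory.cond (couplingLaw v) (conditioning c n k)).real (eventA n k)) :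
    x * (couplingLaw v).real (eventE c k (k - 1)) ≤ (couplingLaw v).real (eventE c k k) := by
  have h1 : ENNReal.ofReal x * couplingLaw v (eventE c k (k - 1)) ≤ couplingLaw v (eventE c k k) := by
    rw [couplingLaw_eventE, couplingLaw_eventE, ← ENNReal.tsum_mul_left]
    refine ENNReal.tsum_le_tsum fun i => ?_
    rw [← conditioning_eq hk, ← conditioning_inter_eventA hk]
    by_cases h0 : couplingLaw v (conditioning c (k + i) k) = 0
    · simp [h0]
    · have h2 := h (k + i) (by omega) h0
      have hm : MeasurableSet (conditioning c (k + i) k) := by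
        rw [conditioning_eq hk]
        exact measurableSet_sliceE _ _ _ _
      rw [measureReal_def, cond_apply hm] at h2
      have h3 := ENNReal.ofReal_le_of_le_toReal h2
      calc ENNReal.ofReal x * couplingLaw v (conditioning c (k + i) k)
          ≤ ((couplingLaw v (conditioning c (k + i) k))⁻¹ *
              couplingLaw v (conditioning c (k + i) k ∩ eventA (k + i) k)) *
              couplingLaw v (conditioning c (k + i) k) := mul_le_mul_left h3 _
        _ = couplingLaw v (conditioning c (k + i) k ∩ eventA (k + i) k) := by
            rw [mul_comm, ← mul_assoc, ENNReal.mul_inv_cancel h0 (measure_ne_top _ _), one_mul]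
  have h2 := ENNReal.toReal_mono (measure_ne_top _ _) h1
  -- The bound `x` may be negative; `ENNReal.ofReal` then replaces it by zero, which only
  -- strengthens the inequality.
  rw [ENNReal.toReal_mul, ENNReal.toReal_ofReal'] at h2
  exact (mul_le_mul_of_nonneg_right (le_max_left x 0) measureReal_nonneg).trans h2

/-- The couplings for which `R(n,k)` holds too early, or the barriers come too late. -/
def eventBad (k M : ℕ) : Set Couplings :=
  (⋃ n ∈ Finset.Icc k (2 * M + 102), eventR n k) ∪
    ({J | ∀ i < M, ¬ IsBarrier J (102 + 2 * (i : ℤ)) k} ∪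
      {J | ∀ i < M, ¬ IsBarrier J (-(102 + 2 * (i : ℤ))) k})

lemma exists_first_eventR {J : Couplings} {k K : ℕ} (hK : k ≤ K)
    (h : ∃ n, K ≤ n ∧ J ∈ eventR n k) : ∃ n, k ≤ n ∧ J ∈ eventR' n k := by
  classical
  have h' : ∃ n, k ≤ n ∧ J ∈ eventR n k := by
    obtain ⟨n, h1, h2⟩ := h
    exact ⟨n, hK.trans h1, h2⟩
  refine ⟨Nat.find h', (Nat.find_spec h').1, (Nat.find_spec h').2, fun n' h1 h2 h3 => ?_⟩
  exact Nat.find_min h' h2 ⟨h1, h3⟩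

/-- Off the bad event the first height for `k` lies beyond a barrier on each side of the origin, and
the first height for `k + 1` is no smaller. So A carries over from one to the other for each
half-width up to `k`. -/
lemma mem_eventE_succ {J : Couplings} (hJ : Generic J) {c k M : ℕ} (hk : 2 ≤ k)
    (hE : J ∈ eventE c k k) (hbad : J ∉ eventBad k M)
    (hR : ∃ n, k + 1 ≤ n ∧ J ∈ eventR n (k + 1)) : J ∈ eventE c (k + 1) k := by
  obtain ⟨n, hkn, hRn, hA⟩ := hE
  obtain ⟨n', hkn', hRn'⟩ := exists_first_eventR le_rfl hR
  simp only [eventBad, Set.mem_union, Set.mem_iUnion, Set.mem_ofPred_eq, not_or, not_exists,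
    not_forall, not_not, Finset.mem_Icc] at hbad
  obtain ⟨hlate, ⟨i, hi, hBt⟩, i', hi', hBb⟩ := hbad
  have hn : 2 * M + 102 < n := by
    by_contra hc
    exact hlate n ⟨hkn, not_lt.mp hc⟩ hRn.1
  have hn' : n ≤ n' := by
    by_contra hc
    exact hRn.2 n' (by omega) (not_le.mp hc) (eventR_anti (Nat.le_succ k) hRn'.1)
  refine ⟨n', hkn', hRn', fun k' h1 h2 => ?_⟩
  have r1 : IsRegularAt J n k' := .of_eventR (by omega) (by omega) h2 hRn.1
  have r2 : IsRegularAt J n' k' := .of_eventR (by omega) (by omega) (by omega) hRn'.1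
  exact mem_eventA_of_barriers hJ r1 r2 (hBt.anti h2) (hBb.anti h2) (by omega) (by omega)
    (by omega) (by omega) (by omega) (by omega) (hA k' h1 h2)

lemma couplingLaw_eventE_succ_ge {v : ℝ≥0} (hv : v ≠ 0) {c k : ℕ} (hk : 2 ≤ k) (M : ℕ) :
    (couplingLaw v).real (eventE c k k) - (couplingLaw v).real (eventBad k M) ≤
      (couplingLaw v).real (eventE c (k + 1) k) := by
  have h1 : eventE c k k ≤ᵐ[couplingLaw v] (eventE c (k + 1) k ∪ eventBad k M : Set Couplings) := by
    filter_upwards [ae_generic hv, ae_exists_eventR hv (k := k + 1) (by omega) (k + 1)] with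
      J hJ hR hE
    by_cases hbad : J ∈ eventBad k M
    · exact Or.inr hbad
    · exact Or.inl (mem_eventE_succ hJ hk hE hbad hR)
  have h2 := ENNReal.toReal_mono (measure_ne_top _ _) (measure_mono_ae h1)
  have h3 := measureReal_union_le (μ := couplingLaw v) (eventE c (k + 1) k) (eventBad k M)
  simp only [measureReal_def] at *
  linarith

/-- A barrier through the origin gives a lower bound to start with. -/
lemma barrierProb_le_couplingLaw_eventE {v : ℝ≥0} (hv : v ≠ 0) (c : ℕ) {k : ℕ} (hk : 3 ≤ k) :
    barrierProb v k ≤ (couplingLaw v).real (eventE c k k) := by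
  have h1 : {J | IsBarrier J 0 k} ≤ᵐ[couplingLaw v] eventE c k k := by
    filter_upwards [ae_generic hv, ae_exists_eventR hv (k := k) (by omega) k] with J hJ hR hB
    obtain ⟨n, hkn, hRn⟩ := exists_first_eventR le_rfl hR
    refine ⟨n, hkn, hRn, fun k' h1 h2 => ?_⟩
    exact mem_eventA_of_barrier hJ (.of_eventR (by omega) (by omega) h2 hRn.1) (by omega)
      (IsBarrier.anti h2 hB)
  exact ENNReal.toReal_mono (measure_ne_top _ _) (measure_mono_ae h1)

/-! ### Summable errors -/

lemma couplingLaw_eventBad_le (v : ℝ≥0) {k : ℕ} (hk : 2 ≤ k) (M : ℕ) :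
    (couplingLaw v).real (eventBad k M) ≤
      (2 * M + 103) * (barrierProb v k ^ 2 * (1 / 2) ^ (4 * k - 2)) + 2 * (1 - barrierProb v k) ^ M := by
  refine (measureReal_union_le _ _).trans (add_le_add ?_ ?_)
  · refine (measureReal_biUnion_finset_le _ _).trans ?_
    refine (Finset.sum_le_card_nsmul _ _ _ fun n hn => couplingLaw_eventR_le v
      (hk.trans (Finset.mem_Icc.mp hn).1) (by omega)).trans ?_
    rw [nsmul_eq_mul]
    refine mul_le_mul_of_nonneg_right ?_ (by positivity)
    have : (Finset.Icc k (2 * M + 102)).card ≤ 2 * M + 103 := by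
      rw [Nat.card_Icc]; omega
    exact_mod_cast this
  · refine (measureReal_union_le _ _).trans ?_
    rw [couplingLaw_no_barrier v k (f := fun i => 102 + 2 * (i : ℤ)) (by intros; omega),
      couplingLaw_no_barrier v k (f := fun i => -(102 + 2 * (i : ℤ))) (by intros; omega)]
    linarith

/-- The number of heights searched must be large enough to find barriers and small enough to avoid
R; the exponential gap between R and a pair of barriers leaves room for both. The error is stated
relative to the barrier probability because the recursion starts from such a value. -/
lemma exists_couplingLaw_eventBad_le {v : ℝ≥0} (hv : v ≠ 0) : ∃ b : ℕ → ℝ, (∀ k, 0 ≤ b k) ∧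
    Summable b ∧ ∀ k, 2 ≤ k → ∃ M, (couplingLaw v).real (eventBad k M) ≤ barrierProb v k * b k := by
  obtain ⟨C, hC, hq⟩ := exists_neg_log_barrierProb_le hv
  refine ⟨fun k => (2 * k + 2 * C * k ^ 2 + 105) * (1 / 2) ^ k + 2 * Real.exp (-k),
    fun k => by positivity, ?_, fun k hk => ?_⟩
  · have hs : ∀ j : ℕ, Summable fun k : ℕ => (k : ℝ) ^ j * (1 / 2 : ℝ) ^ k := fun j =>
      summable_pow_mul_geometric_of_norm_lt_one j (by norm_num)
    refine Summable.add ?_ (Real.summable_exp_neg_nat.mul_left 2)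
    refine ((((hs 1).mul_left 2).add ((hs 2).mul_left (2 * C))).add ((hs 0).mul_left 105)).congr ?_
    intro k
    ring
  · obtain ⟨hpos, hlog⟩ := hq k (by omega)
    have hle := barrierProb_le_one v k
    set q := barrierProb v k with hqdef
    have hlog0 : Real.log q ≤ 0 := Real.log_nonpos hpos.le hle
    -- Chosen so that (1-q)^M ≤ exp(-qM) ≤ q exp(-k), while M q remains at most quadratic in k.
    set M := ⌈((k : ℝ) - Real.log q) / q⌉₊ with hM
    have hk0 : (0 : ℝ) ≤ k := Nat.cast_nonneg k
    have hM1 : ((k : ℝ) - Real.log q) / q ≤ M := Nat.le_ceil _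
    have hM2 : (M : ℝ) < ((k : ℝ) - Real.log q) / q + 1 :=
      Nat.ceil_lt_add_one (div_nonneg (by linarith) hpos.le)
    refine ⟨M, (couplingLaw_eventBad_le v hk M).trans ?_⟩
    rw [← hqdef, mul_add]
    refine add_le_add ?_ ?_
    · have h1 : (M : ℝ) * q ≤ k - Real.log q + q := by
        have := mul_le_mul_of_nonneg_right hM2.le hpos.le
        rwa [add_mul, div_mul_cancel₀ _ hpos.ne', one_mul] at this
      have h2 : (1 / 2 : ℝ) ^ (4 * k - 2) ≤ (1 / 2) ^ k :=
        pow_le_pow_of_le_one (by norm_num) (by norm_num) (by omega)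
      have h3 : (2 * M + 103) * q ≤ 2 * k + 2 * C * k ^ 2 + 105 := by nlinarith
      calc (2 * M + 103) * (q ^ 2 * (1 / 2) ^ (4 * k - 2))
          = q * (((2 * M + 103) * q) * (1 / 2) ^ (4 * k - 2)) := by ring
        _ ≤ q * ((2 * k + 2 * C * k ^ 2 + 105) * (1 / 2) ^ k) := by gcongr
    · have h1 : (1 - q) ^ M ≤ Real.exp (-q) ^ M :=
        pow_le_pow_left₀ (by linarith) (Real.one_sub_le_exp_neg q) M
      have h2 : Real.exp (-q) ^ M ≤ q * Real.exp (-k) := by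
        rw [← Real.exp_nat_mul]
        nth_rewrite 2 [← Real.exp_log hpos]
        rw [← Real.exp_add, Real.exp_le_exp]
        rw [div_le_iff₀ hpos] at hM1
        linarith
      linarith

lemma summable_inv_mul_log_rpow {ε : ℝ} (hε : 0 < ε) :
    Summable fun j : ℕ => (j : ℝ)⁻¹ * Real.log j ^ (-1 - ε) := by
  -- Replacing j by max j 2 makes the sequence nonnegative and decreasing from the start, so Cauchy
  -- condensation applies and reduces it to a p-series with exponent 1 + ε.
  set f : ℕ → ℝ := fun j => ((max j 2 : ℕ) : ℝ)⁻¹ * Real.log (max j 2 : ℕ) ^ (-1 - ε) with hf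
  have hlog : ∀ j : ℕ, 0 < Real.log (max j 2 : ℕ) := fun j =>
    Real.log_pos (by exact_mod_cast (lt_of_lt_of_le one_lt_two (le_max_right j 2)))
  have hfs : Summable f := by
    rw [← summable_condensed_iff_of_nonneg]
    · rw [← summable_nat_add_iff 1]
      have h1 : Summable fun k : ℕ => ((k + 1 : ℕ) : ℝ) ^ (-1 - ε) :=
        (summable_nat_add_iff 1).mpr (Real.summable_nat_rpow.mpr (by linarith))
      refine (h1.mul_right (Real.log 2 ^ (-1 - ε))).congr fun k => ?_
      have h2 : max (2 ^ (k + 1)) 2 = 2 ^ (k + 1) :=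
        max_eq_left (by rw [pow_succ]; have := Nat.one_le_two_pow (n := k); omega)
      simp only [hf, h2]
      push_cast
      rw [Real.log_pow, ← mul_assoc, mul_inv_cancel₀ (by positivity), one_mul,
        Real.mul_rpow (by positivity) (Real.log_nonneg (by norm_num))]
      push_cast
      rfl
    · intro j
      exact mul_nonneg (by positivity) (Real.rpow_nonneg (hlog j).le _)
    · intro i j _ hij
      have h1 : max i 2 ≤ max j 2 := max_le_max_right 2 hij
      have h2 : ((max i 2 : ℕ) : ℝ) ≤ (max j 2 : ℕ) := by exact_mod_cast h1
      have h3 : (0 : ℝ) < (max i 2 : ℕ) := by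
        exact_mod_cast (lt_of_lt_of_le zero_lt_two (le_max_right i 2))
      refine mul_le_mul (inv_anti₀ h3 h2) ?_ (Real.rpow_nonneg (hlog j).le _) (by positivity)
      exact Real.rpow_le_rpow_of_nonpos (hlog i) (Real.log_le_log h3 h2) (by linarith)
  rw [← summable_nat_add_iff 2] at hfs ⊢
  refine hfs.congr fun j => ?_
  simp only [hf, max_eq_left (show 2 ≤ j + 2 by omega)]

lemma exists_tail_le {f : ℕ → ℝ} (hf : Summable f) (h0 : ∀ k, 0 ≤ f k) {x : ℝ} (hx : 0 < x) :
    ∃ K, ∀ k, K ≤ k → ∀ i, ∑ j ∈ Finset.range i, f (j + k) ≤ x := by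
  have h1 := (tendsto_sum_nat_add f).eventually_lt_const hx
  obtain ⟨K, hK⟩ := eventually_atTop.mp h1
  refine ⟨K, fun k hk i => le_trans ?_ (hK k hk).le⟩
  exact ((summable_nat_add_iff k).mpr hf).sum_le_tsum _ fun j _ => h0 _

/-- Relative to the starting bound `A`, the losses at most add up: the product terms omitted in the
induction are nonnegative. -/
lemma recursion_lower_bound {a d e : ℕ → ℝ} {A : ℝ} (hA : 0 ≤ A) (h0 : A ≤ a 0)
    (hd : ∀ i, 0 ≤ d i ∧ d i ≤ 1) (he : ∀ i, 0 ≤ e i)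
    (hstep : ∀ i, (1 - d i) * (a i - A * e i) ≤ a (i + 1)) (i : ℕ) :
    A * (1 - ∑ j ∈ Finset.range i, d j - ∑ j ∈ Finset.range i, e j) ≤ a i := by
  induction i with
  | zero => simpa using h0
  | succ i ih =>
    rw [Finset.sum_range_succ, Finset.sum_range_succ]
    refine le_trans ?_ (hstep i)
    set x := ∑ j ∈ Finset.range i, d j with hx
    set y := ∑ j ∈ Finset.range i, e j with hy
    have hx0 : 0 ≤ x := Finset.sum_nonneg fun j _ => (hd j).1
    have hy0 : 0 ≤ y := Finset.sum_nonneg fun j _ => he j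
    obtain ⟨h1, h2⟩ := hd i
    have h3 := he i
    have h4 : (1 - d i) * (A * (1 - x - y) - A * e i) ≤ (1 - d i) * (a i - A * e i) :=
      mul_le_mul_of_nonneg_left (by linarith) (by linarith)
    refine le_trans ?_ h4
    have h5 : 0 ≤ A * (d i * (x + y + e i)) := by positivity
    nlinarith

/-- Under the finite conjecture, the probabilities of `eventE c k k` are bounded from below. -/
theorem exists_le_couplingLaw_eventE {v : ℝ≥0} (hv : v ≠ 0) (h : FiniteConjecture v) :
    ∃ (c k₀ : ℕ) (A : ℝ), 0 < A ∧ ∀ k, k₀ ≤ k → A ≤ (couplingLaw v).real (eventE c k k) := by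
  obtain ⟨c, -, ε, hε, hcond⟩ := h
  obtain ⟨b, hb0, hbs, hb⟩ := exists_couplingLaw_eventBad_le hv
  obtain ⟨C, hC, hq⟩ := exists_neg_log_barrierProb_le hv
  set d : ℕ → ℝ := fun j => (j : ℝ)⁻¹ * Real.log j ^ (-1 - ε) with hd
  have hd0 : ∀ j, 0 ≤ d j := fun j =>
    mul_nonneg (by positivity) (Real.rpow_nonneg (Real.log_natCast_nonneg j) _)
  obtain ⟨K₁, hK₁⟩ := exists_tail_le (summable_inv_mul_log_rpow hε) hd0 (x := 1 / 4) (by norm_num)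
  obtain ⟨K₂, hK₂⟩ := exists_tail_le hbs hb0 (x := 1 / 4) (by norm_num)
  -- Beyond both thresholds each kind of loss sums to at most 1/4, so half of the starting value
  -- survives. The shift `m + 1` below is k - c for the half-width k = k₀ + 1 reached by the first
  -- step.
  set m := K₁ + K₂ + 3 with hm
  set k₀ := c + m with hk₀
  have hqpos := (hq k₀ (by omega)).1
  refine ⟨c, k₀, barrierProb v k₀ / 2, by positivity, fun k hk => ?_⟩
  have hdle : ∀ i, d (i + (m + 1)) ≤ 1 := by
    intro i
    have h1 := hK₁ (m + 1) (by omega) (i + 1)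
    have h2 := Finset.single_le_sum (f := fun j => d (j + (m + 1))) (s := Finset.range (i + 1))
      (fun j _ => hd0 _) (Finset.self_mem_range_succ i)
    linarith
  have key := recursion_lower_bound (a := fun i => (couplingLaw v).real (eventE c (k₀ + i) (k₀ + i)))
    (d := fun i => d (i + (m + 1))) (e := fun i => b (i + k₀)) (A := barrierProb v k₀) hqpos.le
    (barrierProb_le_couplingLaw_eventE hv c (by omega)) (fun i => ⟨hd0 _, hdle i⟩)
    (fun i => hb0 _) ?_ (k - k₀)
  · simp only [Nat.add_sub_cancel' hk] at key
    refine le_trans ?_ key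
    have h1 := hK₁ (m + 1) (by omega) (k - k₀)
    have h2 := hK₂ k₀ (by omega) (k - k₀)
    rw [div_eq_mul_one_div]
    exact mul_le_mul_of_nonneg_left (by linarith) hqpos.le
  · intro i
    obtain ⟨M, hM⟩ := hb (k₀ + i) (by omega)
    have h1 := couplingLaw_eventE_succ_ge hv (c := c) (k := k₀ + i) (by omega) M
    have h2 := couplingLaw_eventE_ge (v := v) (c := c) (k := k₀ + i + 1) (by omega)
      (fun n hn => hcond n (k₀ + i + 1) (by omega) (by omega))
    have h3 : ((k₀ + i + 1 : ℕ) : ℝ) - c = ((i + (m + 1) : ℕ) : ℝ) := by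
      rw [hk₀]; push_cast; ring
    rw [h3] at h2
    rw [Nat.add_sub_cancel] at h2
    refine le_trans ?_ h2
    refine mul_le_mul_of_nonneg_left ?_ (by linarith [hdle i])
    -- Wider barriers are rarer, so all errors can be measured against the starting value.
    have h4 : barrierProb v (k₀ + i) * b (k₀ + i) ≤ barrierProb v k₀ * b (i + k₀) := by
      rw [add_comm i k₀]
      exact mul_le_mul_of_nonneg_right (barrierProb_anti v (by omega)) (hb0 _)
    linarith

/-- Continuity from above for the decreasing unions, each of measure at least `A`. -/
lemma measure_limsup_pos {Ω : Type*} [MeasurableSpace Ω] {μ : Measure Ω} [IsFiniteMeasure μ]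
    {E : ℕ → Set Ω} (hE : ∀ k, MeasurableSet (E k)) {A : ℝ} (hA : 0 < A) {k₀ : ℕ}
    (h : ∀ k, k₀ ≤ k → A ≤ μ.real (E k)) : 0 < μ (⋂ K, ⋃ k ≥ K, E k) := by
  have hm : ∀ K, MeasurableSet (⋃ k ≥ K, E k) := fun K =>
    MeasurableSet.iUnion fun k => MeasurableSet.iUnion fun _ => hE k
  have hanti : Antitone fun K => ⋃ k ≥ K, E k := by
    intro K L hKL
    simp only [ge_iff_le, Set.iUnion_subset_iff]
    exact fun k hk => Set.subset_iUnion₂_of_subset k (hKL.trans hk) subset_rfl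
  have ht := tendsto_measure_iInter_atTop (μ := μ) (fun K => (hm K).nullMeasurableSet) hanti
    ⟨0, measure_ne_top _ _⟩
  refine lt_of_lt_of_le (ENNReal.ofReal_pos.mpr hA) (ge_of_tendsto' ht fun K => ?_)
  refine ENNReal.ofReal_le_of_le_toReal ((h (max K k₀) (le_max_right _ _)).trans ?_)
  exact ENNReal.toReal_mono (measure_ne_top _ _)
    (measure_mono (Set.subset_iUnion₂_of_subset _ (le_max_left K k₀) subset_rfl))

theorem incongruenceConjecture_of_finiteConjecture {v : ℝ≥0} (hv : v ≠ 0)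
    (h : FiniteConjecture v) : IncongruenceConjecture v := by
  obtain ⟨c, k₀, A, hA, hE⟩ := exists_le_couplingLaw_eventE hv h
  have hpos := measure_limsup_pos (fun k => measurableSet_eventE c k k) hA hE
  -- Removing a measurable null superset of the nongeneric couplings keeps the event measurable.
  set N := toMeasurable (couplingLaw v) {J | ¬ Generic J} with hN
  have hN0 : couplingLaw v N = 0 := by
    rw [hN, measure_toMeasurable]
    exact ae_iff.mp (ae_generic hv)
  refine ⟨(⋂ K, ⋃ k ≥ K, eventE c k k) \ N, ?_, ?_, ?_⟩
  · exact (MeasurableSet.iInter fun K => MeasurableSet.iUnion fun k => MeasurableSet.iUnion fun _ =>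
      measurableSet_eventE c k k).diff (measurableSet_toMeasurable _ _)
  · rwa [measure_sdiff_null hN0]
  · rintro J ⟨hJ, hJN⟩
    have hgen : Generic J := by
      by_contra hc
      exact hJN (subset_toMeasurable _ _ hc)
    refine exists_incongruent_limits hgen fun K => ?_
    simp only [Set.mem_iInter, Set.mem_iUnion] at hJ
    -- From `c + 2` on, `k` itself is among the half-widths for which the event provides A.
    obtain ⟨k, hk, n, hkn, hR, hAn⟩ := hJ (max K (c + 2))
    have h1 := le_max_left K (c + 2)
    have h2 := le_max_right K (c + 2)
    exact ⟨n, k, by omega, hkn, hR.1, hAn k (by omega) le_rfl⟩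

end EASpinGlass

end

theorem theorem1 (v : ℝ≥0) (hv : v ≠ 0) (h : EASpinGlass.FiniteConjecture v) :
    EASpinGlass.IncongruenceConjecture v :=
  EASpinGlass.incongruenceConjecture_of_finiteConjecture hv h
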